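/- Let $n>2$ be an integer, $0<\mu<\frac{n-1}{2}$ real, and $j\ge 0$ an integer with $\mu+j<\frac{n-2}{2}$. Let $H=SO_0(n,1)$ and let $H_1=SO_0(n-1,1)\subset H$ be the subgroup that fixes the last space coordinate vector, so that $H$ and $H_1$ act by conformal transformations on $\mathbb R^{n-1}\cup\{\infty\}$ and on $\mathbb R^{n-2}\cup\{\infty\}$, where $\mathbb R^{n-2}=\{x_{n-1}=0\}$. For $d\ge 1$ and $\lambda\in\mathbb R$ let $SO_0(d+1,1)$ act on functions on $\mathbb R^d$ by $\pi_\lambda(h)f(x)=t^{-\lambda}f(h^{-1}x)$, where $h^{-1}\iota(x)=t\,\iota(h^{-1}x)$ and $\iota(x)=\big(\tfrac{1-|x|^2}{2},x,\tfrac{1+|x|^2}{2}\big)$ is the lift of $x$ to the light cone. For $\frac d2<\lambda<d$ let $\mathcal C_\lambda(\mathbb R^d)$ be the Hilbert space of the tempered distributions $f$ on $\mathbb R^d$ whose Fourier transform is a function $\hat f$ with $\|f\|_\lambda^2=\int_{\mathbb R^d}|\hat f(\xi)|^2|\xi|^{d-2\lambda}\,d\xi<\infty$. The operators $\pi_\lambda(h)$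 on $C_c^\infty(\mathbb R^d)$ extend to a (strongly continuous) unitary representation of $SO_0(d+1,1)$ on $\mathcal C_\lambda(\mathbb R^d)$, the complementary series representation $\pi_\lambda$. In particular this defines $\pi_{n-1-\mu}$ of $H$ (with $d=n-1$) and $\pi_{n-2-(\mu+j)}$ of $H_1$ (with $d=n-2$). There are constants $C_{\mu,k}$, $0\le 2k\le j$, depending on $\mu,j,n$, with $C_{\mu,0}=1$, such that the differential operator $$\mathcal D_{\mu,j}f(y)=\Big(\sum_{2k\le j}C_{\mu,k}\,\partial_{n-1}^{\,j-2k}\Delta_{n-2}^{k}f\Big)(y,0),\qquad \Delta_{n-2}=\partial_1^2+\dots+\partial_{n-2}^2,$$ intertwines the restriction to $H_1$ of the action $\pi_\mu$ of $H$ on $C^\infty_\mu(\mathbb R^{n-1})$ with the action $\pi_{\mu+j}$ of $H_1$ on functions on $\mathbb R^{n-2}$. Here $C^\infty_\mu(\mathbb R^{n-1})$ is the space of functions $\big(\tfrac{1+|x|^2}{2}\big)^{-\mu}\varphi(u(x))$ with $\varphi$ smooth on the sphere $S^{n-1}$ and $u$ the stereographic parametrization, $\iota(x)=\tfrac{1+|x|^2}{2}(u(x),1)$.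 For any such constants the following holds: $\pi_{n-2-(\mu+j)}$ of $H_1$ is unitarily equivalent to a subrepresentation (on a closed $H_1$-invariant nonzero subspace) of the restriction of $\pi_{n-1-\mu}$ to $H_1$. This subspace, as a space of distributions on $\mathbb R^{n-1}$, is $$\Big\{F:\ F(y,x_{n-1})=\sum_{2k\le j}C_{\mu,k}\,\partial_{n-1}^{\,j-2k}\Delta_{n-2}^{k}\big(f(y)\,\delta(x_{n-1})\big),\quad f\in\mathcal C_{n-2-(\mu+j)}(\mathbb R^{n-2})\Big\},$$ where $\delta$ is the Dirac delta, and the map $f\mapsto F$ is a positive multiple of a unitary $H_1$-equivalence. -/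

import Mathlib

open MeasureTheory SchwartzMap FourierTransform LineDeriv
open scoped ContDiff Matrix ENNReal

/-! ## Lorentz groups -/

/-- Index set of `ℝ^{d+1,1}`: the space coordinates `inl 0, …, inl d` and the time coordinate
`inr 0`. -/
abbrev LIdx (d : ℕ) : Type := Fin (d + 1) ⊕ Fin 1

/-- The group `SO(d+1,1)` of real matrices of determinant one which preserve the form
`x₀² + ⋯ + x_d² - t²`. -/
def lorentzSO (d : ℕ) : Subgroup (Matrix.SpecialLinearGroup (LIdx d) ℝ) where
  carrier := {g | (g : Matrix (LIdx d) (LIdx d) ℝ)ᵀ *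
    LieAlgebra.Orthogonal.indefiniteDiagonal (Fin (d + 1)) (Fin 1) ℝ *
      (g : Matrix (LIdx d) (LIdx d) ℝ) =
    LieAlgebra.Orthogonal.indefiniteDiagonal (Fin (d + 1)) (Fin 1) ℝ}
  one_mem' := by simp
  mul_mem' := by
    intro a b ha hb
    simp only [Set.mem_ofPred_eq, Matrix.SpecialLinearGroup.coe_mul, Matrix.transpose_mul] at *
    calc _ = (b : Matrix (LIdx d) (LIdx d) ℝ)ᵀ * ((a : Matrix (LIdx d) (LIdx d) ℝ)ᵀ *
        LieAlgebra.Orthogonal.indefiniteDiagonal (Fin (d + 1)) (Fin 1) ℝ *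
        (a : Matrix (LIdx d) (LIdx d) ℝ)) * b := by simp only [Matrix.mul_assoc]
      _ = _ := by rw [ha, hb]
  inv_mem' := by
    intro a ha
    simp only [Set.mem_ofPred_eq] at *
    have h1 : (a : Matrix (LIdx d) (LIdx d) ℝ) * ((a⁻¹ : Matrix.SpecialLinearGroup (LIdx d) ℝ) :
        Matrix (LIdx d) (LIdx d) ℝ) = 1 := by
      rw [← Matrix.SpecialLinearGroup.coe_mul]; simp
    have h2 := congrArg Matrix.transpose h1
    rw [Matrix.transpose_mul, Matrix.transpose_one] at h2
    conv_lhs => rw [← ha]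
    calc _ = (((a⁻¹ : Matrix.SpecialLinearGroup (LIdx d) ℝ) : Matrix (LIdx d) (LIdx d) ℝ)ᵀ *
          (a : Matrix (LIdx d) (LIdx d) ℝ)ᵀ) *
        LieAlgebra.Orthogonal.indefiniteDiagonal (Fin (d + 1)) (Fin 1) ℝ *
        ((a : Matrix (LIdx d) (LIdx d) ℝ) * ((a⁻¹ : Matrix.SpecialLinearGroup (LIdx d) ℝ) :
        Matrix (LIdx d) (LIdx d) ℝ)) := by simp only [Matrix.mul_assoc]
      _ = _ := by rw [h1, h2]; simp

/-- The group `SO₀(d+1,1)`: the identity component of `SO(d+1,1)`. -/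
abbrev SO0 (d : ℕ) : Type := Subgroup.connectedComponentOfOne (lorentzSO d)

/-- The matrix of an element of `SO₀(d+1,1)`. -/
def SO0.mat {d : ℕ} (h : SO0 d) : Matrix (LIdx d) (LIdx d) ℝ :=
  ((h : lorentzSO d) : Matrix.SpecialLinearGroup (LIdx d) ℝ)

/-- The coordinates of `ℝ^{d+2,1}` are those of `ℝ^{d+1,1}` and one more, the last space
coordinate. -/
def idxEquiv (d : ℕ) : LIdx d ⊕ Fin 1 ≃ LIdx (d + 1) :=
  (Equiv.sumAssoc _ _ _).trans <| ((Equiv.refl _).sumCongr (Equiv.sumComm _ _)).trans <|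
    (Equiv.sumAssoc _ _ _).symm.trans <| (finSumFinEquiv (m := d + 1) (n := 1)).sumCongr (Equiv.refl _)

/-- Extension of a matrix by the identity on the last space coordinate. -/
def extendMat {d : ℕ} (A : Matrix (LIdx d) (LIdx d) ℝ) : Matrix (LIdx (d + 1)) (LIdx (d + 1)) ℝ :=
  Matrix.reindex (idxEquiv d) (idxEquiv d) (Matrix.fromBlocks A 0 0 1)

theorem extendMat_mul {d : ℕ} (A B : Matrix (LIdx d) (LIdx d) ℝ) :
    extendMat (A * B) = extendMat A * extendMat B := by
  simp [extendMat, Matrix.submatrix_mul_equiv, Matrix.fromBlocks_multiply]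

theorem extendMat_form (d : ℕ) :
    extendMat (LieAlgebra.Orthogonal.indefiniteDiagonal (Fin (d + 1)) (Fin 1) ℝ) =
      LieAlgebra.Orthogonal.indefiniteDiagonal (Fin (d + 1 + 1)) (Fin 1) ℝ := by
  have h : Matrix.fromBlocks (LieAlgebra.Orthogonal.indefiniteDiagonal (Fin (d + 1)) (Fin 1) ℝ)
      0 0 (1 : Matrix (Fin 1) (Fin 1) ℝ) =
      Matrix.diagonal (Sum.elim (Sum.elim (fun _ => 1) fun _ => -1) fun _ => 1) := by
    rw [LieAlgebra.Orthogonal.indefiniteDiagonal, ← Matrix.diagonal_one,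
      Matrix.fromBlocks_diagonal]
  rw [extendMat, h, LieAlgebra.Orthogonal.indefiniteDiagonal, Matrix.reindex_apply,
    Matrix.submatrix_diagonal_equiv]
  congr 1
  ext i
  rcases i with i | i
  · induction i using Fin.lastCases with
    | last =>
      have h : (idxEquiv d).symm (Sum.inl (Fin.last (d + 1))) = Sum.inr 0 := by
        rw [Equiv.symm_apply_eq]; simp [idxEquiv]; rfl
      simp [h]
    | cast i =>
      have h : (idxEquiv d).symm (Sum.inl i.castSucc) = Sum.inl (Sum.inl i) := by
        rw [Equiv.symm_apply_eq]; simp [idxEquiv]; rfl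
      simp [h]
  · rfl

theorem mem_lorentzSO {d : ℕ} {g : Matrix.SpecialLinearGroup (LIdx d) ℝ} :
    g ∈ lorentzSO d ↔ (g : Matrix (LIdx d) (LIdx d) ℝ)ᵀ *
      LieAlgebra.Orthogonal.indefiniteDiagonal (Fin (d + 1)) (Fin 1) ℝ *
        (g : Matrix (LIdx d) (LIdx d) ℝ) =
      LieAlgebra.Orthogonal.indefiniteDiagonal (Fin (d + 1)) (Fin 1) ℝ := Iff.rfl

theorem extendMat_one (d : ℕ) : extendMat (1 : Matrix (LIdx d) (LIdx d) ℝ) = 1 := by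
  simp [extendMat]

theorem extendMat_transpose {d : ℕ} (A : Matrix (LIdx d) (LIdx d) ℝ) :
    (extendMat A)ᵀ = extendMat Aᵀ := by
  simp [extendMat, Matrix.fromBlocks_transpose]

/-- The standard embedding `SO(d+1,1) → SO(d+2,1)`. -/
def extendSO (d : ℕ) : lorentzSO d →* lorentzSO (d + 1) where
  toFun g := ⟨⟨extendMat (g : Matrix.SpecialLinearGroup (LIdx d) ℝ), by
    simp [extendMat]⟩, mem_lorentzSO.2 <| by
    have hg := mem_lorentzSO.1 g.2
    change (extendMat _)ᵀ * _ * extendMat _ = _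
    rw [← extendMat_form, extendMat_transpose, ← extendMat_mul, ← extendMat_mul, hg]⟩
  map_one' := Subtype.ext <| Subtype.ext <| extendMat_one d
  map_mul' a b := Subtype.ext <| Subtype.ext <| extendMat_mul _ _

theorem continuous_extendSO (d : ℕ) : Continuous (extendSO d) := by
  refine Continuous.subtype_mk (Continuous.subtype_mk ?_ _) _
  refine Continuous.matrix_reindex (Continuous.matrix_fromBlocks ?_ continuous_const
    continuous_const continuous_const) _ _
  exact continuous_subtype_val.comp continuous_subtype_val

/-- The standard embedding `SO₀(d+1,1) → SO₀(d+2,1)`; its image fixes the last space coordinate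
vector. -/
def extendSO0 (d : ℕ) : SO0 d →* SO0 (d + 1) :=
  ((extendSO d).comp (Subgroup.subtype _)).codRestrict _ fun h => by
    have h1 := (continuous_extendSO d).image_connectedComponent_subset 1 ⟨_, h.2, rfl⟩
    rw [map_one] at h1
    exact h1


/-! ## Conformal action on `ℝ^d` and the spherical principal series -/

/-- The Euclidean space `ℝ^d`. -/
abbrev RSpace (d : ℕ) : Type := EuclideanSpace ℝ (Fin d)

/-- The lift of `x ∈ ℝ^d` to the forward light cone of `ℝ^{d+1,1}`:
`((1 - |x|²)/2, x, (1 + |x|²)/2)`. -/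
noncomputable def coneVec {d : ℕ} (x : RSpace d) : LIdx d → ℝ :=
  Sum.elim (Fin.cons ((1 - ‖x‖ ^ 2) / 2) fun i => x i) fun _ => (1 + ‖x‖ ^ 2) / 2

/-- The vector `h⁻¹ · coneVec x` of the light cone. -/
noncomputable def movedCone {d : ℕ} (h : SO0 d) (x : RSpace d) : LIdx d → ℝ :=
  (h⁻¹).mat *ᵥ coneVec x

/-- The number `t ≥ 0` with `h⁻¹ · coneVec x = t • coneVec y`. It vanishes exactly if `h⁻¹` maps `x`
to the point at infinity. -/
noncomputable def confFactor {d : ℕ} (h : SO0 d) (x : RSpace d) : ℝ :=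
  movedCone h x (Sum.inl 0) + movedCone h x (Sum.inr 0)

/-- The point `y = h⁻¹ x` with `h⁻¹ · coneVec x = t • coneVec y`. -/
noncomputable def confPoint {d : ℕ} (h : SO0 d) (x : RSpace d) : RSpace d :=
  WithLp.toLp 2 fun i : Fin d => movedCone h x (Sum.inl i.succ) / confFactor h x

/-- The operator `π_lam(h)` of the spherical principal series of `SO₀(d+1,1)` on functions on
`ℝ^d`: functions `Φ` on the forward light cone, homogeneous of degree `-lam`, are moved
to `Φ(h⁻¹ ·)`, and `f(x) = Φ(coneVec x)`. -/
noncomputable def principalAct {d : ℕ} (lam : ℝ) (h : SO0 d) (f : RSpace d → ℂ) : RSpace d → ℂ :=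
  fun x => ((confFactor h x ^ (-lam) : ℝ) : ℂ) * f (confPoint h x)

/-- The space `C^∞_lam(ℝ^d)` of smooth vectors of `π_lam`: the functions on `ℝ^d` that come from
smooth functions `φ` on the sphere `S^d`, through stereographic projection. -/
def IsSmoothVector {d : ℕ} (lam : ℝ) (f : RSpace d → ℂ) : Prop :=
  ∃ φ : RSpace (d + 1) → ℂ, ContDiff ℝ ∞ φ ∧ ∀ x : RSpace d,
    f x = ((((1 + ‖x‖ ^ 2) / 2) ^ (-lam) : ℝ) : ℂ) *
      φ (WithLp.toLp 2 fun i : Fin (d + 1) =>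
        coneVec x (Sum.inl i) / coneVec x (Sum.inr 0))

/-! ## The complementary series -/

/-- The measure `|ξ|^{d - 2 lam} dξ` on `ℝ^d`. -/
noncomputable def csMeasure (d : ℕ) (lam : ℝ) : Measure (RSpace d) :=
  volume.withDensity fun ξ => ENNReal.ofReal (‖ξ‖ ^ ((d : ℝ) - 2 * lam))

/-- The Hilbert space of the complementary series `π_lam` of `SO₀(d+1,1)`, in the Fourier picture:
Fourier transforms of distributions, with norm `∫ |v(ξ)|² |ξ|^{d - 2 lam} dξ`. -/
abbrev CSpace (d : ℕ) (lam : ℝ) : Type := Lp ℂ 2 (csMeasure d lam)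

/-- `U` is the complementary series representation `π_lam` of `SO₀(d+1,1)`: the (strongly
continuous) unitary representation on `CSpace d lam` which is given on `C_c^∞(ℝ^d)`, by the
operators of the principal series. As `CSpace d lam` is in the Fourier picture, `f` enters through
its Fourier transform. -/
structure IsCompSeries (d : ℕ) (lam : ℝ) (U : SO0 d →* (CSpace d lam ≃ₗᵢ[ℂ] CSpace d lam)) :
    Prop where
  formula : ∀ (h : SO0 d) (f : RSpace d → ℂ), ContDiff ℝ ∞ f → HasCompactSupport f →
    ∃ v w : CSpace d lam, v =ᵐ[volume] 𝓕 f ∧ w =ᵐ[volume] 𝓕 (principalAct lam h f) ∧ U h v = w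
  continuous : ∀ v : CSpace d lam, Continuous fun h => U h v

open Classical in
/-- The complementary series representation `π_lam` of `SO₀(d+1,1)` (and the trivial one
for those `lam` for which there is none). -/
noncomputable def compSeries (d : ℕ) (lam : ℝ) : SO0 d →* (CSpace d lam ≃ₗᵢ[ℂ] CSpace d lam) :=
  if h : ∃ U, IsCompSeries d lam U then h.choose else 1

/-! ## Realization by tempered distributions -/

/-- An exponent which is large enough for the next definition. -/
noncomputable def bigExp (d : ℕ) (lam : ℝ) : ℕ := ⌈|lam| + d⌉₊ + 1

theorem integrable_of_CSpace {d : ℕ} {lam : ℝ} (hlam : (d : ℝ) ≤ 2 * lam) (v : CSpace d lam) :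
    Integrable (fun ξ : RSpace d => (((1 + ‖ξ‖ ^ 2) ^ bigExp d lam : ℝ) : ℂ)⁻¹ * v ξ) volume := by
  by_cases hd : d = 0
  · subst hd
    exact Integrable.of_finite
  have : Nonempty (Fin d) := ⟨⟨0, Nat.pos_of_ne_zero hd⟩⟩
  have hne : ∀ᵐ ξ : RSpace d, ξ ≠ 0 := by
    have := measure_singleton (μ := (volume : Measure (RSpace d))) 0
    exact compl_mem_ae_iff.2 this
  have hwm : Measurable fun ξ : RSpace d => ENNReal.ofReal (‖ξ‖ ^ ((d : ℝ) - 2 * lam)) := by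
    fun_prop
  have hac : (volume : Measure (RSpace d)) ≪ csMeasure d lam := by
    refine withDensity_absolutelyContinuous' hwm.aemeasurable ?_
    filter_upwards [hne] with ξ hξ
    have : 0 < ‖ξ‖ := norm_pos_iff.2 hξ
    simpa using Real.rpow_pos_of_pos this _
  have hvm : AEStronglyMeasurable v (volume : Measure (RSpace d)) :=
    (Lp.aestronglyMeasurable v).mono_ac hac
  have hv2 : Integrable (fun ξ : RSpace d => ‖ξ‖ ^ ((d : ℝ) - 2 * lam) * ‖v ξ‖ ^ 2) volume := by
    have h : Integrable (fun ξ : RSpace d => ‖v ξ‖ ^ 2) (volume.withDensity fun ξ : RSpace d =>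
        ENNReal.ofReal (‖ξ‖ ^ ((d : ℝ) - 2 * lam))) :=
      (Lp.memLp v).integrable_norm_pow (by norm_num)
    rw [integrable_withDensity_iff_integrable_smul₀' hwm.aemeasurable (by simp)] at h
    refine h.congr (Filter.Eventually.of_forall fun ξ => ?_)
    simp [ENNReal.toReal_ofReal (Real.rpow_nonneg (norm_nonneg ξ) _)]
  have hpow : Integrable (fun ξ : RSpace d => ((1 : ℝ) + ‖ξ‖ ^ 2) ^ (-((d : ℝ) + 1) / 2))
      volume := integrable_rpow_neg_one_add_norm_sq (by simp)
  refine (hv2.add hpow).mono' ?_ ?_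
  · refine AEStronglyMeasurable.mul ?_ hvm
    exact Measurable.aestronglyMeasurable (by fun_prop)
  filter_upwards [hne] with ξ hξ
  have hr : 0 < ‖ξ‖ := norm_pos_iff.2 hξ
  set r := ‖ξ‖
  set N := bigExp d lam with hN
  have h1 : (1 : ℝ) ≤ 1 + r ^ 2 := by nlinarith
  have hP : (0 : ℝ) < (1 + r ^ 2) ^ N := by positivity
  have ha : 0 < r ^ ((d : ℝ) - 2 * lam) := Real.rpow_pos_of_pos hr _
  have hinv : r ^ (2 * lam - (d : ℝ)) * r ^ ((d : ℝ) - 2 * lam) = 1 := by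
    rw [← Real.rpow_add hr]; simp
  have hNle : |lam| + d + 1 ≤ (N : ℝ) := by
    have := Nat.le_ceil (|lam| + (d : ℝ))
    rw [hN, bigExp]; push_cast; linarith
  have hb : r ^ (2 * lam - (d : ℝ)) ≤ (1 + r ^ 2) ^ (lam - (d : ℝ) / 2) := by
    have e : (2 * lam - (d : ℝ)) = 2 * (lam - (d : ℝ) / 2) := by ring
    rw [e, Real.rpow_mul hr.le]
    refine Real.rpow_le_rpow (by positivity) ?_ (by linarith)
    rw [Real.rpow_two]; linarith
  have hc : r ^ (2 * lam - (d : ℝ)) * (((1 + r ^ 2) ^ N)⁻¹) ^ 2 ≤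
      (1 + r ^ 2) ^ (-((d : ℝ) + 1) / 2) := by
    have e : (((1 + r ^ 2) ^ N)⁻¹) ^ 2 = (1 + r ^ 2) ^ (-(2 * N : ℝ)) := by
      rw [Real.rpow_neg (by positivity), inv_pow, ← pow_mul, ← Real.rpow_natCast]
      push_cast; rw [mul_comm (N : ℝ)]
    calc _ ≤ (1 + r ^ 2) ^ (lam - (d : ℝ) / 2) * (1 + r ^ 2) ^ (-(2 * N : ℝ)) := by
          rw [e]; gcongr
      _ = (1 + r ^ 2) ^ (lam - (d : ℝ) / 2 + -(2 * N : ℝ)) := by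
          rw [← Real.rpow_add (by positivity)]
      _ ≤ _ := by
          refine Real.rpow_le_rpow_of_exponent_le h1 ?_
          have := le_abs_self lam
          have := abs_nonneg lam
          have : (0 : ℝ) ≤ d := by positivity
          linarith
  have hnorm : ‖(((1 + r ^ 2) ^ N : ℝ) : ℂ)⁻¹ * v ξ‖ = ((1 + r ^ 2) ^ N)⁻¹ * ‖v ξ‖ := by
    rw [norm_mul, norm_inv, Complex.norm_of_nonneg hP.le]
  rw [hnorm]
  refine le_trans ?_ (add_le_add le_rfl hc)
  set a := r ^ ((d : ℝ) - 2 * lam)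
  set b := r ^ (2 * lam - (d : ℝ))
  set p := ((1 + r ^ 2) ^ N)⁻¹
  set V := ‖v ξ‖
  have hb0 : 0 < b := Real.rpow_pos_of_pos hr _
  have key : a * (a * V ^ 2 + b * p ^ 2 - p * V) = (a * V - p / 2) ^ 2 + 3 / 4 * p ^ 2 := by
    linear_combination p ^ 2 * hinv
  linarith [
    (mul_nonneg_iff_of_pos_left ha).1 (key ▸ (by positivity :
      0 ≤ (a * V - p / 2) ^ 2 + 3 / 4 * p ^ 2))]

/-- The tempered distribution on `ℝ^d` with Fourier transform `v`, for `v ∈ CSpace d lam`. The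
parameters of interest satisfy `d ≤ 2 lam`; the value for the others is irrelevant. -/
noncomputable def toDist {d : ℕ} {lam : ℝ} (v : CSpace d lam) : 𝓢'(RSpace d, ℂ) :=
  if hlam : (d : ℝ) ≤ 2 * lam then
    𝓕⁻ (TemperedDistribution.smulLeftCLM ℂ
      (fun ξ : RSpace d => (((1 + ‖ξ‖ ^ 2) ^ bigExp d lam : ℝ) : ℂ))
      (Lp.toTemperedDistribution (memLp_one_iff_integrable.2 (integrable_of_CSpace hlam v)).toLp))
  else 0

/-- The Fourier transform of `toDist v` is the function `v`. -/
theorem fourier_toDist {d : ℕ} {lam : ℝ} (hlam : (d : ℝ) ≤ 2 * lam) (v : CSpace d lam)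
    (φ : 𝓢(RSpace d, ℂ)) : 𝓕 (toDist v) φ = ∫ ξ, φ ξ * v ξ := by
  have hg : (fun ξ : RSpace d => (((1 + ‖ξ‖ ^ 2) ^ bigExp d lam : ℝ) : ℂ)).HasTemperateGrowth := by
    fun_prop
  rw [toDist, dif_pos hlam, FourierInvPair.fourier_fourierInv_eq]
  rw [TemperedDistribution.smulLeftCLM_apply_apply, Lp.toTemperedDistribution_apply]
  refine integral_congr_ae ?_
  filter_upwards [(memLp_one_iff_integrable.2 (integrable_of_CSpace hlam v)).coeFn_toLp] with ξ hξ
  have hP : (((1 + ‖ξ‖ ^ 2) ^ bigExp d lam : ℝ) : ℂ) ≠ 0 := by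
    exact_mod_cast (by positivity : (0 : ℝ) < (1 + ‖ξ‖ ^ 2) ^ bigExp d lam).ne'
  rw [hξ, SchwartzMap.smulLeftCLM_apply_apply hg]
  simp only [smul_eq_mul]
  field_simp

/-- The inclusion `y ↦ (y, 0)` of `ℝ^d` in `ℝ^{d+1}`. -/
noncomputable def incl (d : ℕ) : RSpace d →ₗᵢ[ℝ] RSpace (d + 1) where
  toFun y := WithLp.toLp 2 (Fin.snoc (fun i => y i) 0 : Fin (d + 1) → ℝ)
  map_add' y z := by
    ext i
    induction i using Fin.lastCases <;> simp
  map_smul' c y := by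
    ext i
    induction i using Fin.lastCases <;> simp
  norm_map' y := by
    simp [EuclideanSpace.norm_eq, Fin.sum_univ_castSucc]

/-- Restriction of Schwartz functions from `ℝ^{d+1}` to the hyperplane `ℝ^d`. -/
noncomputable def restrictCLM (d : ℕ) : 𝓢(RSpace (d + 1), ℂ) →L[ℂ] 𝓢(RSpace d, ℂ) :=
  SchwartzMap.compCLMOfAntilipschitz ℂ (incl d).toContinuousLinearMap.hasTemperateGrowth
    (incl d).antilipschitz

/-- The distribution `f(y) δ(x_{d+1})` on `ℝ^{d+1}`. -/
noncomputable def tensorDelta {d : ℕ} (f : 𝓢'(RSpace d, ℂ)) : 𝓢'(RSpace (d + 1), ℂ) :=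
  PointwiseConvergenceCLM.precomp ℂ (restrictCLM d) f

/-! ## The differential operators -/

/-- The `i`-th unit vector of `ℝ^m`. -/
noncomputable abbrev unitVec {m : ℕ} (i : Fin m) : RSpace m := EuclideanSpace.single i 1

/-- `∂_i` on functions on `ℝ^m`. -/
noncomputable def pderivFun {m : ℕ} (i : Fin m) (f : RSpace m → ℂ) : RSpace m → ℂ :=
  fun x => lineDeriv ℝ f x (unitVec i)

/-- The Laplacian in the first `d` variables, on functions on `ℝ^{d+1}`. -/
noncomputable def horLapFun {d : ℕ} (f : RSpace (d + 1) → ℂ) : RSpace (d + 1) → ℂ :=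
  ∑ i : Fin d, pderivFun i.castSucc (pderivFun i.castSucc f)

/-- The operator `∑_{2k ≤ j} C_k ∂_{d+1}^{j-2k} Δ_d^k` on functions on `ℝ^{d+1}`. -/
noncomputable def diffOpFun {d : ℕ} (j : ℕ) (C : ℕ → ℂ) (f : RSpace (d + 1) → ℂ) :
    RSpace (d + 1) → ℂ :=
  ∑ k ∈ Finset.range (j / 2 + 1), C k • (pderivFun (Fin.last d))^[j - 2 * k] (horLapFun^[k] f)

/-- `∂_i` on tempered distributions on `ℝ^m`. -/
noncomputable def pderivDist {m : ℕ} (i : Fin m) (F : 𝓢'(RSpace m, ℂ)) : 𝓢'(RSpace m, ℂ) :=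
  ∂_{unitVec i} F

/-- The Laplacian in the first `d` variables, on tempered distributions on `ℝ^{d+1}`. -/
noncomputable def horLapDist {d : ℕ} (F : 𝓢'(RSpace (d + 1), ℂ)) : 𝓢'(RSpace (d + 1), ℂ) :=
  ∑ i : Fin d, pderivDist i.castSucc (pderivDist i.castSucc F)

/-- The operator `∑_{2k ≤ j} C_k ∂_{d+1}^{j-2k} Δ_d^k` on tempered distributions on `ℝ^{d+1}`. -/
noncomputable def diffOpDist {d : ℕ} (j : ℕ) (C : ℕ → ℂ) (F : 𝓢'(RSpace (d + 1), ℂ)) :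
    𝓢'(RSpace (d + 1), ℂ) :=
  ∑ k ∈ Finset.range (j / 2 + 1), C k • (pderivDist (Fin.last d))^[j - 2 * k] (horLapDist^[k] F)

/-- `C 0, …, C ⌊j/2⌋` are the constants `C_{mu,k}`, normalized by `C 0 = 1`, of the intertwining
differential operator
`D f (y) = (∑_{2k ≤ j} C_k ∂_{d+1}^{j-2k} Δ_d^k f) (y, 0)`
of `SO₀(d+1,1)` from `C^∞_mu(ℝ^{d+1})` to `C^∞_{mu+j}(ℝ^d)`. The relation is
stated at all points `y` of `ℝ^d` which `h⁻¹` does not map to infinity, i.e. at all but at most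
one. -/
structure IsIntertwiningCoeff (d : ℕ) (mu : ℝ) (j : ℕ) (C : ℕ → ℂ) : Prop where
  normalized : C 0 = 1
  intertwines : ∀ (h : SO0 d) (f : RSpace (d + 1) → ℂ), IsSmoothVector mu f →
    ∀ y : RSpace d, confFactor h y ≠ 0 →
      diffOpFun j C (principalAct mu (extendSO0 d h) f) (incl d y) =
        principalAct (mu + j) h (fun z => diffOpFun j C f (incl d z)) y

/-! ### The Lorentz form, the forward light cone and the conformal action. -/

section LorentzGeometry

/-! Put d = n - 2, lam = d + 1 - mu and lam' = d - (mu + j). On the Fourier side f(y) δ(x_{d+1}) is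
the function f̂(ξ), constant in the normal frequency η, and the differential operator multiplies it
by (2πi)^j P(ξ, η), where P = ∑ C_k η^{j-2k} |ξ|^{2k} is homogeneous of degree j. The substitution η
= |ξ| u shows that the integral of |(ξ, η)|^{d+1-2 lam} |P|² over η is a constant times |ξ|^{d-2
lam'}. The constant is finite because mu + j < d/2 and positive because C_0 = 1. So f ↦ F is a
positive multiple of an isometry (`norm_breakMul`, `diffOpDist_tensorDelta`), and its range is
closed.

Equivariance is where the values of the C_k matter. Conformality makes the kernel x_{d+1}^j |x -
(y,0)|^{-2(mu+j)} covariant under H_1 (`breaking_kernel_covariant`), so the form which it defines on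
pairs of functions is invariant under π_lam' and the restriction of π_lam. If the power of the norm
is written as a superposition of Gaussians, the Fourier transform of the kernel turns out to be, up
to a constant, |ζ|^{-2ν} times an explicit homogeneous polynomial, with ν = (d+1)/2 - mu
(`kernel_fourier_identity`). Since |ζ|^{-2ν} is the weight of the norm of π_lam, multiplication by
this polynomial, whose coefficients are `breakCoeff`, is an intertwining operator
(`breakMul_compSeries`). The same computation for the Riesz kernel |x - y|^{-2(d-lam)} expresses the
norm of the complementary series by an invariant kernel and gives the existence of the unitary
representations (`exists_isCompSeries`).

It remains to compare the given C_k with `breakCoeff`. The adjoint of the multiplication operator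
is, on suitable vectors, the differential operator with the coefficients `breakCoeff`, followed by
restriction to the hyperplane. Hence that operator intertwines π_mu and π_{mu+j}
(`inner_breakMul_dualVec`, `breakOp_intertwines`). An intertwining operator of this shape is
determined by its leading coefficient: a test with the inversion and functions equal to x_{d+1}^m
near the unit sphere shows that all coefficients vanish if the leading one does
(`coeff_eq_zero_of_intertwines`). So the leading `breakCoeff` is nonzero, and the C_k are the
`breakCoeff` divided by it. -/

/-- The Lorentz form on `ℝ^{d+1,1}`. -/
def lform {d : ℕ} (v w : LIdx d → ℝ) : ℝ :=
  (∑ i, v (Sum.inl i) * w (Sum.inl i)) - v (Sum.inr 0) * w (Sum.inr 0)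

theorem lform_eq_dotProduct {d : ℕ} (v w : LIdx d → ℝ) :
    lform v w =
      v ⬝ᵥ (LieAlgebra.Orthogonal.indefiniteDiagonal (Fin (d + 1)) (Fin 1) ℝ *ᵥ w) := by
  simp [lform, LieAlgebra.Orthogonal.indefiniteDiagonal, dotProduct, Matrix.mulVec_diagonal,
    sub_eq_add_neg]

theorem lform_smul_smul {d : ℕ} (a b : ℝ) (v w : LIdx d → ℝ) :
    lform (a • v) (b • w) = a * b * lform v w := by
  simp only [lform, Pi.smul_apply, smul_eq_mul, mul_sub, Finset.mul_sum]
  congr 1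
  · exact Finset.sum_congr rfl fun _ _ => by ring
  · ring

theorem SO0.mat_mul {d : ℕ} (g h : SO0 d) : (g * h).mat = g.mat * h.mat := rfl

theorem SO0.mat_one {d : ℕ} : (1 : SO0 d).mat = 1 := rfl

theorem SO0.mat_mulVec_inv_mulVec {d : ℕ} (h : SO0 d) (v : LIdx d → ℝ) :
    h.mat *ᵥ ((h⁻¹).mat *ᵥ v) = v := by
  rw [Matrix.mulVec_mulVec, ← SO0.mat_mul, mul_inv_cancel, SO0.mat_one, Matrix.one_mulVec]

theorem lform_mulVec_of_mem {d : ℕ} (g : lorentzSO d) (v w : LIdx d → ℝ) :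
    lform ((g : Matrix.SpecialLinearGroup (LIdx d) ℝ).1 *ᵥ v)
      ((g : Matrix.SpecialLinearGroup (LIdx d) ℝ).1 *ᵥ w) = lform v w := by
  have hg := mem_lorentzSO.1 g.2
  rw [lform_eq_dotProduct, lform_eq_dotProduct]
  conv_rhs => rw [← hg]
  simp only [← Matrix.mulVec_mulVec]
  rw [Matrix.dotProduct_mulVec v, Matrix.vecMul_transpose]

theorem lform_mulVec {d : ℕ} (h : SO0 d) (v w : LIdx d → ℝ) :
    lform (h.mat *ᵥ v) (h.mat *ᵥ w) = lform v w := lform_mulVec_of_mem h.1 v w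

theorem lform_coneVec {d : ℕ} (x y : RSpace d) :
    lform (coneVec x) (coneVec y) = -‖x - y‖ ^ 2 / 2 := by
  have h : ‖x - y‖ ^ 2 = ‖x‖ ^ 2 - 2 * (∑ i, x i * y i) + ‖y‖ ^ 2 := by
    rw [norm_sub_sq_real]; simp [PiLp.inner_apply, mul_comm]
  simp only [lform, coneVec, Sum.elim_inl, Sum.elim_inr, Fin.sum_univ_succ, Fin.cons_zero,
    Fin.cons_succ]
  rw [h]; ring

/-- The image of the time vector has form -1, so the square of its time component is 1 plus a sum of
squares. -/
theorem one_le_timeComp_sq {d : ℕ} (g : lorentzSO d) :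
    1 ≤ ((g : Matrix.SpecialLinearGroup (LIdx d) ℝ).1 (Sum.inr 0) (Sum.inr 0)) ^ 2 := by
  have h := lform_mulVec_of_mem g (Pi.single (Sum.inr 0) 1) (Pi.single (Sum.inr 0) 1)
  simp only [Matrix.mulVec_single_one, lform, Matrix.col_apply] at h
  simp at h
  have : 0 ≤ ∑ i, (g : Matrix.SpecialLinearGroup (LIdx d) ℝ).1 (Sum.inl i) (Sum.inr 0) *
      (g : Matrix.SpecialLinearGroup (LIdx d) ℝ).1 (Sum.inl i) (Sum.inr 0) :=
    Finset.sum_nonneg fun i _ => mul_self_nonneg _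
  nlinarith

theorem continuous_lorentzSO_entry {d : ℕ} (i k : LIdx d) :
    Continuous fun g : lorentzSO d => (g : Matrix.SpecialLinearGroup (LIdx d) ℝ).1 i k := by
  have h : Continuous fun g : lorentzSO d => (g : Matrix.SpecialLinearGroup (LIdx d) ℝ).1 :=
    continuous_subtype_val.comp continuous_subtype_val
  exact h.matrix_elem i k

theorem SO0.isInducing_mat (d : ℕ) :
    Topology.IsInducing (SO0.mat : SO0 d → Matrix (LIdx d) (LIdx d) ℝ) := by
  have h1 : Topology.IsInducing (Subtype.val : Matrix.SpecialLinearGroup (LIdx d) ℝ → _) :=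
    .subtypeVal
  have h2 : Topology.IsInducing (Subtype.val : lorentzSO d → _) := .subtypeVal
  have h3 : Topology.IsInducing (Subtype.val : SO0 d → _) := .subtypeVal
  exact (h1.comp h2).comp h3

theorem SO0.continuous_mat (d : ℕ) :
    Continuous (SO0.mat : SO0 d → Matrix (LIdx d) (LIdx d) ℝ) :=
  (SO0.isInducing_mat d).continuous

instance (d : ℕ) : FirstCountableTopology (SO0 d) :=
  haveI : FirstCountableTopology (Matrix (LIdx d) (LIdx d) ℝ) :=
    inferInstanceAs (FirstCountableTopology (LIdx d → LIdx d → ℝ))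
  (SO0.isInducing_mat d).firstCountableTopology

/-- The time entry is continuous, equals 1 at the identity and never vanishes, so it keeps its sign
on the identity component. This is the only place where connectedness restricts the group. -/
theorem SO0.timeComp_pos {d : ℕ} (h : SO0 d) : 0 < h.mat (Sum.inr 0) (Sum.inr 0) := by
  by_contra! hneg
  have hp : IsPreconnected (connectedComponent (1 : lorentzSO d)) :=
    isPreconnected_connectedComponent
  obtain ⟨g, -, hg⟩ := hp.intermediate_value h.2 mem_connectedComponent
    (continuous_lorentzSO_entry (Sum.inr 0) (Sum.inr 0)).continuousOn
    (⟨hneg, by simp⟩ : (0 : ℝ) ∈ Set.Icc _ _)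
  have := one_le_timeComp_sq g
  simp only at hg
  rw [hg] at this
  norm_num at this

/-- Compare the image w of v with the image u of the time vector, whose time component a is
positive. If the time component b of w were at most 0, then the spatial product S of u and w would
satisfy S < ab ≤ 0, so (ab)² < S², whereas Cauchy-Schwarz gives S² ≤ (a² - 1) b². -/
theorem forward_mulVec {d : ℕ} (h : SO0 d) {v : LIdx d → ℝ} (hv : lform v v = 0)
    (hpos : 0 < v (Sum.inr 0)) : 0 < (h.mat *ᵥ v) (Sum.inr 0) := by
  by_contra! hneg
  set w := h.mat *ᵥ v with hw
  set u := h.mat *ᵥ (Pi.single (Sum.inr 0) 1) with hu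
  have hww : lform w w = 0 := by rw [hw, lform_mulVec, hv]
  have huw : lform u w = -v (Sum.inr 0) := by
    rw [hw, hu, lform_mulVec]; simp [lform]
  have huu : lform u u = -1 := by
    rw [hu, lform_mulVec]; simp [lform]
  have hut : 0 < u (Sum.inr 0) := by
    have := h.timeComp_pos
    rw [hu, Matrix.mulVec_single_one]; exact this
  simp only [lform] at hww huw huu
  have hcs := Finset.sum_mul_sq_le_sq_mul_sq Finset.univ (fun i => u (Sum.inl i))
    fun i => w (Sum.inl i)
  simp only [sq] at hcs
  set S := ∑ i, u (Sum.inl i) * w (Sum.inl i)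
  set A := ∑ i, u (Sum.inl i) * u (Sum.inl i)
  set B := ∑ i, w (Sum.inl i) * w (Sum.inl i)
  set a := u (Sum.inr 0)
  set b := w (Sum.inr 0)
  have hA : A = a * a - 1 := by linarith
  have hB : B = b * b := by linarith
  rw [hA, hB] at hcs
  have hS : S < a * b := by linarith
  have hab : a * b ≤ 0 := mul_nonpos_of_nonneg_of_nonpos hut.le hneg
  nlinarith [mul_self_nonneg b]

theorem sq_le_time_sq {d : ℕ} {v : LIdx d → ℝ} (hv : lform v v = 0) (i : LIdx d) :
    v i ^ 2 ≤ v (Sum.inr 0) ^ 2 := by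
  rcases i with i | i
  · have := Finset.single_le_sum (f := fun i => v (Sum.inl i) * v (Sum.inl i))
      (fun i _ => mul_self_nonneg _) (Finset.mem_univ i)
    simp only [lform] at hv this
    nlinarith
  · rw [Subsingleton.elim i 0]

theorem abs_le_time {d : ℕ} {v : LIdx d → ℝ} (hv : lform v v = 0) (hpos : 0 ≤ v (Sum.inr 0))
    (i : LIdx d) : |v i| ≤ v (Sum.inr 0) := abs_le_of_sq_le_sq (sq_le_time_sq hv i) hpos

theorem coneVec_time_pos {d : ℕ} (x : RSpace d) : 0 < coneVec x (Sum.inr 0) := by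
  simp only [coneVec, Sum.elim_inr]; positivity

theorem lform_coneVec_self {d : ℕ} (x : RSpace d) : lform (coneVec x) (coneVec x) = 0 := by
  simp [lform_coneVec]

theorem lform_movedCone {d : ℕ} (h : SO0 d) (x y : RSpace d) :
    lform (movedCone h x) (movedCone h y) = -‖x - y‖ ^ 2 / 2 := by
  rw [movedCone, movedCone, lform_mulVec, lform_coneVec]

theorem lform_movedCone_self {d : ℕ} (h : SO0 d) (x : RSpace d) :
    lform (movedCone h x) (movedCone h x) = 0 := by
  simp [lform_movedCone]

theorem movedCone_time_pos {d : ℕ} (h : SO0 d) (x : RSpace d) :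
    0 < movedCone h x (Sum.inr 0) :=
  forward_mulVec h⁻¹ (lform_coneVec_self x) (coneVec_time_pos x)

theorem confFactor_nonneg {d : ℕ} (h : SO0 d) (x : RSpace d) : 0 ≤ confFactor h x := by
  have := (abs_le.1 (abs_le_time (lform_movedCone_self h x) (movedCone_time_pos h x).le
    (Sum.inl 0))).1
  rw [confFactor]; linarith

theorem confFactor_pos {d : ℕ} {h : SO0 d} {x : RSpace d} (hx : confFactor h x ≠ 0) :
    0 < confFactor h x := lt_of_le_of_ne (confFactor_nonneg h x) hx.symm

theorem coneVec_inl_zero_add {d : ℕ} (x : RSpace d) :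
    coneVec x (Sum.inl 0) + coneVec x (Sum.inr 0) = 1 := by
  simp only [coneVec, Sum.elim_inl, Fin.cons_zero, Sum.elim_inr]; ring

/-- A null vector `v` with `v₀ + v_t ≠ 0` is a multiple of some `coneVec`. -/
theorem null_eq_smul_coneVec {d : ℕ} {v : LIdx d → ℝ} (hv : lform v v = 0)
    (ht : v (Sum.inl 0) + v (Sum.inr 0) ≠ 0) :
    v = (v (Sum.inl 0) + v (Sum.inr 0)) • coneVec (WithLp.toLp 2 fun i : Fin d =>
      v (Sum.inl i.succ) / (v (Sum.inl 0) + v (Sum.inr 0))) := by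
  set t := v (Sum.inl 0) + v (Sum.inr 0) with htdef
  have hsum : ∑ i : Fin d, v (Sum.inl i.succ) ^ 2 =
      v (Sum.inr 0) ^ 2 - v (Sum.inl 0) ^ 2 := by
    simp only [lform, Fin.sum_univ_succ, ← sq] at hv; linarith
  have hn : ‖(WithLp.toLp 2 fun i : Fin d => v (Sum.inl i.succ) / t : RSpace d)‖ ^ 2 =
      (v (Sum.inr 0) ^ 2 - v (Sum.inl 0) ^ 2) / t ^ 2 := by
    rw [EuclideanSpace.real_norm_sq_eq, ← hsum, Finset.sum_div]
    exact Finset.sum_congr rfl fun i _ => by simp [div_pow]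
  ext i
  rcases i with i | i
  · refine Fin.cases ?_ (fun i => ?_) i
    · simp only [coneVec, Pi.smul_apply, Sum.elim_inl, Fin.cons_zero, hn, smul_eq_mul]
      field_simp
      rw [htdef]; ring
    · simp only [coneVec, Pi.smul_apply, Sum.elim_inl, Fin.cons_succ, smul_eq_mul]
      field_simp
  · rw [Subsingleton.elim i 0]
    simp only [coneVec, Pi.smul_apply, Sum.elim_inr, hn, smul_eq_mul]
    field_simp
    rw [htdef]; ring

theorem movedCone_eq {d : ℕ} {h : SO0 d} {x : RSpace d} (hx : confFactor h x ≠ 0) :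
    movedCone h x = confFactor h x • coneVec (confPoint h x) :=
  null_eq_smul_coneVec (lform_movedCone_self h x) hx

theorem confFactor_one {d : ℕ} (x : RSpace d) : confFactor 1 x = 1 := by
  rw [confFactor, movedCone, inv_one, SO0.mat_one, Matrix.one_mulVec, coneVec_inl_zero_add]

theorem confPoint_one {d : ℕ} (x : RSpace d) : confPoint 1 x = x := by
  ext i
  simp only [confPoint, confFactor_one, div_one, movedCone, inv_one, SO0.mat_one,
    Matrix.one_mulVec]
  simp [coneVec]

/-- The cocycle relation. It needs only that g⁻¹ keeps x finite; h⁻¹ may then send the point to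
infinity. -/
theorem movedCone_mul {d : ℕ} (g h : SO0 d) {x : RSpace d} (hx : confFactor g x ≠ 0) :
    movedCone (g * h) x = confFactor g x • movedCone h (confPoint g x) := by
  rw [movedCone, mul_inv_rev, SO0.mat_mul, ← Matrix.mulVec_mulVec]
  change _ *ᵥ movedCone g x = _
  rw [movedCone_eq hx, Matrix.mulVec_smul]; rfl

theorem confFactor_mul {d : ℕ} (g h : SO0 d) {x : RSpace d} (hx : confFactor g x ≠ 0) :
    confFactor (g * h) x = confFactor g x * confFactor h (confPoint g x) := by
  simp only [confFactor, movedCone_mul g h hx, Pi.smul_apply, smul_eq_mul, mul_add]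

theorem confPoint_mul {d : ℕ} (g h : SO0 d) {x : RSpace d} (hx : confFactor g x ≠ 0) :
    confPoint (g * h) x = confPoint h (confPoint g x) := by
  ext i
  simp only [confPoint, confFactor_mul g h hx, movedCone_mul g h hx, Pi.smul_apply, smul_eq_mul]
  rw [mul_div_mul_left _ _ hx]

theorem confFactor_inv_confPoint {d : ℕ} {h : SO0 d} {x : RSpace d} (hx : confFactor h x ≠ 0) :
    confFactor h x * confFactor h⁻¹ (confPoint h x) = 1 := by
  rw [← confFactor_mul h h⁻¹ hx, mul_inv_cancel, confFactor_one]

theorem confFactor_inv_confPoint_ne {d : ℕ} {h : SO0 d} {x : RSpace d}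
    (hx : confFactor h x ≠ 0) : confFactor h⁻¹ (confPoint h x) ≠ 0 :=
  right_ne_zero_of_mul_eq_one (confFactor_inv_confPoint hx)

theorem confPoint_inv_confPoint {d : ℕ} {h : SO0 d} {x : RSpace d} (hx : confFactor h x ≠ 0) :
    confPoint h⁻¹ (confPoint h x) = x := by
  rw [← confPoint_mul h h⁻¹ hx, mul_inv_cancel, confPoint_one]

/-- The Lorentz product of two lifted points is -|x - y|²/2, so invariance of the form is
conformality in integrated form. Jacobians and covariance of kernels all come from this identity. -/
theorem norm_sub_sq_confPoint {d : ℕ} {h : SO0 d} {x y : RSpace d} (hx : confFactor h x ≠ 0)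
    (hy : confFactor h y ≠ 0) :
    ‖x - y‖ ^ 2 = confFactor h x * confFactor h y * ‖confPoint h x - confPoint h y‖ ^ 2 := by
  have h1 := lform_movedCone h x y
  rw [movedCone_eq hx, movedCone_eq hy, lform_smul_smul, lform_coneVec] at h1
  linarith

/-- At most one point is mapped to infinity. -/
theorem subsingleton_confFactor_eq_zero {d : ℕ} (h : SO0 d) :
    {x : RSpace d | confFactor h x = 0}.Subsingleton := by
  intro x hx y hy
  -- A null vector with v₀ = -v_t lies on a fixed line. Two such vectors have Lorentz product zero,
  -- and this product is -|x - y|²/2.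
  have key : ∀ z : RSpace d, confFactor h z = 0 → ∀ i : Fin d,
      movedCone h z (Sum.inl i.succ) = 0 := by
    intro z hz i
    have h1 := lform_movedCone_self h z
    have h2 : movedCone h z (Sum.inl 0) = -movedCone h z (Sum.inr 0) := by
      rw [confFactor] at hz; linarith
    simp only [lform, Fin.sum_univ_succ, h2] at h1
    have h3 : ∑ i : Fin d, movedCone h z (Sum.inl i.succ) * movedCone h z (Sum.inl i.succ) = 0 := by
      linarith
    have := (Finset.sum_eq_zero_iff_of_nonneg fun i _ => mul_self_nonneg _).1 h3 i
      (Finset.mem_univ i)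
    exact mul_self_eq_zero.1 this
  have h1 := lform_movedCone h x y
  simp only [lform, Fin.sum_univ_succ, key x hx, key y hy] at h1
  have h2 : movedCone h x (Sum.inl 0) = -movedCone h x (Sum.inr 0) := by
    simp only [Set.mem_ofPred_eq, confFactor] at hx; linarith
  have h3 : movedCone h y (Sum.inl 0) = -movedCone h y (Sum.inr 0) := by
    simp only [Set.mem_ofPred_eq, confFactor] at hy; linarith
  rw [h2, h3] at h1
  simp only [mul_zero, Finset.sum_const_zero] at h1
  have h4 : ‖x - y‖ ^ 2 = 0 := by linarith
  exact sub_eq_zero.1 (norm_eq_zero.1 (pow_eq_zero_iff two_ne_zero |>.1 h4))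

end LorentzGeometry

/-! ### Smoothness, Jacobian and change of variables for the conformal maps. -/

section ConformalCalculus

theorem contDiff_coneVec {d : ℕ} (i : LIdx d) :
    ContDiff ℝ ∞ fun x : RSpace d => coneVec x i := by
  have hn : ContDiff ℝ ∞ fun x : RSpace d => ‖x‖ ^ 2 := contDiff_norm_sq ℝ
  rcases i with i | i
  · refine Fin.cases ?_ (fun i => ?_) i
    · simp only [coneVec, Sum.elim_inl, Fin.cons_zero]; fun_prop
    · simp only [coneVec, Sum.elim_inl, Fin.cons_succ]; fun_prop
  · simp only [coneVec, Sum.elim_inr]; fun_prop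

theorem contDiff_movedCone {d : ℕ} (h : SO0 d) (i : LIdx d) :
    ContDiff ℝ ∞ fun x : RSpace d => movedCone h x i := by
  simp only [movedCone, Matrix.mulVec, dotProduct]
  exact ContDiff.sum fun k _ => contDiff_const.mul (contDiff_coneVec k)

theorem contDiff_confFactor {d : ℕ} (h : SO0 d) : ContDiff ℝ ∞ (confFactor h) :=
  (contDiff_movedCone h _).add (contDiff_movedCone h _)

theorem contDiffAt_confPoint {d : ℕ} {h : SO0 d} {x : RSpace d} (hx : confFactor h x ≠ 0) :
    ContDiffAt ℝ ∞ (confPoint h) x := by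
  rw [contDiffAt_euclidean]
  intro i
  exact (contDiff_movedCone h _).contDiffAt.div (contDiff_confFactor h).contDiffAt hx

theorem measurable_confPoint {d : ℕ} (h : SO0 d) : Measurable (confPoint h) := by
  refine (WithLp.measurable_toLp _ _).comp (measurable_pi_lambda _ fun i => ?_)
  exact (contDiff_movedCone h _).continuous.measurable.div
    (contDiff_confFactor h).continuous.measurable

theorem isOpen_confFactor_ne {d : ℕ} (h : SO0 d) : IsOpen {x | confFactor h x ≠ 0} :=
  isOpen_ne_fun (contDiff_confFactor h).continuous continuous_const

theorem confPoint_image {d : ℕ} (h : SO0 d) :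
    confPoint h '' {x | confFactor h x ≠ 0} = {x | confFactor h⁻¹ x ≠ 0} := by
  ext y
  constructor
  · rintro ⟨x, hx, rfl⟩
    exact confFactor_inv_confPoint_ne hx
  · intro hy
    have h1 := confFactor_inv_confPoint_ne (h := h⁻¹) hy
    have h2 := confPoint_inv_confPoint (h := h⁻¹) hy
    rw [inv_inv] at h1 h2
    exact ⟨_, h1, h2⟩

theorem confPoint_injOn {d : ℕ} (h : SO0 d) : Set.InjOn (confPoint h) {x | confFactor h x ≠ 0} := by
  intro x hx y hy hxy
  rw [← confPoint_inv_confPoint hx, ← confPoint_inv_confPoint hy, hxy]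

/-- Divide `norm_sub_sq_confPoint` for the points x + s v and x by s² and let s tend to 0. -/
theorem norm_fderiv_confPoint {d : ℕ} {h : SO0 d} {x : RSpace d} (hx : confFactor h x ≠ 0)
    (v : RSpace d) : confFactor h x * ‖fderiv ℝ (confPoint h) x v‖ = ‖v‖ := by
  have hd : HasFDerivAt (confPoint h) (fderiv ℝ (confPoint h) x) x :=
    ((contDiffAt_confPoint hx).differentiableAt (by simp)).hasFDerivAt
  have hl := (hd.hasLineDerivAt v).tendsto_slope_zero
  have hcont : Filter.Tendsto (fun s : ℝ => confFactor h (x + s • v)) (nhdsWithin 0 {0}ᶜ)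
      (nhds (confFactor h x)) := by
    have : Continuous fun s : ℝ => confFactor h (x + s • v) :=
      (contDiff_confFactor h).continuous.comp (by fun_prop)
    have := this.tendsto 0
    simp only [zero_smul, add_zero] at this
    exact this.mono_left nhdsWithin_le_nhds
  have h1 : Filter.Tendsto (fun s : ℝ => confFactor h x * confFactor h (x + s • v) *
      ‖s⁻¹ • (confPoint h (x + s • v) - confPoint h x)‖ ^ 2) (nhdsWithin 0 {0}ᶜ)
      (nhds (confFactor h x * confFactor h x * ‖fderiv ℝ (confPoint h) x v‖ ^ 2)) :=
    (hcont.const_mul _).mul (hl.norm.pow 2)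
  have h2 : Filter.Tendsto (fun s : ℝ => confFactor h x * confFactor h (x + s • v) *
      ‖s⁻¹ • (confPoint h (x + s • v) - confPoint h x)‖ ^ 2) (nhdsWithin 0 {0}ᶜ)
      (nhds (‖v‖ ^ 2)) := by
    refine tendsto_const_nhds.congr' ?_
    have hne : ∀ᶠ s in nhdsWithin (0 : ℝ) {0}ᶜ, confFactor h (x + s • v) ≠ 0 :=
      hcont.eventually_ne hx
    filter_upwards [hne, self_mem_nhdsWithin] with s hs hs0
    have hs0 : s ≠ 0 := hs0
    have h3 := norm_sub_sq_confPoint hs hx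
    rw [norm_smul, mul_pow, mul_left_comm, mul_comm (confFactor h x), ← h3]
    simp only [add_sub_cancel_left, norm_smul, mul_pow, norm_inv, inv_pow]
    field_simp
  have h4 := tendsto_nhds_unique h1 h2
  rw [← sq, ← mul_pow] at h4
  exact (pow_left_inj₀ (mul_nonneg (confFactor_nonneg h x) (norm_nonneg _)) (norm_nonneg v)
    two_ne_zero).1 h4

/-- The derivative times the conformal factor is a linear isometry, so its determinant is 1 in
absolute value. -/
theorem abs_det_fderiv_confPoint {d : ℕ} {h : SO0 d} {x : RSpace d} (hx : confFactor h x ≠ 0) :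
    |(fderiv ℝ (confPoint h) x).det| = confFactor h x ^ (-(d : ℝ)) := by
  have hpos := confFactor_pos hx
  let A : RSpace d →ₗᵢ[ℝ] RSpace d :=
    { toLinearMap := confFactor h x • (fderiv ℝ (confPoint h) x : RSpace d →ₗ[ℝ] RSpace d)
      norm_map' := fun v => by
        simp only [LinearMap.smul_apply, norm_smul, Real.norm_eq_abs, abs_of_pos hpos]
        exact norm_fderiv_confPoint hx v }
  have hA : |LinearMap.det A.toLinearMap| = 1 := by
    rw [← LinearMap.normDet_eq_abs_det, LinearIsometry.normDet_eq_one A]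
  have h1 : LinearMap.det A.toLinearMap =
      confFactor h x ^ d * (fderiv ℝ (confPoint h) x).det := by
    change LinearMap.det (confFactor h x • (fderiv ℝ (confPoint h) x : RSpace d →ₗ[ℝ] RSpace d)) = _
    rw [LinearMap.det_smul]; simp [ContinuousLinearMap.det]
  rw [h1, abs_mul, abs_of_pos (pow_pos hpos d)] at hA
  rw [Real.rpow_neg hpos.le, Real.rpow_natCast]
  exact eq_inv_of_mul_eq_one_right hA

theorem ae_confFactor_ne {d : ℕ} [NeZero d] (h : SO0 d) :
    ∀ᵐ x : RSpace d, confFactor h x ≠ 0 := by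
  have : Nonempty (Fin d) := ⟨0⟩
  have := (subsingleton_confFactor_eq_zero h).measure_zero (volume : Measure (RSpace d))
  exact compl_mem_ae_iff.2 this

theorem ae_restrict_confFactor_ne {d : ℕ} [NeZero d] (h : SO0 d) :
    (volume : Measure (RSpace d)).restrict {x | confFactor h x ≠ 0} = volume :=
  Measure.restrict_eq_self_of_ae_mem (ae_confFactor_ne h)

/-- Change of variables for the conformal action. -/
theorem integral_confPoint {d : ℕ} [NeZero d] (h : SO0 d) {E : Type*} [NormedAddCommGroup E]
    [NormedSpace ℝ E] (F : RSpace d → E) :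
    ∫ x, confFactor h x ^ (-(d : ℝ)) • F (confPoint h x) = ∫ x, F x := by
  have h1 := integral_image_eq_integral_abs_det_fderiv_smul (volume : Measure (RSpace d))
    (isOpen_confFactor_ne h).measurableSet
    (fun x hx => ((contDiffAt_confPoint hx).differentiableAt (by simp)).hasFDerivAt.hasFDerivWithinAt)
    (confPoint_injOn h) F
  rw [confPoint_image, ae_restrict_confFactor_ne] at h1
  rw [h1, setIntegral_congr_fun (isOpen_confFactor_ne h).measurableSet
    (g := fun x => confFactor h x ^ (-(d : ℝ)) • F (confPoint h x)), ae_restrict_confFactor_ne]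
  intro x hx
  simp only [abs_det_fderiv_confPoint hx]

end ConformalCalculus

/-! ### A function space with decay at infinity, invariant under the action. -/

section Decay

/-- A bound for the growth of the time coordinate under `h`. -/
def SO0.timeBound {d : ℕ} (h : SO0 d) : ℝ := ∑ i, |h.mat (Sum.inr 0) i|

theorem SO0.continuous_timeBound (d : ℕ) : Continuous (SO0.timeBound : SO0 d → ℝ) :=
  continuous_finsetSum _ fun i _ => ((SO0.continuous_mat d).matrix_elem _ i).abs

/-- Apply h to the moved vector and use that the entries of a forward null vector are bounded by its
time entry. -/
theorem coneVec_time_le {d : ℕ} (h : SO0 d) (x : RSpace d) :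
    coneVec x (Sum.inr 0) ≤ h.timeBound * movedCone h x (Sum.inr 0) := by
  have h1 : coneVec x = h.mat *ᵥ movedCone h x := (SO0.mat_mulVec_inv_mulVec h _).symm
  conv_lhs => rw [h1]
  simp only [Matrix.mulVec, dotProduct, SO0.timeBound, Finset.sum_mul]
  refine Finset.sum_le_sum fun i _ => (le_abs_self _).trans ?_
  rw [abs_mul]
  gcongr
  exact abs_le_time (lform_movedCone_self h x) (movedCone_time_pos h x).le i

theorem SO0.timeBound_pos {d : ℕ} (h : SO0 d) : 0 < h.timeBound :=
  pos_of_mul_pos_left ((coneVec_time_pos 0).trans_le (coneVec_time_le h 0))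
    (movedCone_time_pos h 0).le

/-- Measurable functions `f` on `ℝ^d` with `|f| ≤ C ((1 + |x|²)/2)^{-lam}`. -/
def DecaySpace (d : ℕ) (lam : ℝ) : Submodule ℂ (RSpace d → ℂ) where
  carrier := {f | Measurable f ∧ ∃ C : ℝ, ∀ x, ‖f x‖ ≤ C * coneVec x (Sum.inr 0) ^ (-lam)}
  zero_mem' := ⟨measurable_const, 0, fun x => by simp⟩
  add_mem' := by
    rintro f g ⟨hf, C, hC⟩ ⟨hg, C', hC'⟩
    exact ⟨hf.add hg, C + C', fun x => (norm_add_le _ _).trans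
      ((add_le_add (hC x) (hC' x)).trans_eq (add_mul _ _ _).symm)⟩
  smul_mem' := by
    rintro c f ⟨hf, C, hC⟩
    refine ⟨hf.const_smul c, ‖c‖ * C, fun x => ?_⟩
    rw [Pi.smul_apply, norm_smul, mul_assoc]
    exact mul_le_mul_of_nonneg_left (hC x) (norm_nonneg c)

/-- The weight is the time coordinate of the cone vector, which h changes by at most the factor
`timeBound`. The dependence of the bound on h is kept explicit because strong continuity needs
uniformity near the identity. -/
theorem norm_principalAct_le {d : ℕ} {lam : ℝ} (hlam : 0 < lam) (h : SO0 d) {f : RSpace d → ℂ}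
    {C : ℝ} (hC : ∀ x, ‖f x‖ ≤ C * coneVec x (Sum.inr 0) ^ (-lam)) (x : RSpace d) :
    ‖principalAct lam h f x‖ ≤ C * h.timeBound ^ lam * coneVec x (Sum.inr 0) ^ (-lam) := by
  have hC0 : 0 ≤ C := by
    have h0 := (norm_nonneg _).trans (hC 0)
    exact nonneg_of_mul_nonneg_left h0 (Real.rpow_pos_of_pos (coneVec_time_pos 0) _)
  have hM := h.timeBound_pos
  have hx0 := coneVec_time_pos x
  -- At the point sent to infinity the real power of 0 with exponent -lam ≠ 0 has the default value
  -- 0.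
  by_cases hx : confFactor h x = 0
  · rw [principalAct, hx, Real.zero_rpow (neg_ne_zero.2 hlam.ne')]
    simp only [Complex.ofReal_zero, zero_mul, norm_zero]
    positivity
  have ht := confFactor_pos hx
  have hy0 := coneVec_time_pos (confPoint h x)
  have hmc : movedCone h x (Sum.inr 0) =
      confFactor h x * coneVec (confPoint h x) (Sum.inr 0) := by
    conv_lhs => rw [movedCone_eq hx]
    rfl
  have hle := coneVec_time_le h x
  rw [hmc] at hle
  rw [principalAct, norm_mul, Complex.norm_real, Real.norm_of_nonneg (by positivity)]
  calc _ ≤ confFactor h x ^ (-lam) * (C * coneVec (confPoint h x) (Sum.inr 0) ^ (-lam)) := by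
        gcongr; exact hC _
    _ = C * (confFactor h x * coneVec (confPoint h x) (Sum.inr 0)) ^ (-lam) := by
        rw [Real.mul_rpow ht.le hy0.le]; ring
    _ ≤ C * (coneVec x (Sum.inr 0) / h.timeBound) ^ (-lam) := by
        gcongr C * ?_
        refine Real.rpow_le_rpow_of_nonpos (by positivity) ?_ (by linarith)
        rw [div_le_iff₀ hM]; linarith
    _ = _ := by
        rw [Real.div_rpow hx0.le hM.le, Real.rpow_neg hM.le, div_inv_eq_mul]; ring

theorem measurable_principalAct {d : ℕ} (lam : ℝ) (h : SO0 d) {f : RSpace d → ℂ}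
    (hf : Measurable f) : Measurable (principalAct lam h f) := by
  refine Measurable.mul ?_ (hf.comp (measurable_confPoint h))
  have := (contDiff_confFactor h).continuous.measurable
  fun_prop

/-- Test functions are not preserved by the action, since a point of the support may be moved to
infinity. `DecaySpace` contains them and is preserved. -/
theorem principalAct_mem {d : ℕ} {lam : ℝ} (hlam : 0 < lam) (h : SO0 d) {f : RSpace d → ℂ}
    (hf : f ∈ DecaySpace d lam) : principalAct lam h f ∈ DecaySpace d lam := by
  obtain ⟨hm, C, hC⟩ := hf
  exact ⟨measurable_principalAct lam h hm, _, norm_principalAct_le hlam h hC⟩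

/-- `principalAct` as a linear operator on `DecaySpace`. -/
noncomputable def decayAct {d : ℕ} {lam : ℝ} (hlam : 0 < lam) (h : SO0 d) :
    DecaySpace d lam →ₗ[ℂ] DecaySpace d lam where
  toFun f := ⟨principalAct lam h f, principalAct_mem hlam h f.2⟩
  map_add' f g := by ext x; simp [principalAct, mul_add]
  map_smul' c f := by ext x; simp [principalAct, mul_left_comm]

theorem principalAct_one {d : ℕ} (lam : ℝ) (f : RSpace d → ℂ) : principalAct lam 1 f = f := by
  ext x; simp [principalAct, confFactor_one, confPoint_one]

theorem principalAct_mul_apply {d : ℕ} (lam : ℝ) (g h : SO0 d) (f : RSpace d → ℂ) {x : RSpace d}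
    (hx : confFactor g x ≠ 0) :
    principalAct lam (g * h) f x = principalAct lam g (principalAct lam h f) x := by
  simp only [principalAct]
  rw [confFactor_mul g h hx, confPoint_mul g h hx,
    Real.mul_rpow (confFactor_nonneg _ _) (confFactor_nonneg _ _)]
  push_cast; ring

theorem principalAct_mul {d : ℕ} [NeZero d] (lam : ℝ) (g h : SO0 d) (f : RSpace d → ℂ) :
    principalAct lam (g * h) f =ᵐ[volume] principalAct lam g (principalAct lam h f) := by
  filter_upwards [ae_confFactor_ne g] with x hx using principalAct_mul_apply lam g h f hx

/-- The decay is of order |x|^{-2 lam}, and 2 lam > d. -/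
theorem integrable_time_rpow {d : ℕ} {lam : ℝ} (hlam : (d : ℝ) / 2 < lam) :
    Integrable fun x : RSpace d => coneVec x (Sum.inr 0) ^ (-lam) := by
  have h := integrable_rpow_neg_one_add_norm_sq (E := RSpace d) (μ := volume) (r := 2 * lam)
    (by simp; linarith)
  refine (h.const_mul ((2 : ℝ) ^ lam)).congr (Filter.Eventually.of_forall fun x => ?_)
  simp only [coneVec, Sum.elim_inr]
  rw [Real.div_rpow (by positivity) (by positivity), Real.rpow_neg (by norm_num : (0 : ℝ) ≤ 2),
    div_inv_eq_mul, mul_comm]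
  congr 2
  ring

theorem DecaySpace.integrable {d : ℕ} {lam : ℝ} (hlam : (d : ℝ) / 2 < lam) {f : RSpace d → ℂ}
    (hf : f ∈ DecaySpace d lam) : Integrable f := by
  obtain ⟨hm, C, hC⟩ := hf
  exact ((integrable_time_rpow hlam).const_mul C).mono' hm.aestronglyMeasurable
    (Filter.Eventually.of_forall hC)

theorem time_rpow_le {d : ℕ} {lam : ℝ} (hlam : 0 < lam) (x : RSpace d) :
    coneVec x (Sum.inr 0) ^ (-lam) ≤ 2 ^ lam := by
  rw [← inv_inv (2 : ℝ), Real.inv_rpow (by norm_num), ← Real.rpow_neg (by norm_num)]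
  refine Real.rpow_le_rpow_of_nonpos (by norm_num) ?_ (by linarith)
  simp only [coneVec, Sum.elim_inr]
  have := sq_nonneg ‖x‖
  linarith

theorem DecaySpace.bounded {d : ℕ} {lam : ℝ} (hlam : 0 < lam) {f : RSpace d → ℂ}
    (hf : f ∈ DecaySpace d lam) : ∃ B, 0 ≤ B ∧ ∀ x, ‖f x‖ ≤ B := by
  obtain ⟨-, C, hC⟩ := hf
  have hC0 : 0 ≤ C := nonneg_of_mul_nonneg_left ((norm_nonneg _).trans (hC 0))
    (Real.rpow_pos_of_pos (coneVec_time_pos 0) _)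
  exact ⟨C * 2 ^ lam, by positivity, fun x => (hC x).trans (by gcongr; exact time_rpow_le hlam x)⟩

theorem DecaySpace.of_hasCompactSupport {d : ℕ} (lam : ℝ) {f : RSpace d → ℂ}
    (hf : Continuous f) (hs : HasCompactSupport f) : f ∈ DecaySpace d lam := by
  have hτ : Continuous fun x : RSpace d => (coneVec x (Sum.inr 0) ^ lam : ℝ) :=
    (contDiff_coneVec _).continuous.rpow_const fun x => Or.inl (coneVec_time_pos x).ne'
  obtain ⟨C, hC⟩ := (hs.mul_left
    (f := fun x => ((coneVec x (Sum.inr 0) ^ lam : ℝ) : ℂ))).exists_bound_of_continuous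
    (by fun_prop : Continuous fun x : RSpace d => ((coneVec x (Sum.inr 0) ^ lam : ℝ) : ℂ) * f x)
  refine ⟨hf.measurable, C, fun x => ?_⟩
  have h0 := coneVec_time_pos x
  have := hC x
  simp only [Pi.mul_apply, norm_mul, Complex.norm_real] at this
  rw [Real.norm_of_nonneg (by positivity)] at this
  rw [Real.rpow_neg h0.le, ← div_eq_mul_inv, le_div_iff₀ (by positivity), mul_comm]
  exact this

end Decay

/-! ### The subgroup which fixes the last coordinate, and its action on the hyperplane. -/

section Extension

theorem extendMat_mulVec_castSucc {d : ℕ} (A : Matrix (LIdx d) (LIdx d) ℝ)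
    (v : LIdx (d + 1) → ℝ) :
    (fun i : LIdx d => (extendMat A *ᵥ v) (idxEquiv d (Sum.inl i))) =
      A *ᵥ fun i => v (idxEquiv d (Sum.inl i)) := by
  ext i
  simp only [extendMat, Matrix.reindex_apply, Matrix.mulVec, dotProduct]
  rw [← (idxEquiv d).sum_comp]
  simp [Fintype.sum_sum_type]

theorem extendMat_mulVec_last {d : ℕ} (A : Matrix (LIdx d) (LIdx d) ℝ)
    (v : LIdx (d + 1) → ℝ) :
    (extendMat A *ᵥ v) (idxEquiv d (Sum.inr 0)) = v (idxEquiv d (Sum.inr 0)) := by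
  simp only [extendMat, Matrix.reindex_apply, Matrix.mulVec, dotProduct]
  rw [← (idxEquiv d).sum_comp]
  simp [Fintype.sum_sum_type]

theorem idxEquiv_inl_inl {d : ℕ} (i : Fin (d + 1)) :
    idxEquiv d (Sum.inl (Sum.inl i)) = Sum.inl i.castSucc := by simp [idxEquiv]; rfl

theorem idxEquiv_inl_inr {d : ℕ} (i : Fin 1) :
    idxEquiv d (Sum.inl (Sum.inr i)) = Sum.inr i := by simp [idxEquiv]

theorem idxEquiv_inr {d : ℕ} : idxEquiv d (Sum.inr 0) = Sum.inl (Fin.last (d + 1)) := by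
  simp [idxEquiv]; rfl

theorem extendSO0_mat {d : ℕ} (h : SO0 d) : (extendSO0 d h).mat = extendMat h.mat := rfl

theorem coneVec_incl {d : ℕ} (y : RSpace d) (i : LIdx d) :
    coneVec (incl d y) (idxEquiv d (Sum.inl i)) = coneVec y i := by
  rcases i with i | i
  · rw [idxEquiv_inl_inl]
    refine Fin.cases ?_ (fun i => ?_) i
    · simp [coneVec]
    · simp only [coneVec, Sum.elim_inl, Fin.cons_succ, ← Fin.succ_castSucc]
      simp [incl]
  · rw [idxEquiv_inl_inr]
    simp [coneVec]

theorem movedCone_extend_incl {d : ℕ} (h : SO0 d) (y : RSpace d) (i : LIdx d) :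
    movedCone (extendSO0 d h) (incl d y) (idxEquiv d (Sum.inl i)) = movedCone h y i := by
  rw [movedCone, ← map_inv, extendSO0_mat]
  rw [congrFun (extendMat_mulVec_castSucc _ _) i]
  simp only [coneVec_incl]
  rfl

theorem movedCone_extend_last {d : ℕ} (h : SO0 d) (x : RSpace (d + 1)) :
    movedCone (extendSO0 d h) x (Sum.inl (Fin.last (d + 1))) = x (Fin.last d) := by
  rw [movedCone, ← map_inv, extendSO0_mat, ← idxEquiv_inr, extendMat_mulVec_last, idxEquiv_inr,
    ← Fin.succ_last]
  simp [coneVec]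

theorem confFactor_extend_incl {d : ℕ} (h : SO0 d) (y : RSpace d) :
    confFactor (extendSO0 d h) (incl d y) = confFactor h y := by
  rw [confFactor, confFactor, ← movedCone_extend_incl h y, ← movedCone_extend_incl h y,
    idxEquiv_inl_inl, idxEquiv_inl_inr]
  rfl

/-- In the cone the last coordinate is fixed, so on points it is only divided by the conformal
factor. Powers of it are therefore covariant and may enter an invariant kernel. -/
theorem confPoint_extend_last {d : ℕ} (h : SO0 d) (x : RSpace (d + 1)) :
    confPoint (extendSO0 d h) x (Fin.last d) =
      x (Fin.last d) / confFactor (extendSO0 d h) x := by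
  simp only [confPoint]
  rw [Fin.succ_last, movedCone_extend_last]

theorem confPoint_extend_incl {d : ℕ} (h : SO0 d) (y : RSpace d) :
    confPoint (extendSO0 d h) (incl d y) = incl d (confPoint h y) := by
  ext i
  refine Fin.lastCases ?_ (fun i => ?_) i
  · rw [confPoint_extend_last]; simp [incl]
  · simp only [confPoint]
    rw [confFactor_extend_incl, Fin.succ_castSucc, ← idxEquiv_inl_inl, movedCone_extend_incl]
    simp [incl]

end Extension

/-! ### Covariance of the Riesz kernel and of the symmetry breaking kernel. -/

section KernelInvariance

theorem kernel_covariant {d : ℕ} {mu lam : ℝ} (hlm : lam + mu = d) {h : SO0 d} {x y : RSpace d}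
    (hx : confFactor h x ≠ 0) (hy : confFactor h y ≠ 0) :
    confFactor h x ^ (-lam) * confFactor h y ^ (-lam) * ‖x - y‖ ^ (-(2 * mu)) =
      confFactor h x ^ (-(d : ℝ)) * (confFactor h y ^ (-(d : ℝ)) *
        ‖confPoint h x - confPoint h y‖ ^ (-(2 * mu))) := by
  have htx := confFactor_pos hx
  have hty := confFactor_pos hy
  have e : ∀ r : ℝ, 0 ≤ r → r ^ (-(2 * mu)) = (r ^ 2) ^ (-mu) := fun r hr => by
    rw [← Real.rpow_natCast, ← Real.rpow_mul hr]; congr 1; push_cast; ring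
  rw [e _ (norm_nonneg _), e _ (norm_nonneg _), norm_sub_sq_confPoint hx hy,
    Real.mul_rpow (by positivity) (by positivity), Real.mul_rpow htx.le hty.le, ← hlm, neg_add,
    Real.rpow_add htx, Real.rpow_add hty]
  ring

/-- The covariance of the kernel supplies the two Jacobians for a change of variables in x and in y.
No integrability is needed, because the change of variables holds for arbitrary functions. -/
theorem integral_kernel_principalAct {d : ℕ} [NeZero d] {mu lam : ℝ} (hlm : lam + mu = d)
    (h : SO0 d) (f g : RSpace d → ℂ) :
    ∫ x, ∫ y, principalAct lam h f y * (starRingEnd ℂ (principalAct lam h g x) *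
        (‖x - y‖ ^ (-(2 * mu)) : ℝ)) =
      ∫ x, ∫ y, f y * (starRingEnd ℂ (g x) * (‖x - y‖ ^ (-(2 * mu)) : ℝ)) := by
  rw [← integral_confPoint h fun x => ∫ y, f y * (starRingEnd ℂ (g x) *
    (‖x - y‖ ^ (-(2 * mu)) : ℝ))]
  refine integral_congr_ae ?_
  filter_upwards [ae_confFactor_ne h] with x hx
  rw [← integral_confPoint h fun y => f y * (starRingEnd ℂ (g (confPoint h x)) *
    (‖confPoint h x - y‖ ^ (-(2 * mu)) : ℝ)), ← integral_smul]
  refine integral_congr_ae ?_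
  filter_upwards [ae_confFactor_ne h] with y hy
  have := congrArg (fun r : ℝ => (r : ℂ)) (kernel_covariant hlm hx hy)
  simp only [Complex.ofReal_mul] at this
  simp only [principalAct, map_mul, Complex.conj_ofReal, Complex.real_smul]
  linear_combination f (confPoint h y) * (starRingEnd ℂ) (g (confPoint h x)) * this

theorem breaking_kernel_covariant {d j : ℕ} {mu lam lam' : ℝ} (hlm : lam + mu = d + 1)
    (hlm' : lam' + (mu + j) = d) {h : SO0 d} {x : RSpace (d + 1)} {y : RSpace d}
    (hx : confFactor (extendSO0 d h) x ≠ 0) (hy : confFactor h y ≠ 0) :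
    confFactor (extendSO0 d h) x ^ (-lam) * confFactor h y ^ (-lam') *
        (x (Fin.last d) ^ j * ‖x - incl d y‖ ^ (-(2 * (mu + j)))) =
      confFactor (extendSO0 d h) x ^ (-((d + 1 : ℕ) : ℝ)) * (confFactor h y ^ (-(d : ℝ)) *
        (confPoint (extendSO0 d h) x (Fin.last d) ^ j *
          ‖confPoint (extendSO0 d h) x - incl d (confPoint h y)‖ ^ (-(2 * (mu + j))))) := by
  have hy' : confFactor (extendSO0 d h) (incl d y) ≠ 0 := by rwa [confFactor_extend_incl]
  -- Covariance of the power of the norm in dimension d + 1. Two corrections remain: s^{-j} from the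
  -- power of the last coordinate at x, and one factor t because y ranges over dimension d only.
  have hk := kernel_covariant (lam := (d + 1 : ℕ) - (mu + j)) (mu := mu + j) (by simp) hx hy'
  rw [confFactor_extend_incl, confPoint_extend_incl] at hk
  have htx := confFactor_pos hx
  have hty := confFactor_pos hy
  set s := confFactor (extendSO0 d h) x
  set t := confFactor h y
  set N := ‖x - incl d y‖ ^ (-(2 * (mu + j)))
  set N' := ‖confPoint (extendSO0 d h) x - incl d (confPoint h y)‖ ^ (-(2 * (mu + j)))
  rw [confPoint_extend_last, div_pow]
  have e1 : s ^ (-lam) = s ^ (-((d + 1 : ℕ) - (mu + j) : ℝ)) / s ^ j := by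
    rw [← Real.rpow_natCast, ← Real.rpow_sub htx]; congr 1; push_cast; linarith
  have e2 : t ^ (-lam') = t ^ (-((d + 1 : ℕ) - (mu + j) : ℝ)) * t := by
    rw [← Real.rpow_add_one hty.ne']; congr 1; push_cast; linarith
  have e3 : t ^ (-(d : ℝ)) = t ^ (-((d + 1 : ℕ) : ℝ)) * t := by
    rw [← Real.rpow_add_one hty.ne']; congr 1; push_cast; ring
  rw [e1, e2, e3]
  linear_combination (x (Fin.last d) ^ j / s ^ j * t) * hk

theorem integral_breaking_kernel_principalAct {d j : ℕ} [NeZero d] {mu lam lam' : ℝ}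
    (hlm : lam + mu = d + 1) (hlm' : lam' + (mu + j) = d) (h : SO0 d) (f : RSpace d → ℂ)
    (g : RSpace (d + 1) → ℂ) :
    ∫ x, ∫ y, principalAct lam' h f y * (starRingEnd ℂ (principalAct lam (extendSO0 d h) g x) *
        (x (Fin.last d) ^ j * ‖x - incl d y‖ ^ (-(2 * (mu + j))) : ℝ)) =
      ∫ x, ∫ y, f y * (starRingEnd ℂ (g x) *
        (x (Fin.last d) ^ j * ‖x - incl d y‖ ^ (-(2 * (mu + j))) : ℝ)) := by
  rw [← integral_confPoint (extendSO0 d h) fun x => ∫ y, f y * (starRingEnd ℂ (g x) *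
    (x (Fin.last d) ^ j * ‖x - incl d y‖ ^ (-(2 * (mu + j))) : ℝ))]
  refine integral_congr_ae ?_
  filter_upwards [ae_confFactor_ne (extendSO0 d h)] with x hx
  rw [← integral_confPoint h fun y => f y * (starRingEnd ℂ (g (confPoint (extendSO0 d h) x)) *
    (confPoint (extendSO0 d h) x (Fin.last d) ^ j *
      ‖confPoint (extendSO0 d h) x - incl d y‖ ^ (-(2 * (mu + j))) : ℝ)), ← integral_smul]
  refine integral_congr_ae ?_
  filter_upwards [ae_confFactor_ne h] with y hy
  have := congrArg (fun r : ℝ => (r : ℂ)) (breaking_kernel_covariant hlm hlm' hx hy)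
  simp only [Complex.ofReal_mul] at this ⊢
  simp only [principalAct, map_mul, Complex.conj_ofReal, Complex.real_smul]
  linear_combination f (confPoint h y) * (starRingEnd ℂ) (g (confPoint (extendSO0 d h) x)) * this

end KernelInvariance

/-! ### Directional derivatives of Gaussians and their Fourier transforms. -/

section GaussianMoments

variable {W : Type*} [NormedAddCommGroup W] [InnerProductSpace ℝ W]

/-- The coefficients of the `j`-th derivative of the Gaussian `exp (-π u x²)`. -/
noncomputable def gaussCoeff : ℕ → ℕ → ℝ
  | 0, 0 => 1
  | 0, _ + 1 => 0
  | j + 1, 0 => -2 * Real.pi * gaussCoeff j 0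
  | j + 1, m + 1 => -2 * Real.pi * gaussCoeff j (m + 1) + ((j - 2 * m : ℕ) : ℝ) * gaussCoeff j m

theorem gaussCoeff_zero_ne (j : ℕ) : gaussCoeff j 0 ≠ 0 := by
  induction j with
  | zero => simp [gaussCoeff]
  | succ j ih => simp [gaussCoeff, ih, Real.pi_ne_zero]

/-- Makes the truncated exponents j - 2m harmless and lets sums up to j be replaced by sums up to
j/2. -/
theorem gaussCoeff_eq_zero {j m : ℕ} (h : j < 2 * m) : gaussCoeff j m = 0 := by
  induction j generalizing m with
  | zero =>
    cases m with
    | zero => simp at h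
    | succ m => rfl
  | succ j ih =>
    cases m with
    | zero => simp at h
    | succ m =>
      rw [gaussCoeff, ih (by omega)]
      have : j - 2 * m = 0 := by omega
      simp [this]

/-- The `j`-th derivative of `exp (-π u |ζ|²)` in the direction of the unit vector `e`. -/
noncomputable def gaussKer (e : W) (j : ℕ) (u : ℝ) (ζ : W) : ℝ :=
  (∑ m ∈ Finset.range (j + 1), gaussCoeff j m * (inner ℝ ζ e ^ (j - 2 * m) * u ^ (j - m))) *
    Real.exp (-(Real.pi * u * ‖ζ‖ ^ 2))

/-- The right side is the product rule applied to a polynomial times a Gaussian. The recursion for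
the coefficients collects equal powers, after a shift of the index in the terms where the polynomial
is differentiated. -/
theorem gaussCoeff_sum_succ (j : ℕ) (a u : ℝ) :
    ∑ m ∈ Finset.range (j + 1 + 1), gaussCoeff (j + 1) m * (a ^ (j + 1 - 2 * m) * u ^ (j + 1 - m)) =
      ∑ m ∈ Finset.range (j + 1), gaussCoeff j m *
        (((j - 2 * m : ℕ) : ℝ) * a ^ (j - 2 * m - 1) * u ^ (j - m) -
          2 * Real.pi * u * a * (a ^ (j - 2 * m) * u ^ (j - m))) := by
  have h1 : ∀ m ∈ Finset.range (j + 1), gaussCoeff j m * (2 * Real.pi * u * a *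
      (a ^ (j - 2 * m) * u ^ (j - m))) =
      2 * Real.pi * (gaussCoeff j m * (a ^ (j + 1 - 2 * m) * u ^ (j + 1 - m))) := by
    intro m hm
    rcases lt_or_ge j (2 * m) with h | h
    · simp [gaussCoeff_eq_zero h]
    · have e1 : j + 1 - 2 * m = j - 2 * m + 1 := by omega
      have e2 : j + 1 - m = j - m + 1 := by omega
      rw [e1, e2]; ring
  simp only [mul_sub, Finset.sum_sub_distrib]
  rw [Finset.sum_congr rfl h1, ← Finset.mul_sum, Finset.sum_range_succ' _ (j + 1)]
  have h2 : ∑ m ∈ Finset.range (j + 1), gaussCoeff j m * (a ^ (j + 1 - 2 * m) * u ^ (j + 1 - m)) =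
      ∑ m ∈ Finset.range (j + 1), gaussCoeff j (m + 1) *
        (a ^ (j - 2 * m - 1) * u ^ (j - m)) + gaussCoeff j 0 * (a ^ (j + 1) * u ^ (j + 1)) := by
    have h3 := Finset.sum_range_succ (fun m => gaussCoeff j m *
      (a ^ (j + 1 - 2 * m) * u ^ (j + 1 - m))) (j + 1)
    rw [gaussCoeff_eq_zero (by omega : j < 2 * (j + 1)), zero_mul, add_zero] at h3
    rw [← h3, Finset.sum_range_succ']
    congr 1
    refine Finset.sum_congr rfl fun m hm => ?_
    have e1 : j + 1 - 2 * (m + 1) = j - 2 * m - 1 := by omega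
    have e2 : j + 1 - (m + 1) = j - m := by omega
    rw [e1, e2]
  rw [h2, mul_add, ← sub_sub, Finset.mul_sum, ← Finset.sum_sub_distrib, sub_eq_add_neg]
  congr 1
  · refine Finset.sum_congr rfl fun m hm => ?_
    have e1 : j + 1 - 2 * (m + 1) = j - 2 * m - 1 := by omega
    have e2 : j + 1 - (m + 1) = j - m := by omega
    rw [e1, e2, gaussCoeff]; ring
  · rw [gaussCoeff]; simp; ring

theorem hasLineDerivAt_gaussKer {e : W} (he : ‖e‖ = 1) (j : ℕ) (u : ℝ) (ζ : W) :
    HasLineDerivAt ℝ (gaussKer e j u) (gaussKer e (j + 1) u ζ) ζ e := by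
  have hin : ∀ s : ℝ, inner ℝ (ζ + s • e) e = inner ℝ ζ e + s := fun s => by
    rw [inner_add_left, inner_smul_left, real_inner_self_eq_norm_sq, he]; simp
  have hnorm : ∀ s : ℝ, ‖ζ + s • e‖ ^ 2 = ‖ζ‖ ^ 2 + 2 * s * inner ℝ ζ e + s ^ 2 := fun s => by
    rw [norm_add_sq_real, inner_smul_right, norm_smul, he]; simp; ring
  set a : ℝ := inner ℝ ζ e with ha
  have h1 : ∀ m, HasDerivAt (fun s : ℝ => gaussCoeff j m * ((a + s) ^ (j - 2 * m) * u ^ (j - m)))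
      (gaussCoeff j m * (((j - 2 * m : ℕ) : ℝ) * a ^ (j - 2 * m - 1) * u ^ (j - m))) 0 := by
    intro m
    have := ((((hasDerivAt_id (0 : ℝ)).const_add a).pow (j - 2 * m)).mul_const
      (u ^ (j - m))).const_mul (gaussCoeff j m)
    simpa using this
  have h2 : HasDerivAt (fun s : ℝ => Real.exp (-(Real.pi * u * (‖ζ‖ ^ 2 + 2 * s * a + s ^ 2))))
      (Real.exp (-(Real.pi * u * ‖ζ‖ ^ 2)) * -(Real.pi * u * (2 * a))) 0 := by
    have h3 : HasDerivAt (fun s : ℝ => -(Real.pi * u * (‖ζ‖ ^ 2 + 2 * s * a + s ^ 2)))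
        (-(Real.pi * u * (2 * a))) 0 := by
      have := ((((((hasDerivAt_id (0 : ℝ)).const_mul 2).mul_const a).const_add (‖ζ‖ ^ 2)).add
        ((hasDerivAt_id (0 : ℝ)).pow 2)).const_mul (Real.pi * u)).fun_neg
      simpa using this
    simpa using h3.exp
  have h4 := (HasDerivAt.fun_sum fun m (_ : m ∈ Finset.range (j + 1)) => h1 m).mul h2
  simp only [HasLineDerivAt, gaussKer, hin, hnorm]
  refine h4.congr_deriv ?_
  rw [gaussCoeff_sum_succ, ← ha]
  simp only [add_zero, mul_zero, zero_mul, ne_eq, OfNat.ofNat_ne_zero, not_false_eq_true, zero_pow]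
  simp only [mul_sub, Finset.sum_sub_distrib]
  rw [sub_mul, sub_eq_add_neg]
  congr 1
  rw [Finset.sum_mul, Finset.sum_mul, ← Finset.sum_neg_distrib]
  exact Finset.sum_congr rfl fun m _ => by ring

theorem norm_cexp_inner (x ζ : W) :
    ‖Complex.exp (↑(2 * Real.pi * inner ℝ ζ x) * Complex.I)‖ = 1 :=
  Complex.norm_exp_ofReal_mul_I _

variable [FiniteDimensional ℝ W] [MeasurableSpace W] [BorelSpace W]

theorem integrable_gaussian {b : ℝ} (hb : 0 < b) :
    Integrable fun ζ : W => Real.exp (-(b * ‖ζ‖ ^ 2)) := by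
  have h := (GaussianFourier.integrable_cexp_neg_mul_sq_norm_add (V := W) (b := b)
    (by simpa using hb) 0 0).norm
  refine h.congr (Filter.Eventually.of_forall fun ζ => ?_)
  simp [Complex.norm_exp, ← Complex.ofReal_pow]

/-- Half of the exponent absorbs the polynomial, by x^n / n! ≤ e^x; the other half is integrable. -/
theorem integrable_inner_pow_mul_gaussian {e : W} (he : ‖e‖ = 1) (n : ℕ) {b : ℝ} (hb : 0 < b) :
    Integrable fun ζ : W => inner ℝ ζ e ^ n * Real.exp (-(b * ‖ζ‖ ^ 2)) := by
  have hg := (integrable_gaussian (W := W) (half_pos hb)).const_mul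
    (1 + n.factorial * (2 / b) ^ n)
  refine hg.mono' (by fun_prop) (Filter.Eventually.of_forall fun ζ => ?_)
  have h1 : |inner ℝ ζ e| ≤ ‖ζ‖ := by simpa [he] using abs_real_inner_le_norm ζ e
  have h2 : ‖ζ‖ ^ n ≤ 1 + (‖ζ‖ ^ 2) ^ n := by
    rcases le_total ‖ζ‖ 1 with h | h
    · have := pow_le_one₀ (n := n) (norm_nonneg ζ) h
      have : 0 ≤ (‖ζ‖ ^ 2) ^ n := by positivity
      linarith
    · rw [← pow_mul]
      have := pow_le_pow_right₀ h (by omega : n ≤ 2 * n)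
      linarith
  have h3 : (‖ζ‖ ^ 2) ^ n ≤ n.factorial * (2 / b) ^ n * Real.exp (b / 2 * ‖ζ‖ ^ 2) := by
    have := Real.pow_div_factorial_le_exp (b / 2 * ‖ζ‖ ^ 2) (by positivity) n
    rw [div_le_iff₀ (by positivity), mul_pow] at this
    calc _ = (2 / b) ^ n * ((b / 2) ^ n * (‖ζ‖ ^ 2) ^ n) := by
          rw [← mul_assoc, ← mul_pow]; field_simp; simp
      _ ≤ (2 / b) ^ n * (Real.exp (b / 2 * ‖ζ‖ ^ 2) * n.factorial) := by gcongr
      _ = _ := by ring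
  have h4 : (1 : ℝ) ≤ Real.exp (b / 2 * ‖ζ‖ ^ 2) := Real.one_le_exp (by positivity)
  have h5 : Real.exp (-(b * ‖ζ‖ ^ 2)) =
      Real.exp (-(b / 2 * ‖ζ‖ ^ 2)) * Real.exp (-(b / 2 * ‖ζ‖ ^ 2)) := by
    rw [← Real.exp_add]; congr 1; ring
  have h6 : Real.exp (b / 2 * ‖ζ‖ ^ 2) * Real.exp (-(b / 2 * ‖ζ‖ ^ 2)) = 1 := by
    rw [← Real.exp_add]; simp
  rw [norm_mul, norm_pow, Real.norm_eq_abs, Real.norm_of_nonneg (Real.exp_pos _).le, h5,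
    ← mul_assoc]
  refine mul_le_mul_of_nonneg_right ?_ (Real.exp_pos _).le
  calc _ ≤ ((1 + n.factorial * (2 / b) ^ n) * Real.exp (b / 2 * ‖ζ‖ ^ 2)) *
        Real.exp (-(b / 2 * ‖ζ‖ ^ 2)) := by
        gcongr
        calc _ ≤ ‖ζ‖ ^ n := by gcongr
          _ ≤ _ := by rw [add_mul]; linarith
    _ = _ := by rw [mul_assoc, h6, mul_one]

theorem integrable_gaussKer {e : W} (he : ‖e‖ = 1) (j : ℕ) {u : ℝ} (hu : 0 < u) :
    Integrable (gaussKer e j u) := by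
  have h : gaussKer e j u = fun ζ => ∑ m ∈ Finset.range (j + 1),
      gaussCoeff j m * (inner ℝ ζ e ^ (j - 2 * m) * u ^ (j - m)) *
        Real.exp (-(Real.pi * u * ‖ζ‖ ^ 2)) := by
    funext ζ; rw [gaussKer, Finset.sum_mul]
  rw [h]
  refine integrable_finsetSum _ fun m _ => ?_
  refine ((integrable_inner_pow_mul_gaussian he (j - 2 * m)
    (mul_pos Real.pi_pos hu)).const_mul (gaussCoeff j m * u ^ (j - m))).congr
    (Filter.Eventually.of_forall fun ζ => ?_)
  simp only; ring

theorem integrable_mul_cexp {k : W → ℂ} (hk : Integrable k) (x : W) :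
    Integrable fun ζ => k ζ * Complex.exp (↑(2 * Real.pi * inner ℝ ζ x) * Complex.I) :=
  hk.mul_bdd (by fun_prop) (c := 1) (Filter.Eventually.of_forall fun ζ => (norm_cexp_inner x ζ).le)

theorem integral_gaussian_mul_cexp {u : ℝ} (hu : 0 < u) (x : W) :
    ∫ ζ : W, (Real.exp (-(Real.pi * u * ‖ζ‖ ^ 2)) : ℂ) *
        Complex.exp (↑(2 * Real.pi * inner ℝ ζ x) * Complex.I) =
      ((u⁻¹ ^ ((Module.finrank ℝ W : ℝ) / 2) *
        Real.exp (-(Real.pi * u⁻¹ * ‖x‖ ^ 2)) : ℝ) : ℂ) := by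
  have h := fourier_gaussian_innerProductSpace (V := W) (b := (Real.pi * u : ℝ))
    (by simpa using mul_pos Real.pi_pos hu) (-x)
  rw [Real.fourier_eq'] at h
  have e1 : (↑Real.pi / ((Real.pi * u : ℝ) : ℂ)) ^ ((Module.finrank ℝ W : ℂ) / 2) =
      ((u⁻¹ ^ ((Module.finrank ℝ W : ℝ) / 2) : ℝ) : ℂ) := by
    rw [Complex.ofReal_cpow (by positivity)]
    push_cast
    congr 1
    field_simp [Real.pi_ne_zero]
  have e2 : -(Real.pi : ℂ) ^ 2 * (‖-x‖ : ℂ) ^ 2 / ((Real.pi * u : ℝ) : ℂ) =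
      ((-(Real.pi * u⁻¹ * ‖x‖ ^ 2) : ℝ) : ℂ) := by
    have : (Real.pi : ℂ) ≠ 0 := by exact_mod_cast Real.pi_ne_zero
    have : (u : ℂ) ≠ 0 := by exact_mod_cast hu.ne'
    rw [norm_neg]; push_cast; field_simp
  rw [e1, e2, ← Complex.ofReal_exp, ← Complex.ofReal_mul] at h
  rw [← h]
  refine integral_congr_ae (Filter.Eventually.of_forall fun ζ => ?_)
  simp only [inner_neg_right, smul_eq_mul]
  rw [mul_comm]
  congr 1
  · congr 2; push_cast; ring
  · push_cast; congr 1; ring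

/-- Each derivative is moved to the character by integration by parts and produces a factor -2πi⟨x,
e⟩. -/
theorem integral_gaussKer_mul_cexp {e : W} (he : ‖e‖ = 1) (j : ℕ) {u : ℝ} (hu : 0 < u) (x : W) :
    ∫ ζ : W, (gaussKer e j u ζ : ℂ) * Complex.exp (↑(2 * Real.pi * inner ℝ ζ x) * Complex.I) =
      (-(2 * Real.pi * Complex.I)) ^ j * ((inner ℝ x e ^ j * (u⁻¹ ^ ((Module.finrank ℝ W : ℝ) / 2) *
        Real.exp (-(Real.pi * u⁻¹ * ‖x‖ ^ 2))) : ℝ) : ℂ) := by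
  induction j with
  | zero =>
    rw [pow_zero, pow_zero, one_mul, one_mul, ← integral_gaussian_mul_cexp hu]
    simp [gaussKer, gaussCoeff]
  | succ j ih =>
    have hk := fun i => (integrable_gaussKer he i hu).ofReal (𝕜 := ℂ)
    set E : W → ℂ := fun ζ => Complex.exp (↑(2 * Real.pi * inner ℝ ζ x) * Complex.I) with hE
    have hEd : ∀ ζ, HasLineDerivAt ℝ E ((2 * Real.pi * Complex.I * inner ℝ x e) * E ζ) ζ e := by
      intro ζ
      have h1 : HasDerivAt (fun s : ℝ => ((2 * Real.pi * (inner ℝ ζ x + s * inner ℝ x e) : ℝ) : ℂ) *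
          Complex.I) (2 * Real.pi * Complex.I * inner ℝ x e) 0 := by
        have := (((((hasDerivAt_id (0 : ℝ)).mul_const (inner ℝ x e)).const_add
          (inner ℝ ζ x)).const_mul (2 * Real.pi)).ofReal_comp).mul_const Complex.I
        refine this.congr_deriv ?_
        simp; ring
      have h2 := h1.cexp
      simp only [HasLineDerivAt, hE, inner_add_left, inner_smul_left, real_inner_comm x e]
      refine h2.congr_deriv ?_
      simp; ring
    have hkd : ∀ ζ, HasLineDerivAt ℝ (fun ζ => (gaussKer e j u ζ : ℂ))
        (gaussKer e (j + 1) u ζ : ℂ) ζ e := fun ζ => by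
      have := (hasLineDerivAt_gaussKer he j u ζ)
      simp only [HasLineDerivAt] at this ⊢
      exact this.ofReal_comp
    have hibp := integral_bilinear_hasLineDerivAt_right_eq_neg_left_of_integrable
      (μ := (volume : Measure W)) (B := ContinuousLinearMap.mul ℝ ℂ) (v := e)
      (f := fun ζ => (gaussKer e j u ζ : ℂ)) (f' := fun ζ => (gaussKer e (j + 1) u ζ : ℂ))
      (g := E) (g' := fun ζ => (2 * Real.pi * Complex.I * inner ℝ x e) * E ζ)
      (by simpa [hE] using integrable_mul_cexp (hk (j + 1)) x)
      (by
        have := (integrable_mul_cexp (hk j) x).const_mul (2 * Real.pi * Complex.I * inner ℝ x e)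
        refine this.congr (Filter.Eventually.of_forall fun ζ => ?_)
        simp [hE]; ring)
      (by simpa [hE] using integrable_mul_cexp (hk j) x)
      (fun ζ _ => hkd ζ) (fun ζ _ => hEd ζ)
    simp only [ContinuousLinearMap.mul_apply'] at hibp
    have h3 : ∫ ζ, (gaussKer e j u ζ : ℂ) * ((2 * Real.pi * Complex.I * inner ℝ x e) * E ζ) =
        (2 * Real.pi * Complex.I * inner ℝ x e) * ∫ ζ, (gaussKer e j u ζ : ℂ) * E ζ := by
      rw [← integral_const_mul]
      exact integral_congr_ae (Filter.Eventually.of_forall fun ζ => by simp only; ring)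
    rw [h3, ih] at hibp
    rw [← neg_eq_iff_eq_neg] at hibp
    rw [← hibp]
    push_cast
    ring

end GaussianMoments

/-! ### Powers as superpositions of exponentials. -/

section Subordination

theorem integrableOn_rpow_mul_exp {a r : ℝ} (ha : 0 < a) (hr : 0 < r) :
    IntegrableOn (fun t : ℝ => t ^ (a - 1) * Real.exp (-(r * t))) (Set.Ioi 0) := by
  have := integrableOn_rpow_mul_exp_neg_mul_rpow (p := 1) (s := a - 1) (by linarith) one_pos hr
  simpa using this

/-- The substitution t ↦ 1/t in the Gamma integral. Both weights are needed because the Fourier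
transform of a Gaussian interchanges the width parameters t and 1/t. -/
theorem integrableOn_rpow_mul_exp_inv {b r : ℝ} (hb : 0 < b) (hr : 0 < r) :
    IntegrableOn (fun t : ℝ => t ^ (-b - 1) * Real.exp (-(r * t⁻¹))) (Set.Ioi 0) := by
  have h := (integrableOn_Ioi_comp_rpow_iff (fun t : ℝ => t ^ (b - 1) * Real.exp (-(r * t)))
    (p := -1) (by norm_num)).2 (integrableOn_rpow_mul_exp hb hr)
  refine h.congr_fun (fun t ht => ?_) measurableSet_Ioi
  have ht : (0 : ℝ) < t := ht
  simp only [abs_neg, abs_one, one_mul, smul_eq_mul, Real.rpow_neg_one]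
  rw [Real.inv_rpow ht.le, ← Real.rpow_neg ht.le, ← mul_assoc, ← Real.rpow_add ht]
  congr 2; ring

theorem integral_rpow_mul_exp_inv {b r : ℝ} (hb : 0 < b) (hr : 0 < r) :
    ∫ t in Set.Ioi (0 : ℝ), t ^ (-b - 1) * Real.exp (-(r * t⁻¹)) = Real.Gamma b * r ^ (-b) := by
  rw [Real.rpow_neg hr.le, ← Real.inv_rpow hr.le, ← one_div, mul_comm,
    ← Real.integral_rpow_mul_exp_neg_mul_Ioi hb hr,
    ← integral_comp_rpow_Ioi (fun t : ℝ => t ^ (b - 1) * Real.exp (-(r * t))) (p := -1)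
      (by norm_num)]
  refine setIntegral_congr_fun measurableSet_Ioi fun t ht => ?_
  have ht : (0 : ℝ) < t := ht
  simp only [abs_neg, abs_one, one_mul, smul_eq_mul, Real.rpow_neg_one]
  rw [Real.inv_rpow ht.le, ← Real.rpow_neg ht.le, ← mul_assoc, ← Real.rpow_add ht]
  congr 2; ring

/-- Fubini for a weight `φ t r` whose integral over `t` is `c r^{-a}`. -/
theorem integrable_subordination {α : Type*} [MeasurableSpace α] {μ : Measure α} [SFinite μ]
    {φ : ℝ → ℝ → ℝ} (hφm : Measurable (Function.uncurry φ)) {c a : ℝ}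
    (hφ0 : ∀ t r : ℝ, 0 < t → 0 ≤ φ t r)
    (hφi : ∀ r : ℝ, 0 < r → IntegrableOn (fun t => φ t r) (Set.Ioi 0))
    (hφv : ∀ r : ℝ, 0 < r → ∫ t in Set.Ioi 0, φ t r = c * r ^ (-a))
    {F : α → ℂ} {r : α → ℝ} (hr : Measurable r) (hr0 : ∀ᵐ p ∂μ, 0 < r p)
    (hFm : AEStronglyMeasurable F μ)
    (hF : Integrable (fun p => ((r p ^ (-a) : ℝ) : ℂ) * F p) μ) :
    Integrable (fun z : ℝ × α => ((φ z.1 (r z.2) : ℝ) : ℂ) * F z.2)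
      ((volume.restrict (Set.Ioi 0)).prod μ) := by
  have hm : AEStronglyMeasurable (fun z : ℝ × α => ((φ z.1 (r z.2) : ℝ) : ℂ) * F z.2)
      ((volume.restrict (Set.Ioi 0)).prod μ) := by
    refine AEStronglyMeasurable.mul (Measurable.aestronglyMeasurable ?_) hFm.comp_snd
    exact Complex.measurable_ofReal.comp
      (hφm.comp (measurable_fst.prodMk (hr.comp measurable_snd)))
  rw [integrable_prod_iff' hm]
  constructor
  · filter_upwards [hr0] with p hp
    exact ((hφi _ hp).ofReal (𝕜 := ℂ)).mul_const _
  · refine (hF.norm.const_mul c).congr ?_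
    filter_upwards [hr0] with p hp
    simp only [norm_mul, Complex.norm_real]
    rw [integral_mul_const, Real.norm_of_nonneg (by positivity), ← mul_assoc, ← hφv _ hp]
    congr 1
    exact setIntegral_congr_fun measurableSet_Ioi fun t ht =>
      (Real.norm_of_nonneg (hφ0 t _ ht)).symm

theorem integral_subordination {α : Type*} [MeasurableSpace α] {μ : Measure α} [SFinite μ]
    {φ : ℝ → ℝ → ℝ} (hφm : Measurable (Function.uncurry φ)) {c a : ℝ}
    (hφ0 : ∀ t r : ℝ, 0 < t → 0 ≤ φ t r)
    (hφi : ∀ r : ℝ, 0 < r → IntegrableOn (fun t => φ t r) (Set.Ioi 0))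
    (hφv : ∀ r : ℝ, 0 < r → ∫ t in Set.Ioi 0, φ t r = c * r ^ (-a))
    {F : α → ℂ} {r : α → ℝ} (hr : Measurable r) (hr0 : ∀ᵐ p ∂μ, 0 < r p)
    (hFm : AEStronglyMeasurable F μ)
    (hF : Integrable (fun p => ((r p ^ (-a) : ℝ) : ℂ) * F p) μ) :
    ∫ t in Set.Ioi (0 : ℝ), ∫ p, ((φ t (r p) : ℝ) : ℂ) * F p ∂μ =
      c * ∫ p, ((r p ^ (-a) : ℝ) : ℂ) * F p ∂μ := by
  rw [integral_integral_swap (f := fun t p => ((φ t (r p) : ℝ) : ℂ) * F p)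
    (integrable_subordination hφm hφ0 hφi hφv hr hr0 hFm hF), ← integral_const_mul]
  refine integral_congr_ae ?_
  filter_upwards [hr0] with p hp
  rw [integral_mul_const, integral_complex_ofReal, hφv _ hp, Complex.ofReal_mul, mul_assoc]

end Subordination

/-! ### Pairings with a translation kernel on the Fourier side. -/

section KernelFourier

section

variable {W : Type*} [NormedAddCommGroup W] [InnerProductSpace ℝ W]

/-- The polynomial `P` such that `P(ζ) |ζ|^{-2ν}` is up to a factor the Fourier transform of
`s^j |x|^{-2(mu + j)}`. -/
noncomputable def breakPoly (e : W) (ν : ℝ) (j : ℕ) (ζ : W) : ℝ :=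
  ∑ m ∈ Finset.range (j / 2 + 1), gaussCoeff j m * (Real.Gamma (ν - m) *
    Real.pi ^ (-(ν - m))) * (inner ℝ ζ e ^ (j - 2 * m) * (‖ζ‖ ^ 2) ^ m)

theorem gaussKer_eq (e : W) (j : ℕ) (u : ℝ) (ζ : W) : gaussKer e j u ζ =
    ∑ m ∈ Finset.range (j / 2 + 1), gaussCoeff j m * inner ℝ ζ e ^ (j - 2 * m) *
      (u ^ (j - m) * Real.exp (-(Real.pi * ‖ζ‖ ^ 2 * u))) := by
  have e1 : Real.pi * ‖ζ‖ ^ 2 * u = Real.pi * u * ‖ζ‖ ^ 2 := by ring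
  rw [gaussKer, Finset.sum_mul, e1]
  symm
  refine Finset.sum_subset_zero_on_sdiff (by intro m; simp; omega) (fun m hm => ?_)
    (fun m _ => by ring)
  simp only [Finset.mem_sdiff, Finset.mem_range, not_lt] at hm
  rw [gaussCoeff_eq_zero (by omega)]; ring

end

variable {V W : Type*} [NormedAddCommGroup W] [InnerProductSpace ℝ W] [FiniteDimensional ℝ W]
  [MeasurableSpace W] [BorelSpace W] [NormedAddCommGroup V] [InnerProductSpace ℝ V]
  [FiniteDimensional ℝ V] [MeasurableSpace V] [BorelSpace V]

theorem integrable_conj {f : W → ℂ} (hf : Integrable f) :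
    Integrable fun x => starRingEnd ℂ (f x) :=
  (Complex.conjLIE.toContinuousLinearEquiv.integrable_comp_iff).2 hf

theorem integrable_prod_conj_mul {f : V → ℂ} {g : W → ℂ} (hf : Integrable f) (hg : Integrable g) :
    Integrable (fun p : W × V => f p.2 * starRingEnd ℂ (g p.1)) := by
  refine ((integrable_conj hg).mul_prod hf).congr (Filter.Eventually.of_forall fun p => ?_)
  simp only; ring

/-- Fubini. The kernel is an inverse Fourier transform evaluated at x - ι y, and its character
splits into one for x at frequency ζ and one for y at frequency A ζ, as A is the adjoint of ι. The
case ι = id serves the Riesz kernel, the inclusion of the hyperplane the symmetry breaking kernel.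
-/
theorem integral_prod_kernel {ι : V →ₗᵢ[ℝ] W} {A : W →L[ℝ] V}
    (hA : ∀ y ζ, inner ℝ ζ (ι y) = inner ℝ y (A ζ)) {k : W → ℂ} (hk : Integrable k)
    {f : V → ℂ} {g : W → ℂ} (hf : Integrable f) (hg : Integrable g) :
    ∫ p : W × V, (∫ ζ, k ζ * Complex.exp (↑(2 * Real.pi * inner ℝ ζ (p.1 - ι p.2)) * Complex.I)) *
        (f p.2 * starRingEnd ℂ (g p.1)) =
      ∫ ζ, k ζ * (𝓕 f (A ζ) * starRingEnd ℂ (𝓕 g ζ)) := by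
  have hιc : Continuous ι := ι.continuous
  have hint : Integrable (Function.uncurry fun (p : W × V) (ζ : W) => k ζ *
      Complex.exp (↑(2 * Real.pi * inner ℝ ζ (p.1 - ι p.2)) * Complex.I) *
      (f p.2 * starRingEnd ℂ (g p.1))) (volume.prod volume) := by
    have h1 := (integrable_prod_conj_mul hf hg).mul_prod hk
    have h2 := h1.mul_bdd (g := fun z : (W × V) × W =>
      Complex.exp (↑(2 * Real.pi * inner ℝ z.2 (z.1.1 - ι z.1.2)) * Complex.I)) (c := 1)
      (by fun_prop) (Filter.Eventually.of_forall fun z => (norm_cexp_inner _ _).le)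
    refine h2.congr (Filter.Eventually.of_forall fun z => ?_)
    simp only [Function.uncurry]; ring
  simp_rw [← integral_mul_const]
  rw [integral_integral_swap hint]
  refine integral_congr_ae (Filter.Eventually.of_forall fun ζ => ?_)
  simp only
  have h3 : starRingEnd ℂ (𝓕 g ζ) = ∫ x, Complex.exp (↑(2 * Real.pi * inner ℝ ζ x) * Complex.I) *
      starRingEnd ℂ (g x) := by
    rw [Real.fourier_eq', ← integral_conj]
    refine integral_congr_ae (Filter.Eventually.of_forall fun x => ?_)
    simp only [smul_eq_mul, map_mul, ← Complex.exp_conj, Complex.conj_I, Complex.conj_ofReal]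
    congr 2
    rw [real_inner_comm]; push_cast; ring
  have h4 : 𝓕 f (A ζ) = ∫ y, Complex.exp (↑(-2 * Real.pi * inner ℝ ζ (ι y)) * Complex.I) * f y := by
    rw [Real.fourier_eq']
    refine integral_congr_ae (Filter.Eventually.of_forall fun y => ?_)
    simp only [smul_eq_mul, hA]
  rw [h3, h4, mul_comm (∫ y, _), ← integral_prod_mul, ← integral_const_mul]
  refine integral_congr_ae (Filter.Eventually.of_forall fun p => ?_)
  simp only
  have h5 : Complex.exp (↑(2 * Real.pi * inner ℝ ζ (p.1 - ι p.2)) * Complex.I) =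
      Complex.exp (↑(2 * Real.pi * inner ℝ ζ p.1) * Complex.I) *
      Complex.exp (↑(-2 * Real.pi * inner ℝ ζ (ι p.2)) * Complex.I) := by
    rw [← Complex.exp_add, inner_sub_right]; congr 1; push_cast; ring
  rw [h5]; ring

theorem ae_norm_pos [Nontrivial W] : ∀ᵐ ζ : W, 0 < ‖ζ‖ := by
  have : ∀ᵐ ζ : W, ζ ≠ 0 := compl_mem_ae_iff.2 (measure_singleton 0)
  filter_upwards [this] with ζ hζ using norm_pos_iff.2 hζ

theorem ae_norm_sub_pos [Nontrivial V] (ι : V →ₗᵢ[ℝ] W) :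
    ∀ᵐ p : W × V, 0 < ‖p.1 - ι p.2‖ := by
  have hm : MeasurableSet {p : W × V | ‖p.1 - ι p.2‖ = 0} := by
    have : Continuous fun p : W × V => ‖p.1 - ι p.2‖ :=
      (continuous_fst.sub (ι.continuous.comp continuous_snd)).norm
    exact (isClosed_singleton.preimage this).measurableSet
  have h0 : (volume : Measure (W × V)) {p : W × V | ‖p.1 - ι p.2‖ = 0} = 0 := by
    rw [Measure.volume_eq_prod, Measure.measure_prod_null hm]
    refine Filter.Eventually.of_forall fun x => ?_
    refine Set.Subsingleton.measure_zero ?_ _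
    intro y hy z hz
    simp only [Set.mem_preimage, Set.mem_ofPred_eq, norm_eq_zero, sub_eq_zero] at hy hz
    exact ι.injective (hy.symm.trans hz)
  filter_upwards [compl_mem_ae_iff.2 h0] with p hp
  exact lt_of_le_of_ne (norm_nonneg _) (Ne.symm hp)

theorem measurable_expWeight (a : ℝ) :
    Measurable (Function.uncurry fun t r : ℝ => t ^ (a - 1) * Real.exp (-(r * t))) := by
  unfold Function.uncurry; fun_prop

theorem measurable_expInvWeight (b : ℝ) :
    Measurable (Function.uncurry fun t r : ℝ => t ^ (-b - 1) * Real.exp (-(r * t⁻¹))) := by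
  unfold Function.uncurry; fun_prop

theorem integral_expWeight {a : ℝ} (ha : 0 < a) {r : ℝ} (hr : 0 < r) :
    ∫ t in Set.Ioi (0 : ℝ), t ^ (a - 1) * Real.exp (-(r * t)) = Real.Gamma a * r ^ (-a) := by
  rw [Real.integral_rpow_mul_exp_neg_mul_Ioi ha hr, one_div, Real.inv_rpow hr.le,
    Real.rpow_neg hr.le, mul_comm]

end KernelFourier

/-! ### The Fourier transform of the symmetry breaking kernel. -/

section KernelIdentity

variable {V W : Type*} [NormedAddCommGroup W] [InnerProductSpace ℝ W] [FiniteDimensional ℝ W]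
  [MeasurableSpace W] [BorelSpace W] [NormedAddCommGroup V] [InnerProductSpace ℝ V]
  [FiniteDimensional ℝ V] [MeasurableSpace V] [BorelSpace V]

theorem continuous_fourier {f : W → ℂ} (hf : Integrable f) : Continuous (𝓕 f) :=
  VectorFourier.fourierIntegral_continuous Real.continuous_fourierChar
    (by exact continuous_inner) hf

theorem norm_fourier_le (f : W → ℂ) (ζ : W) : ‖𝓕 f ζ‖ ≤ ∫ x, ‖f x‖ :=
  VectorFourier.norm_fourierIntegral_le_integral_norm _ _ _ _ _

theorem integrable_mul_fourier {k : W → ℂ} (hk : Integrable k) (A : W →L[ℝ] V) {f : V → ℂ}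
    {g : W → ℂ} (hf : Integrable f) (hg : Integrable g) :
    Integrable fun ζ => k ζ * (𝓕 f (A ζ) * starRingEnd ℂ (𝓕 g ζ)) := by
  have h1 := (continuous_fourier hf).comp A.continuous
  have h2 := continuous_fourier hg
  refine hk.mul_bdd (c := (∫ x, ‖f x‖) * ∫ x, ‖g x‖) ?_ (Filter.Eventually.of_forall fun ζ => ?_)
  · exact (h1.mul (Complex.continuous_conj.comp h2)).aestronglyMeasurable
  · rw [norm_mul, RCLike.norm_conj]
    exact mul_le_mul (norm_fourier_le _ _) (norm_fourier_le _ _) (norm_nonneg _)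
      (integral_nonneg fun _ => norm_nonneg _)

theorem gaussian_pairing {ι : V →ₗᵢ[ℝ] W} {A : W →L[ℝ] V}
    (hA : ∀ y ζ, inner ℝ ζ (ι y) = inner ℝ y (A ζ)) {e : W} (he : ‖e‖ = 1) (j : ℕ)
    {f : V → ℂ} {g : W → ℂ} (hf : Integrable f) (hg : Integrable g) {t : ℝ} (ht : 0 < t) :
    (-(2 * Real.pi * Complex.I)) ^ j *
      ∫ p : W × V, ((Real.exp (-(Real.pi * ‖p.1 - ι p.2‖ ^ 2 * t)) : ℝ) : ℂ) *
        (((inner ℝ (p.1 - ι p.2) e ^ j : ℝ) : ℂ) * (f p.2 * starRingEnd ℂ (g p.1))) =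
      ((t ^ (-((Module.finrank ℝ W : ℝ) / 2)) : ℝ) : ℂ) *
      ∫ ζ, (gaussKer e j t⁻¹ ζ : ℂ) * (𝓕 f (A ζ) * starRingEnd ℂ (𝓕 g ζ)) := by
  have ht' : 0 < t⁻¹ := inv_pos.2 ht
  have hk : Integrable fun ζ : W => (gaussKer e j t⁻¹ ζ : ℂ) := (integrable_gaussKer he j ht').ofReal
  rw [← integral_prod_kernel hA hk hf hg]
  rw [← integral_const_mul, ← integral_const_mul]
  refine integral_congr_ae (Filter.Eventually.of_forall fun p => ?_)
  simp only
  rw [integral_gaussKer_mul_cexp he j ht', inv_inv]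
  have e1 : ((t ^ (-((Module.finrank ℝ W : ℝ) / 2)) : ℝ) : ℂ) *
      ((t ^ ((Module.finrank ℝ W : ℝ) / 2) : ℝ) : ℂ) = 1 := by
    rw [← Complex.ofReal_mul, ← Real.rpow_add ht]; simp
  have e2 : Real.pi * t * ‖p.1 - ι p.2‖ ^ 2 = Real.pi * ‖p.1 - ι p.2‖ ^ 2 * t := by ring
  rw [e2]
  push_cast
  linear_combination (-((-(2 * Real.pi * Complex.I)) ^ j *
    Complex.exp (-(Real.pi * ‖p.1 - ι p.2‖ ^ 2 * t)) *
    (inner ℝ (p.1 - ι p.2) e : ℂ) ^ j * (f p.2 * starRingEnd ℂ (g p.1)))) * e1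

theorem aestronglyMeasurable_fourier_pair (A : W →L[ℝ] V) {f : V → ℂ} {g : W → ℂ}
    (hf : Integrable f) (hg : Integrable g) :
    Continuous fun ζ => 𝓕 f (A ζ) * starRingEnd ℂ (𝓕 g ζ) :=
  ((continuous_fourier hf).comp A.continuous).mul
    (Complex.continuous_conj.comp (continuous_fourier hg))

theorem pi_norm_sq_rpow (r : ℝ) (hr : 0 ≤ r) (b : ℝ) :
    (Real.pi * r ^ 2) ^ (-b) = Real.pi ^ (-b) * r ^ (-(2 * b)) := by
  rw [Real.mul_rpow Real.pi_pos.le (by positivity), ← Real.rpow_natCast, ← Real.rpow_mul hr]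
  congr 2; push_cast; ring

/-- The power of the norm is an integral over t of Gaussians e^{-π|z|²t}. For fixed t the pairing
with ⟨z, e⟩^j times the Gaussian is `gaussian_pairing`, whose frequency side is a sum of monomials
times a Gaussian of parameter 1/t. Integrating over t again turns the m-th term into a multiple of
|ζ|^{-2(ν-m)}; these integrals converge because m ≤ j/2 < ν. The integrability hypotheses on both
sides justify Fubini. -/
theorem kernel_fourier_identity [Nontrivial V] {ι : V →ₗᵢ[ℝ] W} {A : W →L[ℝ] V}
    (hA : ∀ y ζ, inner ℝ ζ (ι y) = inner ℝ y (A ζ)) {e : W} (he : ‖e‖ = 1) {j : ℕ} {mu ν : ℝ}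
    (hmu : 0 < mu) (hν : ν = (Module.finrank ℝ W : ℝ) / 2 - mu) (hj : ((j / 2 : ℕ) : ℝ) < ν)
    {f : V → ℂ} {g : W → ℂ} (hf : Integrable f) (hg : Integrable g)
    (hL : Integrable fun p : W × V => ((‖p.1 - ι p.2‖ ^ (-(2 * (mu + j))) : ℝ) : ℂ) *
      (((inner ℝ (p.1 - ι p.2) e ^ j : ℝ) : ℂ) * (f p.2 * starRingEnd ℂ (g p.1))))
    (hR : Integrable fun ζ : W => ((‖ζ‖ ^ ((j : ℝ) - 2 * ν) : ℝ) : ℂ) *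
      (𝓕 f (A ζ) * starRingEnd ℂ (𝓕 g ζ))) :
    (-(2 * Real.pi * Complex.I)) ^ j * (Real.Gamma (mu + j) * Real.pi ^ (-(mu + j)) : ℝ) *
      ∫ p : W × V, ((‖p.1 - ι p.2‖ ^ (-(2 * (mu + j))) : ℝ) : ℂ) *
        (((inner ℝ (p.1 - ι p.2) e ^ j : ℝ) : ℂ) * (f p.2 * starRingEnd ℂ (g p.1))) =
      ∫ ζ, ((‖ζ‖ ^ (-(2 * ν)) * breakPoly e ν j ζ : ℝ) : ℂ) *
        (𝓕 f (A ζ) * starRingEnd ℂ (𝓕 g ζ)) := by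
  have : Nontrivial W := ι.injective.nontrivial
  have hιc : Continuous ι := ι.continuous
  have hνm : ∀ m ∈ Finset.range (j / 2 + 1), 0 < ν - m := by
    intro m hm
    have : (m : ℝ) ≤ (j / 2 : ℕ) := by exact_mod_cast Nat.lt_succ_iff.1 (Finset.mem_range.1 hm)
    linarith
  set F : W × V → ℂ := fun p => ((inner ℝ (p.1 - ι p.2) e ^ j : ℝ) : ℂ) *
    (f p.2 * starRingEnd ℂ (g p.1)) with hF
  set Q : W → ℂ := fun ζ => 𝓕 f (A ζ) * starRingEnd ℂ (𝓕 g ζ) with hQ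
  have hQc : Continuous Q := aestronglyMeasurable_fourier_pair A hf hg
  set G : ℕ → W → ℂ := fun m ζ => ((inner ℝ ζ e ^ (j - 2 * m) : ℝ) : ℂ) * Q ζ with hG
  have hFm : AEStronglyMeasurable F (volume : Measure (W × V)) := by
    refine AEStronglyMeasurable.mul ?_ (integrable_prod_conj_mul hf hg).aestronglyMeasurable
    exact Continuous.aestronglyMeasurable (by fun_prop)
  have ha : 0 < mu + j := by positivity
  have hzpos : ∀ᵐ p : W × V, 0 < Real.pi * ‖p.1 - ι p.2‖ ^ 2 := by
    filter_upwards [ae_norm_sub_pos ι] with p hp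
    exact mul_pos Real.pi_pos (by positivity)
  have hζpos : ∀ᵐ ζ : W, 0 < Real.pi * ‖ζ‖ ^ 2 := by
    filter_upwards [ae_norm_pos (W := W)] with ζ hp
    exact mul_pos Real.pi_pos (by positivity)
  have hFi : Integrable fun p : W × V =>
      (((Real.pi * ‖p.1 - ι p.2‖ ^ 2) ^ (-(mu + j)) : ℝ) : ℂ) * F p := by
    refine (hL.const_mul ((Real.pi ^ (-(mu + j)) : ℝ) : ℂ)).congr
      (Filter.Eventually.of_forall fun p => ?_)
    simp only [pi_norm_sq_rpow _ (norm_nonneg _), hF]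
    push_cast; ring
  have hA1 := integral_subordination (μ := (volume : Measure (W × V)))
    (measurable_expWeight (mu + j)) (c := Real.Gamma (mu + j)) (a := mu + j)
    (fun t r ht => by positivity) (fun r hr => integrableOn_rpow_mul_exp ha hr)
    (fun r hr => integral_expWeight ha hr) (r := fun p => Real.pi * ‖p.1 - ι p.2‖ ^ 2)
    (Continuous.measurable (by fun_prop)) hzpos hFm hFi
  have hGi : ∀ m ∈ Finset.range (j / 2 + 1), Integrable fun ζ : W =>
      (((Real.pi * ‖ζ‖ ^ 2) ^ (-(ν - m)) : ℝ) : ℂ) * G m ζ := by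
    intro m hm
    have hm' : 2 * m ≤ j := by have := Finset.mem_range.1 hm; omega
    -- The power ⟨ζ, e⟩^{j-2m} is at most |ζ|^{j-2m}, so the single hypothesis `hR` dominates all
    -- the terms.
    refine (hR.norm.const_mul (Real.pi ^ (-(ν - m)))).mono' ?_ ?_
    · have hme : Measurable fun ζ : W => (Real.pi * ‖ζ‖ ^ 2) ^ (-(ν - m)) := by fun_prop
      refine AEStronglyMeasurable.mul
        (Complex.measurable_ofReal.comp hme).aestronglyMeasurable ?_
      exact Continuous.aestronglyMeasurable (by fun_prop)
    · filter_upwards [ae_norm_pos (W := W)] with ζ hζ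
      simp only [hG, norm_mul, Complex.norm_real, pi_norm_sq_rpow _ (norm_nonneg _)]
      rw [Real.norm_of_nonneg (by positivity : 0 ≤ Real.pi ^ (-(ν - m))),
        Real.norm_of_nonneg (by positivity : 0 ≤ ‖ζ‖ ^ (-(2 * (ν - m)))),
        Real.norm_of_nonneg (by positivity : 0 ≤ ‖ζ‖ ^ ((j : ℝ) - 2 * ν)), mul_assoc]
      have h1 : |inner ℝ ζ e| ≤ ‖ζ‖ := by simpa [he] using abs_real_inner_le_norm ζ e
      have h2 : ‖ζ‖ ^ (-(2 * (ν - m))) * ‖inner ℝ ζ e ^ (j - 2 * m)‖ ≤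
          ‖ζ‖ ^ ((j : ℝ) - 2 * ν) := by
        calc _ ≤ ‖ζ‖ ^ (-(2 * (ν - m))) * ‖ζ‖ ^ (j - 2 * m) := by
              rw [norm_pow, Real.norm_eq_abs]; gcongr
          _ = _ := by
              rw [← Real.rpow_natCast, ← Real.rpow_add hζ]
              congr 1
              rw [Nat.cast_sub hm']; push_cast; ring
      calc _ = Real.pi ^ (-(ν - m)) * ((‖ζ‖ ^ (-(2 * (ν - m))) *
            ‖inner ℝ ζ e ^ (j - 2 * m)‖) * ‖Q ζ‖) := by ring
        _ ≤ _ := by gcongr; rw [hQ, norm_mul]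
  have hGm : ∀ m, AEStronglyMeasurable (G m) (volume : Measure W) := fun m =>
    Continuous.aestronglyMeasurable (by fun_prop)
  have hB := fun m (hm : m ∈ Finset.range (j / 2 + 1)) =>
    integral_subordination (μ := (volume : Measure W))
    (measurable_expInvWeight (ν - m)) (c := Real.Gamma (ν - m)) (a := ν - m)
    (fun t r ht => by positivity) (fun r hr => integrableOn_rpow_mul_exp_inv (hνm m hm) hr)
    (fun r hr => integral_rpow_mul_exp_inv (hνm m hm) hr) (r := fun ζ => Real.pi * ‖ζ‖ ^ 2)
    (Continuous.measurable (by fun_prop)) hζpos (hGm m) (hGi m hm)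
  have hBi := fun m (hm : m ∈ Finset.range (j / 2 + 1)) =>
    (integrable_subordination (μ := (volume : Measure W))
    (measurable_expInvWeight (ν - m)) (c := Real.Gamma (ν - m)) (a := ν - m)
    (fun t r ht => by positivity) (fun r hr => integrableOn_rpow_mul_exp_inv (hνm m hm) hr)
    (fun r hr => integral_rpow_mul_exp_inv (hνm m hm) hr) (r := fun ζ => Real.pi * ‖ζ‖ ^ 2)
    (Continuous.measurable (by fun_prop)) hζpos (hGm m) (hGi m hm)).integral_prod_left
  simp only at hBi
  have hpt : ∀ t ∈ Set.Ioi (0 : ℝ), (-(2 * Real.pi * Complex.I)) ^ j *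
      ∫ p, ((t ^ (mu + j - 1) * Real.exp (-(Real.pi * ‖p.1 - ι p.2‖ ^ 2 * t)) : ℝ) : ℂ) * F p =
      ∑ m ∈ Finset.range (j / 2 + 1), (gaussCoeff j m : ℂ) * ∫ ζ,
        ((t ^ (-(ν - m) - 1) * Real.exp (-(Real.pi * ‖ζ‖ ^ 2 * t⁻¹)) : ℝ) : ℂ) * G m ζ := by
    intro t ht
    have ht : 0 < t := ht
    have h1 := gaussian_pairing hA he j hf hg ht
    have h2 : ∫ p, ((t ^ (mu + j - 1) * Real.exp (-(Real.pi * ‖p.1 - ι p.2‖ ^ 2 * t)) : ℝ) : ℂ) *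
        F p = ((t ^ (mu + j - 1) : ℝ) : ℂ) *
          ∫ p, ((Real.exp (-(Real.pi * ‖p.1 - ι p.2‖ ^ 2 * t)) : ℝ) : ℂ) * F p := by
      rw [← integral_const_mul]
      refine integral_congr_ae (Filter.Eventually.of_forall fun p => ?_)
      simp only [Complex.ofReal_mul, mul_assoc]
    rw [h2, mul_left_comm, h1, ← mul_assoc, ← integral_const_mul]
    have h3 : ∀ m ∈ Finset.range (j / 2 + 1), Integrable fun ζ : W => (gaussCoeff j m : ℂ) *
        (((t ^ (-(ν - m) - 1) * Real.exp (-(Real.pi * ‖ζ‖ ^ 2 * t⁻¹)) : ℝ) : ℂ) * G m ζ) := by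
      intro m hm
      have h4 := integrable_mul_fourier (((integrable_inner_pow_mul_gaussian he (j - 2 * m)
        (mul_pos Real.pi_pos (inv_pos.2 ht))).ofReal (𝕜 := ℂ))) A hf hg
      refine (h4.const_mul ((gaussCoeff j m : ℂ) * ((t ^ (-(ν - m) - 1) : ℝ) : ℂ))).congr
        (Filter.Eventually.of_forall fun ζ => ?_)
      have e2 : Real.pi * ‖ζ‖ ^ 2 * t⁻¹ = Real.pi * t⁻¹ * ‖ζ‖ ^ 2 := by ring
      simp only [hG, hQ, e2, RCLike.ofReal_mul, Complex.ofReal_mul, Complex.coe_algebraMap]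
      push_cast
      ring
    simp_rw [← integral_const_mul]
    rw [← integral_finsetSum _ h3]
    refine integral_congr_ae (Filter.Eventually.of_forall fun ζ => ?_)
    simp only [gaussKer_eq, hG]
    rw [Complex.ofReal_sum, Finset.sum_mul, Finset.mul_sum]
    refine Finset.sum_congr rfl fun m hm => ?_
    have hm' : m ≤ j := by have := Finset.mem_range.1 hm; omega
    -- The exponents match because ν = dim W / 2 - mu.
    have e3 : t ^ (-(ν - m) - 1) = t ^ (mu + j - 1) * t ^ (-((Module.finrank ℝ W : ℝ) / 2)) *
        t⁻¹ ^ (j - m) := by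
      rw [← Real.rpow_natCast, Real.inv_rpow ht.le, ← Real.rpow_neg ht.le, ← Real.rpow_add ht,
        ← Real.rpow_add ht, Nat.cast_sub hm', hν]
      congr 1; ring
    rw [e3]
    push_cast
    ring
  have hC : ∫ t in Set.Ioi (0 : ℝ), (-(2 * Real.pi * Complex.I)) ^ j *
      ∫ p, ((t ^ (mu + j - 1) * Real.exp (-(Real.pi * ‖p.1 - ι p.2‖ ^ 2 * t)) : ℝ) : ℂ) * F p =
      ∑ m ∈ Finset.range (j / 2 + 1), (gaussCoeff j m : ℂ) * (Real.Gamma (ν - m) *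
        ∫ ζ, (((Real.pi * ‖ζ‖ ^ 2) ^ (-(ν - m)) : ℝ) : ℂ) * G m ζ) := by
    rw [setIntegral_congr_fun measurableSet_Ioi hpt,
      integral_finsetSum _ fun m hm => (hBi m hm).const_mul _]
    refine Finset.sum_congr rfl fun m hm => ?_
    rw [integral_const_mul, hB m hm]
  rw [integral_const_mul, hA1] at hC
  have h5 : ∫ p : W × V, (((Real.pi * ‖p.1 - ι p.2‖ ^ 2) ^ (-(mu + j)) : ℝ) : ℂ) * F p =
      ((Real.pi ^ (-(mu + j)) : ℝ) : ℂ) *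
        ∫ p : W × V, ((‖p.1 - ι p.2‖ ^ (-(2 * (mu + j))) : ℝ) : ℂ) * F p := by
    rw [← integral_const_mul]
    refine integral_congr_ae (Filter.Eventually.of_forall fun p => ?_)
    simp only [pi_norm_sq_rpow _ (norm_nonneg _)]
    push_cast; ring
  rw [h5] at hC
  refine Eq.trans ?_ (hC.trans ?_)
  · rw [Complex.ofReal_mul]; ring
  simp_rw [← integral_const_mul]
  rw [← integral_finsetSum _ fun m hm => ((hGi m hm).const_mul _).const_mul _]
  refine integral_congr_ae ?_
  filter_upwards [ae_norm_pos (W := W)] with ζ hζ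
  simp only [breakPoly, hG]
  rw [Complex.ofReal_mul, Complex.ofReal_sum, Finset.mul_sum, Finset.sum_mul]
  refine Finset.sum_congr rfl fun m hm => ?_
  have e4 : ‖ζ‖ ^ (-(2 * (ν - m))) = ‖ζ‖ ^ (-(2 * ν)) * (‖ζ‖ ^ 2) ^ m := by
    rw [← pow_mul, ← Real.rpow_natCast, ← Real.rpow_add hζ]
    congr 1; push_cast; ring
  rw [pi_norm_sq_rpow _ (norm_nonneg _), e4]
  push_cast
  ring

end KernelIdentity

/-! ### Absolute convergence of the kernel integrals. -/

section RieszBounds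

variable {V W : Type*} [NormedAddCommGroup W] [InnerProductSpace ℝ W] [FiniteDimensional ℝ W]
  [MeasurableSpace W] [BorelSpace W] [NormedAddCommGroup V] [InnerProductSpace ℝ V]
  [FiniteDimensional ℝ V] [MeasurableSpace V] [BorelSpace V]

/-- The singular part of the kernel `‖z‖^{-s}`. -/
noncomputable def rieszLocal (V : Type*) [NormedAddCommGroup V] (s : ℝ) : V → ℝ :=
  (Metric.ball (0 : V) 1).indicator fun z => ‖z‖ ^ (-s)

theorem integrable_rieszLocal [Nontrivial V] {s : ℝ} (hs : s < Module.finrank ℝ V) :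
    Integrable (rieszLocal V s) := by
  rw [rieszLocal, integrable_indicator_iff measurableSet_ball]
  have hme : Measurable fun z : V => ‖z‖ ^ (-s) := by fun_prop
  refine integrableOn_ball_of_norm_le_rpow (C := 1) (α := s) Module.finrank_pos hs
    (Filter.Eventually.of_forall fun z => ?_) hme.aestronglyMeasurable
  rw [one_mul, Real.norm_of_nonneg (by positivity)]

theorem rpow_neg_le_rieszLocal {V : Type*} [NormedAddCommGroup V] {s : ℝ} (hs : 0 ≤ s) (z : V) :
    ‖z‖ ^ (-s) ≤ rieszLocal V s z + 1 := by
  by_cases hz : z ∈ Metric.ball (0 : V) 1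
  · rw [rieszLocal, Set.indicator_of_mem hz]; linarith
  · rw [rieszLocal, Set.indicator_of_notMem hz, zero_add]
    rw [Metric.mem_ball, dist_zero_right, not_lt] at hz
    exact Real.rpow_le_one_of_one_le_of_nonpos hz (by linarith)

theorem rieszLocal_nonneg {V : Type*} [NormedAddCommGroup V] (s : ℝ) (z : V) :
    0 ≤ rieszLocal V s z :=
  Set.indicator_nonneg (fun _ _ => by positivity) _

/-- Projection to V does not increase distances, so ‖x - ι y‖ ≥ ‖A x - y‖ and the kernel is bounded
by one on V. Its singular part is integrable and is paired with the bound of f; its remaining part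
is at most 1 and is paired with the integral of |f|. This bounds the integral over y uniformly in x.
-/
theorem integrable_riesz_prod [Nontrivial V] {ι : V →ₗᵢ[ℝ] W} {A : W →L[ℝ] V}
    (hAι : ∀ y, A (ι y) = y) (hAn : ∀ x, ‖A x‖ ≤ ‖x‖) {s : ℝ} (hs0 : 0 ≤ s)
    (hs : s < Module.finrank ℝ V)
    {f : V → ℂ} {g : W → ℂ} (hf : Integrable f) (hg : Integrable g) {B : ℝ}
    (hB : ∀ y, ‖f y‖ ≤ B) :
    Integrable fun p : W × V => ((‖p.1 - ι p.2‖ ^ (-s) : ℝ) : ℂ) *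
      (f p.2 * starRingEnd ℂ (g p.1)) := by
  have hιc : Continuous ι := ι.continuous
  have hB0 : 0 ≤ B := (norm_nonneg _).trans (hB 0)
  have hme : Measurable fun p : W × V => ‖p.1 - ι p.2‖ ^ (-s) :=
    (Continuous.measurable (by fun_prop : Continuous fun p : W × V => ‖p.1 - ι p.2‖)).pow_const _
  have hm : AEStronglyMeasurable (fun p : W × V => ((‖p.1 - ι p.2‖ ^ (-s) : ℝ) : ℂ) *
      (f p.2 * starRingEnd ℂ (g p.1))) (volume.prod volume) :=
    (Complex.measurable_ofReal.comp hme).aestronglyMeasurable.mul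
      (integrable_prod_conj_mul hf hg).aestronglyMeasurable
  have hK := integrable_rieszLocal hs
  have hKx : ∀ x : V, Integrable fun y => B * rieszLocal V s (x - y) + ‖f y‖ := fun x =>
    ((hK.comp_sub_left x).const_mul B).add hf.norm
  have hb : ∀ x : W, ∀ᵐ y : V, ‖((‖x - ι y‖ ^ (-s) : ℝ) : ℂ) * f y‖ ≤
      B * rieszLocal V s (A x - y) + ‖f y‖ := by
    intro x
    -- Negative powers are decreasing only on positive numbers, so the singular point of the smaller
    -- distance is removed.
    have hne : ∀ᵐ y : V, y ≠ A x := compl_mem_ae_iff.2 (measure_singleton _)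
    filter_upwards [hne] with y hy
    rw [norm_mul, Complex.norm_real, Real.norm_of_nonneg (by positivity)]
    have h1 : ‖A x - y‖ ≤ ‖x - ι y‖ := by
      have := hAn (x - ι y); rwa [map_sub, hAι] at this
    have h2 : 0 < ‖A x - y‖ := norm_pos_iff.2 (sub_ne_zero.2 hy.symm)
    have h3 : ‖x - ι y‖ ^ (-s) ≤ rieszLocal V s (A x - y) + 1 :=
      (Real.rpow_le_rpow_of_nonpos h2 h1 (by linarith)).trans (rpow_neg_le_rieszLocal hs0 _)
    calc _ ≤ (rieszLocal V s (A x - y) + 1) * ‖f y‖ := by gcongr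
      _ = rieszLocal V s (A x - y) * ‖f y‖ + ‖f y‖ := by ring
      _ ≤ rieszLocal V s (A x - y) * B + ‖f y‖ := by
        gcongr
        · exact rieszLocal_nonneg _ _
        · exact hB y
      _ = _ := by ring
  have hsec : ∀ x : W, Integrable fun y => ((‖x - ι y‖ ^ (-s) : ℝ) : ℂ) * f y := by
    intro x
    refine (hKx (A x)).mono' ?_ (hb x)
    refine AEStronglyMeasurable.mul ?_ hf.aestronglyMeasurable
    exact (Complex.measurable_ofReal.comp
      (hme.comp (measurable_const.prodMk measurable_id))).aestronglyMeasurable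
  rw [Measure.volume_eq_prod, integrable_prod_iff hm]
  constructor
  · refine Filter.Eventually.of_forall fun x => ?_
    refine ((hsec x).mul_const (starRingEnd ℂ (g x))).congr (Filter.Eventually.of_forall fun y => ?_)
    simp only; ring
  · refine (hg.norm.const_mul (B * (∫ z, rieszLocal V s z) + ∫ y, ‖f y‖)).mono'
      hm.norm.integral_prod_right' (Filter.Eventually.of_forall fun x => ?_)
    rw [Real.norm_of_nonneg (integral_nonneg fun _ => norm_nonneg _)]
    have h4 : ∀ y, ‖((‖x - ι y‖ ^ (-s) : ℝ) : ℂ) * (f y * starRingEnd ℂ (g x))‖ =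
        ‖((‖x - ι y‖ ^ (-s) : ℝ) : ℂ) * f y‖ * ‖g x‖ := fun y => by
      rw [← mul_assoc, norm_mul, RCLike.norm_conj]
    simp only [h4]
    rw [integral_mul_const]
    gcongr
    calc _ ≤ ∫ y, (B * rieszLocal V s (A x - y) + ‖f y‖) :=
          integral_mono_ae (hsec x).norm (hKx _) (hb x)
      _ = _ := by
          rw [integral_add ((hK.comp_sub_left _).const_mul B) hf.norm, integral_const_mul,
            integral_sub_left_eq_self (rieszLocal V s) volume (A x)]

end RieszBounds

/-! ### Finiteness of the complementary series norm. -/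

section FiniteNorm

variable {W : Type*} [NormedAddCommGroup W] [InnerProductSpace ℝ W] [FiniteDimensional ℝ W]
  [MeasurableSpace W] [BorelSpace W] [Nontrivial W]

theorem inner_id_adjoint {W : Type*} [NormedAddCommGroup W] [InnerProductSpace ℝ W] (y ζ : W) :
    inner ℝ ζ ((LinearIsometry.id : W →ₗᵢ[ℝ] W) y) =
    inner ℝ y (ContinuousLinearMap.id ℝ W ζ) := by
  simp [real_inner_comm]

/-- `kernel_fourier_identity` presupposes integrability on the frequency side, so it cannot be used
here. For f = g that side is nonnegative: the Gaussian pairing shows that its integral over ζ for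
fixed t is a kernel integral which is integrable in t, and joint integrability in (t, ζ) follows by
Tonelli. Integrating over t instead gives the claim. -/
theorem integrable_norm_sq_fourier {mu ν : ℝ} (hmu : 0 < mu)
    (hν : ν = (Module.finrank ℝ W : ℝ) / 2 - mu) (hν0 : 0 < ν) {f : W → ℂ} (hf : Integrable f)
    {B : ℝ} (hB : ∀ y, ‖f y‖ ≤ B) :
    Integrable fun ζ : W => ‖ζ‖ ^ (-(2 * ν)) * ‖𝓕 f ζ‖ ^ 2 := by
  obtain ⟨e, he⟩ := exists_norm_eq W zero_le_one
  have hL := integrable_riesz_prod (ι := (LinearIsometry.id : W →ₗᵢ[ℝ] W))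
    (A := ContinuousLinearMap.id ℝ W) (s := 2 * mu) (fun y => rfl) (fun x => le_rfl) (by linarith)
    (by linarith) hf hf hB
  simp only [LinearIsometry.id_apply] at hL
  set F : W × W → ℂ := fun p => f p.2 * starRingEnd ℂ (f p.1) with hF
  have hFi : Integrable fun p : W × W =>
      (((Real.pi * ‖p.1 - p.2‖ ^ 2) ^ (-mu) : ℝ) : ℂ) * F p := by
    refine (hL.const_mul ((Real.pi ^ (-mu) : ℝ) : ℂ)).congr
      (Filter.Eventually.of_forall fun p => ?_)
    simp only [pi_norm_sq_rpow _ (norm_nonneg _), hF]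
    push_cast; ring
  have hzpos : ∀ᵐ p : W × W, 0 < Real.pi * ‖p.1 - p.2‖ ^ 2 := by
    filter_upwards [ae_norm_sub_pos (LinearIsometry.id : W →ₗᵢ[ℝ] W)] with p hp
    simp only [LinearIsometry.id_apply] at hp
    exact mul_pos Real.pi_pos (by positivity)
  have hA := (integrable_subordination (μ := (volume : Measure (W × W)))
    (measurable_expWeight mu) (c := Real.Gamma mu) (a := mu)
    (fun t r ht => by positivity) (fun r hr => integrableOn_rpow_mul_exp hmu hr)
    (fun r hr => integral_expWeight hmu hr) (r := fun p => Real.pi * ‖p.1 - p.2‖ ^ 2)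
    (Continuous.measurable (by fun_prop)) hzpos
    (integrable_prod_conj_mul hf hf).aestronglyMeasurable hFi).integral_prod_left
  simp only at hA
  set Ψ : ℝ × W → ℝ := fun z => z.1 ^ (-ν - 1) * Real.exp (-(Real.pi * ‖z.2‖ ^ 2 * z.1⁻¹)) *
    ‖𝓕 f z.2‖ ^ 2 with hΨ
  have hΨm : AEStronglyMeasurable Ψ ((volume.restrict (Set.Ioi 0)).prod volume) := by
    have := (continuous_fourier hf).measurable
    exact Measurable.aestronglyMeasurable (by fun_prop)
  have hΨi : Integrable Ψ ((volume.restrict (Set.Ioi 0)).prod volume) := by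
    rw [integrable_prod_iff hΨm]
    have hsec : ∀ t : ℝ, 0 < t → Integrable fun ζ : W => ((Real.exp (-(Real.pi * ‖ζ‖ ^ 2 * t⁻¹)) :
        ℝ) : ℂ) * (𝓕 f ζ * starRingEnd ℂ (𝓕 f ζ)) := by
      intro t ht
      have h1 := (integrable_gaussian (W := W) (mul_pos Real.pi_pos (inv_pos.2 ht))).ofReal (𝕜 := ℂ)
      refine (integrable_mul_fourier h1 (ContinuousLinearMap.id ℝ W) hf hf).congr
        (Filter.Eventually.of_forall fun ζ => ?_)
      have e2 : Real.pi * ‖ζ‖ ^ 2 * t⁻¹ = Real.pi * t⁻¹ * ‖ζ‖ ^ 2 := by ring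
      simp only [e2, Complex.coe_algebraMap, ContinuousLinearMap.id_apply]
    have hΨc : ∀ t ζ, ((Ψ (t, ζ) : ℝ) : ℂ) = ((t ^ (-ν - 1) : ℝ) : ℂ) *
        (((Real.exp (-(Real.pi * ‖ζ‖ ^ 2 * t⁻¹)) : ℝ) : ℂ) *
          (𝓕 f ζ * starRingEnd ℂ (𝓕 f ζ))) := by
      intro t ζ
      rw [RCLike.mul_conj]
      simp only [hΨ]; push_cast; simp only [Complex.coe_algebraMap]; ring
    have hΨ0 : ∀ t ζ, 0 < t → 0 ≤ Ψ (t, ζ) := fun t ζ ht => by positivity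
    constructor
    · filter_upwards [ae_restrict_mem measurableSet_Ioi] with t ht
      have h2 := (hsec t ht).const_mul ((t ^ (-ν - 1) : ℝ) : ℂ)
      simp only [← hΨc] at h2
      simpa using h2.re
    -- By positivity the integral of the norm over ζ is the integral itself, which equals the
    -- spatial pairing at time t.
    · refine hA.norm.congr ?_
      filter_upwards [ae_restrict_mem measurableSet_Ioi] with t ht
      have ht : 0 < t := ht
      have h3 : ((∫ ζ, ‖Ψ (t, ζ)‖ : ℝ) : ℂ) = ∫ p : W × W,
          ((t ^ (mu - 1) * Real.exp (-(Real.pi * ‖p.1 - p.2‖ ^ 2 * t)) : ℝ) : ℂ) * F p := by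
        have hp := gaussian_pairing (ι := (LinearIsometry.id : W →ₗᵢ[ℝ] W))
          (A := ContinuousLinearMap.id ℝ W) inner_id_adjoint he 0 hf hf ht
        simp only [pow_zero, one_mul, LinearIsometry.id_apply, Complex.ofReal_one,
          ContinuousLinearMap.id_apply] at hp
        rw [← integral_complex_ofReal]
        simp only [fun ζ => Real.norm_of_nonneg (hΨ0 t ζ ht), hΨc]
        rw [integral_const_mul]
        have h4 : ∀ ζ : W, (gaussKer e 0 t⁻¹ ζ) = Real.exp (-(Real.pi * ‖ζ‖ ^ 2 * t⁻¹)) := by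
          intro ζ; rw [gaussKer_eq]; simp [gaussCoeff]
        simp only [h4] at hp
        have e3 : t ^ (-ν - 1) = t ^ (mu - 1) * t ^ (-((Module.finrank ℝ W : ℝ) / 2)) := by
          rw [← Real.rpow_add ht, hν]; congr 1; ring
        rw [e3, Complex.ofReal_mul, mul_assoc, ← hp, ← integral_const_mul]
        refine integral_congr_ae (Filter.Eventually.of_forall fun p => ?_)
        simp only [Complex.ofReal_mul, mul_assoc, hF]
      rw [← h3, Complex.norm_real, Real.norm_of_nonneg (integral_nonneg fun _ => norm_nonneg _)]
  have h5 := hΨi.integral_prod_right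
  refine (h5.const_mul (Real.Gamma ν * Real.pi ^ (-ν))⁻¹).congr ?_
  filter_upwards [ae_norm_pos (W := W)] with ζ hζ
  simp only [hΨ]
  rw [integral_mul_const, integral_rpow_mul_exp_inv hν0 (by positivity),
    pi_norm_sq_rpow _ (norm_nonneg _)]
  have := (Real.Gamma_pos_of_pos hν0).ne'
  have := (Real.rpow_pos_of_pos Real.pi_pos (-ν)).ne'
  field_simp

end FiniteNorm

/-! ### The weighted L² space in terms of Lebesgue measure. -/

section CSpaceBasics

theorem measurable_csWeight (d : ℕ) (lam : ℝ) :
    Measurable fun ξ : RSpace d => ENNReal.ofReal (‖ξ‖ ^ ((d : ℝ) - 2 * lam)) := by fun_prop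

theorem csMeasure_absolutelyContinuous (d : ℕ) (lam : ℝ) :
    csMeasure d lam ≪ (volume : Measure (RSpace d)) :=
  withDensity_absolutelyContinuous _ _

theorem absolutelyContinuous_csMeasure (d : ℕ) [NeZero d] (lam : ℝ) :
    (volume : Measure (RSpace d)) ≪ csMeasure d lam := by
  refine withDensity_absolutelyContinuous' (measurable_csWeight d lam).aemeasurable ?_
  filter_upwards [ae_norm_pos (W := RSpace d)] with ξ hξ
  simpa using Real.rpow_pos_of_pos hξ _

theorem integral_csMeasure {d : ℕ} {lam : ℝ} {E : Type*} [NormedAddCommGroup E] [NormedSpace ℝ E]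
    (F : RSpace d → E) :
    ∫ ξ, F ξ ∂csMeasure d lam = ∫ ξ, ‖ξ‖ ^ ((d : ℝ) - 2 * lam) • F ξ := by
  rw [csMeasure, integral_withDensity_eq_integral_toReal_smul (measurable_csWeight d lam) (by simp)]
  refine integral_congr_ae (Filter.Eventually.of_forall fun ξ => ?_)
  simp [ENNReal.toReal_ofReal (Real.rpow_nonneg (norm_nonneg ξ) _)]

theorem integrable_csMeasure_iff {d : ℕ} {lam : ℝ} {E : Type*} [NormedAddCommGroup E]
    [NormedSpace ℝ E] (F : RSpace d → E) :
    Integrable F (csMeasure d lam) ↔ Integrable fun ξ => ‖ξ‖ ^ ((d : ℝ) - 2 * lam) • F ξ := by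
  rw [csMeasure, integrable_withDensity_iff_integrable_smul₀' (measurable_csWeight d lam).aemeasurable
    (by simp)]
  refine integrable_congr (Filter.Eventually.of_forall fun ξ => ?_)
  simp [ENNReal.toReal_ofReal (Real.rpow_nonneg (norm_nonneg ξ) _)]

theorem memLp_csMeasure {d : ℕ} {lam : ℝ} {F : RSpace d → ℂ} (hm : AEStronglyMeasurable F volume)
    (hF : Integrable fun ξ => ‖ξ‖ ^ ((d : ℝ) - 2 * lam) * ‖F ξ‖ ^ 2) :
    MemLp F 2 (csMeasure d lam) :=
  (memLp_two_iff_integrable_sq_norm (hm.mono_ac (csMeasure_absolutelyContinuous d lam))).2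
    ((integrable_csMeasure_iff _).2 hF)

theorem inner_cspace {d : ℕ} {lam : ℝ} (v w : CSpace d lam) :
    inner ℂ v w = ∫ ξ, ((‖ξ‖ ^ ((d : ℝ) - 2 * lam) : ℝ) : ℂ) * (w ξ * starRingEnd ℂ (v ξ)) := by
  rw [L2.inner_def, integral_csMeasure]
  refine integral_congr_ae (Filter.Eventually.of_forall fun ξ => ?_)
  simp [mul_comm]

theorem integrable_inner_cspace {d : ℕ} {lam : ℝ} (v w : CSpace d lam) :
    Integrable fun ξ => ((‖ξ‖ ^ ((d : ℝ) - 2 * lam) : ℝ) : ℂ) * (w ξ * starRingEnd ℂ (v ξ)) := by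
  refine ((integrable_csMeasure_iff _).1 (L2.integrable_inner (𝕜 := ℂ) v w)).congr
    (Filter.Eventually.of_forall fun ξ => ?_)
  simp [mul_comm]

theorem inner_toLp_cspace {d : ℕ} {lam : ℝ} {F G : RSpace d → ℂ}
    (hF : MemLp F 2 (csMeasure d lam)) (hG : MemLp G 2 (csMeasure d lam)) [NeZero d] :
    inner ℂ hF.toLp hG.toLp =
      ∫ ξ, ((‖ξ‖ ^ ((d : ℝ) - 2 * lam) : ℝ) : ℂ) * (G ξ * starRingEnd ℂ (F ξ)) := by
  rw [inner_cspace]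
  refine integral_congr_ae ?_
  filter_upwards [(absolutelyContinuous_csMeasure d lam).ae_eq hF.coeFn_toLp,
    (absolutelyContinuous_csMeasure d lam).ae_eq hG.coeFn_toLp] with ξ h1 h2
  rw [h1, h2]

theorem CSpace.ext_volume {d : ℕ} {lam : ℝ} {v w : CSpace d lam} (h : v =ᵐ[volume] w) : v = w :=
  Lp.ext ((csMeasure_absolutelyContinuous d lam).ae_eq h)

end CSpaceBasics

/-! ### The Fourier transform into the Hilbert space, and its invariant inner product. -/

section FourierEmbedding

theorem fourier_add_apply' {W : Type*} [NormedAddCommGroup W] [InnerProductSpace ℝ W]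
    [FiniteDimensional ℝ W] [MeasurableSpace W] [BorelSpace W] {f g : W → ℂ} (hf : Integrable f)
    (hg : Integrable g) : 𝓕 (f + g) = 𝓕 f + 𝓕 g :=
  VectorFourier.fourierIntegral_add Real.continuous_fourierChar (by exact continuous_inner) hf hg

theorem fourier_const_smul' {W : Type*} [NormedAddCommGroup W] [InnerProductSpace ℝ W]
    [FiniteDimensional ℝ W] [MeasurableSpace W] [BorelSpace W] (c : ℂ) (f : W → ℂ) :
    𝓕 (c • f) = c • 𝓕 f :=
  VectorFourier.fourierIntegral_const_smul _ _ _ _ _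

theorem fourier_congr_ae {W : Type*} [NormedAddCommGroup W] [InnerProductSpace ℝ W]
    [FiniteDimensional ℝ W] [MeasurableSpace W] [BorelSpace W] {f g : W → ℂ}
    (h : f =ᵐ[volume] g) : 𝓕 f = 𝓕 g := by
  ext ξ
  rw [Real.fourier_eq', Real.fourier_eq']
  refine integral_congr_ae ?_
  filter_upwards [h] with x hx
  rw [hx]

variable {d : ℕ} [NeZero d] {lam : ℝ}

theorem integrable_norm_sq_fourier_decay (h1 : (d : ℝ) / 2 < lam) (h2 : lam < d)
    {f : RSpace d → ℂ} (hf : f ∈ DecaySpace d lam) :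
    Integrable fun ξ => ‖ξ‖ ^ ((d : ℝ) - 2 * lam) * ‖𝓕 f ξ‖ ^ 2 := by
  have hd : (0 : ℝ) ≤ d := by positivity
  obtain ⟨B, -, hB⟩ := DecaySpace.bounded (by linarith) hf
  have := integrable_norm_sq_fourier (mu := d - lam) (ν := lam - d / 2) (by linarith)
    (by simp; ring) (by linarith) (DecaySpace.integrable h1 hf) hB
  convert this using 4
  ring

theorem memLp_fourier (h1 : (d : ℝ) / 2 < lam) (h2 : lam < d) {f : RSpace d → ℂ}
    (hf : f ∈ DecaySpace d lam) : MemLp (𝓕 f) 2 (csMeasure d lam) :=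
  memLp_csMeasure (continuous_fourier (DecaySpace.integrable h1 hf)).aestronglyMeasurable
    (integrable_norm_sq_fourier_decay h1 h2 hf)

/-- The Fourier transform as a map to the Hilbert space of the complementary series. -/
noncomputable def csFourier (h1 : (d : ℝ) / 2 < lam) (h2 : lam < d) :
    DecaySpace d lam →ₗ[ℂ] CSpace d lam where
  toFun f := (memLp_fourier h1 h2 f.2).toLp
  map_add' f g := by
    rw [← MemLp.toLp_add]
    congr 1
    exact fourier_add_apply' (DecaySpace.integrable h1 f.2) (DecaySpace.integrable h1 g.2)
  map_smul' c f := by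
    rw [RingHom.id_apply, ← MemLp.toLp_const_smul]
    congr 1
    exact fourier_const_smul' c _

theorem csFourier_coe (h1 : (d : ℝ) / 2 < lam) (h2 : lam < d) (f : DecaySpace d lam) :
    csFourier h1 h2 f =ᵐ[volume] 𝓕 (f : RSpace d → ℂ) :=
  (absolutelyContinuous_csMeasure d lam).ae_eq (memLp_fourier h1 h2 f.2).coeFn_toLp

theorem csFourier_congr (h1 : (d : ℝ) / 2 < lam) (h2 : lam < d) {f g : DecaySpace d lam}
    (h : (f : RSpace d → ℂ) =ᵐ[volume] g) : csFourier h1 h2 f = csFourier h1 h2 g := by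
  simp only [csFourier, LinearMap.coe_mk, AddHom.coe_mk]
  congr 1
  exact fourier_congr_ae h

theorem inner_csFourier (h1 : (d : ℝ) / 2 < lam) (h2 : lam < d) (f g : DecaySpace d lam) :
    inner ℂ (csFourier h1 h2 g) (csFourier h1 h2 f) =
      ∫ ξ, ((‖ξ‖ ^ ((d : ℝ) - 2 * lam) : ℝ) : ℂ) * (𝓕 (f : RSpace d → ℂ) ξ *
        starRingEnd ℂ (𝓕 (g : RSpace d → ℂ) ξ)) :=
  inner_toLp_cspace (memLp_fourier h1 h2 g.2) (memLp_fourier h1 h2 f.2)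

theorem integrable_fourier_pair (h1 : (d : ℝ) / 2 < lam) (h2 : lam < d) (f g : DecaySpace d lam) :
    Integrable fun ξ => ((‖ξ‖ ^ ((d : ℝ) - 2 * lam) : ℝ) : ℂ) * (𝓕 (f : RSpace d → ℂ) ξ *
        starRingEnd ℂ (𝓕 (g : RSpace d → ℂ) ξ)) := by
  refine (integrable_inner_cspace (csFourier h1 h2 g) (csFourier h1 h2 f)).congr ?_
  filter_upwards [csFourier_coe h1 h2 f, csFourier_coe h1 h2 g] with ξ e1 e2
  rw [e1, e2]

theorem integrable_riesz_decay (h1 : (d : ℝ) / 2 < lam) (h2 : lam < d) {f g : RSpace d → ℂ}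
    (hf : f ∈ DecaySpace d lam) (hg : g ∈ DecaySpace d lam) :
    Integrable (fun p : RSpace d × RSpace d => ((‖p.1 - p.2‖ ^ (-(2 * (d - lam))) : ℝ) : ℂ) *
      (f p.2 * starRingEnd ℂ (g p.1))) (volume.prod volume) := by
  have hd : (0 : ℝ) ≤ d := by positivity
  obtain ⟨B, -, hB⟩ := DecaySpace.bounded (by linarith) hf
  exact integrable_riesz_prod (ι := (LinearIsometry.id : RSpace d →ₗᵢ[ℝ] RSpace d))
    (A := ContinuousLinearMap.id ℝ _) (s := 2 * (d - lam)) (fun y => rfl) (fun x => le_rfl)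
    (by linarith) (by simp; linarith) (DecaySpace.integrable h1 hf) (DecaySpace.integrable h1 hg) hB

/-- The constant which relates the Riesz kernel and its Fourier transform. -/
noncomputable def rieszConst (d : ℕ) (lam : ℝ) : ℂ :=
  ((Real.Gamma (lam - d / 2) * Real.pi ^ (-(lam - d / 2)) : ℝ) : ℂ)⁻¹ *
    (Real.Gamma (d - lam) * Real.pi ^ (-(d - lam)) : ℝ)

/-- The inner product of the complementary series in terms of the Riesz kernel. -/
theorem inner_csFourier_eq_kernel_prod (h1 : (d : ℝ) / 2 < lam)
    (h2 : lam < d) (f g : DecaySpace d lam) :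
    inner ℂ (csFourier h1 h2 g) (csFourier h1 h2 f) =
      rieszConst d lam * ∫ p : RSpace d × RSpace d,
        ((‖p.1 - p.2‖ ^ (-(2 * (d - lam))) : ℝ) : ℂ) * ((f : RSpace d → ℂ) p.2 *
        starRingEnd ℂ ((g : RSpace d → ℂ) p.1)) ∂(volume.prod volume) := by
  have hd : (0 : ℝ) ≤ d := by positivity
  have hf := DecaySpace.integrable h1 f.2
  have hg := DecaySpace.integrable h1 g.2
  obtain ⟨e, he⟩ := exists_norm_eq (RSpace d) zero_le_one
  have hL := integrable_riesz_decay h1 h2 f.2 g.2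
  have hν : lam - d / 2 = (Module.finrank ℝ (RSpace d) : ℝ) / 2 - (d - lam) := by simp; ring
  have hR := integrable_fourier_pair h1 h2 f g
  have hexp : (d : ℝ) - 2 * lam = -(2 * (lam - d / 2)) := by ring
  -- For j = 0 the polynomial `breakPoly` is the constant Γ(ν) π^{-ν}, whose inverse enters
  -- `rieszConst`.
  have key := kernel_fourier_identity (ι := (LinearIsometry.id : RSpace d →ₗᵢ[ℝ] RSpace d))
    (A := ContinuousLinearMap.id ℝ _) inner_id_adjoint he (j := 0) (mu := d - lam) (by linarith) hν
    (by simp; linarith) hf hg (by rw [Measure.volume_eq_prod]; simpa using hL)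
    (by rw [hexp] at hR; convert hR using 6; · simp
        rfl)
  simp only [pow_zero, one_mul, Nat.cast_zero, add_zero, Complex.ofReal_one,
    LinearIsometry.id_apply, ContinuousLinearMap.id_apply] at key
  have hκ : ((Real.Gamma (lam - d / 2) * Real.pi ^ (-(lam - d / 2)) : ℝ) : ℂ) ≠ 0 := by
    have := Real.Gamma_pos_of_pos (sub_pos.2 h1)
    exact_mod_cast (by positivity :
      0 < Real.Gamma (lam - d / 2) * Real.pi ^ (-(lam - d / 2))).ne'
  rw [rieszConst, mul_assoc, ← Measure.volume_eq_prod, key, eq_inv_mul_iff_mul_eq₀ hκ,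
    inner_csFourier, hexp, ← integral_const_mul]
  refine integral_congr_ae (Filter.Eventually.of_forall fun ξ => ?_)
  simp only [breakPoly]
  simp [gaussCoeff]
  ring

theorem inner_csFourier_eq_kernel (h1 : (d : ℝ) / 2 < lam)
    (h2 : lam < d) (f g : DecaySpace d lam) :
    inner ℂ (csFourier h1 h2 g) (csFourier h1 h2 f) =
      rieszConst d lam * ∫ x, ∫ y, (f : RSpace d → ℂ) y *
        (starRingEnd ℂ ((g : RSpace d → ℂ) x) * (‖x - y‖ ^ (-(2 * (d - lam))) : ℝ)) := by
  rw [inner_csFourier_eq_kernel_prod, integral_prod _ (integrable_riesz_decay h1 h2 f.2 g.2)]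
  congr 1
  refine integral_congr_ae (Filter.Eventually.of_forall fun x => ?_)
  refine integral_congr_ae (Filter.Eventually.of_forall fun y => ?_)
  simp only; ring

/-- Unitarity, which is not visible on the Fourier side, is the invariance of the Riesz kernel form.
-/
theorem inner_csFourier_decayAct (h1 : (d : ℝ) / 2 < lam) (h2 : lam < d) (h0 : 0 < lam)
    (h : SO0 d) (f g : DecaySpace d lam) :
    inner ℂ (csFourier h1 h2 (decayAct h0 h g)) (csFourier h1 h2 (decayAct h0 h f)) =
      inner ℂ (csFourier h1 h2 g) (csFourier h1 h2 f) := by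
  rw [inner_csFourier_eq_kernel, inner_csFourier_eq_kernel]
  congr 1
  exact integral_kernel_principalAct (by ring) h f g

theorem norm_csFourier_decayAct (h1 : (d : ℝ) / 2 < lam) (h2 : lam < d) (h0 : 0 < lam)
    (h : SO0 d) (f : DecaySpace d lam) :
    ‖csFourier h1 h2 (decayAct h0 h f)‖ = ‖csFourier h1 h2 f‖ := by
  rw [@norm_eq_sqrt_re_inner ℂ, @norm_eq_sqrt_re_inner ℂ _ _ _ _ (csFourier h1 h2 f),
    inner_csFourier_decayAct]

end FourierEmbedding

/-! ### Extending isometric actions from a dense subspace. -/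

section UnitaryExtension

variable {G E H : Type*} [Group G] [AddCommGroup E] [Module ℂ E] [NormedAddCommGroup H]
  [InnerProductSpace ℂ H]

/-- A family of operators which is isometric and multiplicative on a dense subspace extends to a
unitary representation. -/
theorem exists_unitary_extension [CompleteSpace H] (T : E →ₗ[ℂ] H) (hT : DenseRange T) (A : G → E →ₗ[ℂ] E)
    (hn : ∀ g f, ‖T (A g f)‖ = ‖T f‖) (h1 : ∀ f, T (A 1 f) = T f)
    (hmul : ∀ g h f, T (A (g * h) f) = T (A g (A h f))) :
    ∃ U : G →* (H ≃ₗᵢ[ℂ] H), ∀ g f, U g (T f) = T (A g f) := by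
  set L : G → H →L[ℂ] H := fun g => LinearMap.extendOfNorm (T ∘ₗ A g) T with hL
  have hLT : ∀ g f, L g (T f) = T (A g f) := fun g f =>
    LinearMap.extendOfNorm_eq hT ⟨1, fun x => by simp [hn]⟩ f
  have hLn : ∀ g v, ‖L g v‖ = ‖v‖ := fun g v =>
    hT.induction_on (p := fun v => ‖L g v‖ = ‖v‖) v
      (isClosed_eq (by fun_prop) (by fun_prop)) fun f => by rw [hLT, hn]
  have hL1 : ∀ v, L 1 v = v := fun v =>
    hT.induction_on (p := fun v => L 1 v = v) v
      (isClosed_eq (by fun_prop) (by fun_prop)) fun f => by rw [hLT, h1]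
  have hLm : ∀ g h v, L (g * h) v = L g (L h v) := fun g h v =>
    hT.induction_on (p := fun v => L (g * h) v = L g (L h v)) v
      (isClosed_eq (by fun_prop) (by fun_prop)) fun f => by rw [hLT, hLT, hLT, hmul]
  let U : G → (H ≃ₗᵢ[ℂ] H) := fun g =>
    { toLinearEquiv := LinearEquiv.ofLinearMap (L g : H →ₗ[ℂ] H) (L g⁻¹ : H →ₗ[ℂ] H)
        (by ext v; simp [← hLm, hL1]) (by ext v; simp [← hLm, hL1])
      norm_map' := hLn g }
  have hU : ∀ g v, U g v = L g v := fun g v => rfl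
  refine ⟨{ toFun := U, map_one' := ?_, map_mul' := ?_ }, fun g f => ?_⟩
  · ext v; rw [hU, hL1]; rfl
  · intro g h; ext v; rw [hU, hLm]; rfl
  · exact hLT g f

/-- For unitary U one has ‖U v - v‖² = 2‖v‖² - 2 Re⟨v, U v⟩, so convergence of diagonal matrix
coefficients gives strong continuity at 1 on the dense set. Isometry extends this to all vectors,
and translation in the group to all points. -/
theorem continuous_unitary_of_dense [TopologicalSpace G] [ContinuousMul G]
    (U : G →* (H ≃ₗᵢ[ℂ] H)) {S : Set H} (hS : Dense S)
    (h : ∀ v ∈ S, Filter.Tendsto (fun g => inner ℂ v (U g v)) (nhds 1) (nhds (inner ℂ v v)))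
    (v : H) : Continuous fun g => U g v := by
  have hS1 : ∀ v ∈ S, Filter.Tendsto (fun g => ‖U g v - v‖) (nhds 1) (nhds 0) := by
    intro v hv
    have h2 : Filter.Tendsto (fun g => ‖U g v - v‖ ^ 2) (nhds 1) (nhds 0) := by
      have h3 : ∀ g, ‖U g v - v‖ ^ 2 = 2 * ‖v‖ ^ 2 - 2 * (inner ℂ v (U g v)).re := by
        intro g
        rw [norm_sub_rev, norm_sub_sq (𝕜 := ℂ), LinearIsometryEquiv.norm_map]
        simp only [RCLike.re_to_complex]; ring
      simp only [h3]
      have h4 := ((Complex.continuous_re.tendsto _).comp (h v hv)).const_mul 2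
      have h5 := h4.const_sub (2 * ‖v‖ ^ 2)
      rw [inner_self_eq_norm_sq_to_K] at h5
      have h6 : (((‖v‖ : ℂ)) ^ 2).re = ‖v‖ ^ 2 := by
        rw [← Complex.ofReal_pow, Complex.ofReal_re]
      have h7 : 2 * ‖v‖ ^ 2 - 2 * (((‖v‖ : ℂ)) ^ 2).re = 0 := by rw [h6, sub_self]
      exact h7 ▸ h5
    have h6 := h2.sqrt
    simpa [Real.sqrt_sq (norm_nonneg _)] using h6
  have h1 : ∀ v, Filter.Tendsto (fun g => U g v) (nhds 1) (nhds v) := by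
    intro v
    rw [Metric.tendsto_nhds]
    intro ε hε
    obtain ⟨w, hw, hvw⟩ := hS.exists_dist_lt v (ε := ε / 3) (by linarith)
    filter_upwards [(hS1 w hw).eventually (gt_mem_nhds (by linarith : 0 < ε / 3))] with g hg
    calc dist (U g v) v ≤ dist (U g v) (U g w) + dist (U g w) w + dist w v := dist_triangle4 _ _ _ _
      _ < ε / 3 + ε / 3 + ε / 3 := by
        rw [LinearIsometryEquiv.dist_map, dist_eq_norm (U g w)]
        rw [dist_comm w]
        linarith
      _ = ε := by ring
  rw [continuous_iff_continuousAt]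
  intro g0
  have h7 : Filter.Tendsto (fun g => g0⁻¹ * g) (nhds g0) (nhds 1) := by
    have : Continuous fun g => g0⁻¹ * g := continuous_const_mul g0⁻¹
    simpa using this.tendsto g0
  have h8 := ((U g0).continuous.tendsto v).comp ((h1 v).comp h7)
  refine h8.congr fun g => ?_
  simp only [Function.comp_apply]
  change (U g0 * U (g0⁻¹ * g)) v = _
  rw [← map_mul]
  simp

end UnitaryExtension

/-! ### Injectivity of the Fourier transform, and bumps whose transform has no zeros on a ball. -/

section FourierInjective

variable {W : Type*} [NormedAddCommGroup W] [InnerProductSpace ℝ W] [FiniteDimensional ℝ W]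
  [MeasurableSpace W] [BorelSpace W]

/-- A test function is the Fourier transform of a Schwartz function, and the transform can be moved
to G under the integral. -/
theorem ae_eq_zero_of_fourier_eq_zero {G : W → ℂ} (hG : Integrable G) (h : ∀ a, 𝓕 G a = 0) :
    G =ᵐ[volume] 0 := by
  refine ae_eq_zero_of_integral_contDiff_smul_eq_zero hG.locallyIntegrable fun g hg hgs => ?_
  have hgc : ContDiff ℝ ∞ fun x => (g x : ℂ) := Complex.ofRealCLM.contDiff.comp hg
  have hgcs : HasCompactSupport fun x => (g x : ℂ) :=
    hgs.comp_left (g := fun r : ℝ => (r : ℂ)) Complex.ofReal_zero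
  set ψ : 𝓢(W, ℂ) := hgcs.toSchwartzMap hgc with hψ
  set φ : 𝓢(W, ℂ) := 𝓕⁻ ψ with hφ
  have hφψ : ∀ x, 𝓕 (φ : W → ℂ) x = g x := by
    intro x
    rw [← SchwartzMap.fourier_coe, hφ, FourierInvPair.fourier_fourierInv_eq]
    rfl
  have hflip := VectorFourier.integral_fourierIntegral_smul_eq_flip (μ := (volume : Measure W))
    (ν := (volume : Measure W)) (L := innerₗ W) (e := Real.fourierChar)
    Real.continuous_fourierChar (by exact continuous_inner) φ.integrable hG
  have h2 : ∫ x, g x • G x = ∫ ξ, 𝓕 (φ : W → ℂ) ξ • G ξ := by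
    refine integral_congr_ae (Filter.Eventually.of_forall fun x => ?_)
    simp only [hφψ, smul_eq_mul, Complex.real_smul]
  rw [h2]
  refine hflip.trans ?_
  rw [flip_innerₗ]
  have h3 : ∀ a, VectorFourier.fourierIntegral Real.fourierChar volume (innerₗ W) G a = 0 := h
  simp [h3]

theorem fourier_comp_add_right' (f : W → ℂ) (a ξ : W) :
    𝓕 (fun x => f (x + a)) ξ = Real.fourierChar (inner ℝ a ξ) • 𝓕 f ξ :=
  congrFun (VectorFourier.fourierIntegral_comp_add_right _ _ _ f a) ξ

theorem exists_bump_fourier_ne_zero {R : ℝ} (hR : 0 < R) : ∃ f : W → ℂ, ContDiff ℝ ∞ f ∧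
    HasCompactSupport f ∧ ∀ ξ, ‖ξ‖ ≤ R → 𝓕 f ξ ≠ 0 := by
  -- With support in the ball of radius 1/(8R) the phase 2π⟨x, ξ⟩ is at most 2π/8 < 1 for ‖ξ‖ ≤ R.
  -- So its cosine is at least 1/2, and the real part of the transform at least half the integral of
  -- the bump.
  let b : ContDiffBump (0 : W) := ⟨1 / (16 * R), 1 / (8 * R), by positivity, by
    apply one_div_lt_one_div_of_lt <;> linarith⟩
  have hbs : ∀ x, b x ≠ 0 → ‖x‖ < 1 / (8 * R) := fun x hx => by
    have : x ∈ Function.support b := hx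
    rw [b.support_eq] at this
    simpa only [mem_ball_zero_iff] using this
  have hbi : Integrable b := b.continuous.integrable_of_hasCompactSupport b.hasCompactSupport
  have hpos : 0 < ∫ x, b x := b.integral_pos
  refine ⟨fun x => (b x : ℂ), Complex.ofRealCLM.contDiff.comp b.contDiff,
    b.hasCompactSupport.comp_left (g := fun r : ℝ => (r : ℂ)) Complex.ofReal_zero,
    fun ξ hξ h0 => ?_⟩
  have hre : (𝓕 (fun x => (b x : ℂ)) ξ).re = ∫ x, Real.cos (2 * Real.pi * inner ℝ x ξ) * b x := by
    rw [Real.fourier_eq']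
    have h1 : Integrable fun x : W => Complex.exp (((-2 * Real.pi * inner ℝ x ξ : ℝ) : ℂ) *
        Complex.I) • (b x : ℂ) := by
      refine hbi.mono (Continuous.aestronglyMeasurable ?_)
        (Filter.Eventually.of_forall fun x => ?_)
      · have := b.continuous
        fun_prop
      · rw [smul_eq_mul, norm_mul, Complex.norm_exp_ofReal_mul_I, one_mul, Complex.norm_real]
    have h2 := integral_re h1
    simp only [RCLike.re_to_complex] at h2
    rw [← h2]
    refine integral_congr_ae (Filter.Eventually.of_forall fun x => ?_)
    simp only [smul_eq_mul, Complex.mul_re, Complex.exp_ofReal_mul_I_re, Complex.ofReal_re,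
      Complex.ofReal_im, mul_zero, sub_zero]
    congr 1
    rw [← Real.cos_neg]; congr 1; ring
  have hge : (∫ x, b x) / 2 ≤ ∫ x, Real.cos (2 * Real.pi * inner ℝ x ξ) * b x := by
    rw [← integral_div]
    refine integral_mono (hbi.div_const 2) ?_ fun x => ?_
    · refine hbi.mono (Continuous.aestronglyMeasurable ?_) (Filter.Eventually.of_forall fun x => ?_)
      · have := b.continuous
        fun_prop
      · rw [norm_mul]
        exact mul_le_of_le_one_left (norm_nonneg _) (Real.abs_cos_le_one _)
    · by_cases hx : b x = 0
      · simp [hx]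
      · have h3 : |inner ℝ x ξ| ≤ 1 / 8 := by
          calc |inner ℝ x ξ| ≤ ‖x‖ * ‖ξ‖ := abs_real_inner_le_norm x ξ
            _ ≤ 1 / (8 * R) * R := by gcongr; exact (hbs x hx).le
            _ = 1 / 8 := by field_simp
        have h4 : (2 * Real.pi * inner ℝ x ξ) ^ 2 ≤ 1 := by
          rw [sq_le_one_iff_abs_le_one, abs_mul, abs_of_pos Real.two_pi_pos]
          have := Real.pi_lt_four
          have := Real.pi_pos
          nlinarith [abs_nonneg (inner ℝ x ξ)]
        have h5 := Real.one_sub_sq_div_two_le_cos (x := 2 * Real.pi * inner ℝ x ξ)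
        have h6 : 0 ≤ b x := b.nonneg
        show b x / 2 ≤ _
        nlinarith
  rw [h0, Complex.zero_re] at hre
  linarith

end FourierInjective

/-! ### Existence of the complementary series. -/

section CompSeriesExists

variable {d : ℕ} {lam : ℝ}

/-- The test functions in `DecaySpace d lam`. -/
def testSub (d : ℕ) (lam : ℝ) : Submodule ℂ (DecaySpace d lam) where
  carrier := {f | ContDiff ℝ ∞ (f : RSpace d → ℂ) ∧ HasCompactSupport (f : RSpace d → ℂ)}
  zero_mem' := ⟨contDiff_const, HasCompactSupport.zero⟩
  add_mem' h1 h2 := ⟨h1.1.add h2.1, h1.2.add h2.2⟩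
  smul_mem' c _ h := ⟨contDiff_const.smul h.1, h.2.mul_left (f := fun _ => c)⟩

/-- A test function as an element of `DecaySpace d lam`. -/
def testDecay (lam : ℝ) {f : RSpace d → ℂ} (hf : ContDiff ℝ ∞ f) (hs : HasCompactSupport f) :
    DecaySpace d lam :=
  ⟨f, DecaySpace.of_hasCompactSupport lam hf.continuous hs⟩

theorem testDecay_mem (lam : ℝ) {f : RSpace d → ℂ} (hf : ContDiff ℝ ∞ f)
    (hs : HasCompactSupport f) : testDecay lam hf hs ∈ testSub d lam := ⟨hf, hs⟩

theorem continuousAt_principalAct_one {f : RSpace d → ℂ} (hf : Continuous f) (x : RSpace d) :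
    Filter.Tendsto (fun h : SO0 d => principalAct lam h f x) (nhds 1) (nhds (f x)) := by
  have hm : Continuous fun h : SO0 d => movedCone h x :=
    ((SO0.continuous_mat d).comp continuous_inv).matrix_mulVec continuous_const
  have hcf : Continuous fun h : SO0 d => confFactor h x :=
    ((continuous_apply _).comp hm).add ((continuous_apply _).comp hm)
  have h1 : confFactor (1 : SO0 d) x = 1 := confFactor_one x
  have hp : ContinuousAt (fun h : SO0 d => confPoint h x) 1 := by
    refine (PiLp.continuous_toLp 2 _).continuousAt.comp (continuousAt_pi.2 fun i => ?_)
    exact ((continuous_apply _).comp hm).continuousAt.div hcf.continuousAt (by rw [h1]; simp)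
  have hr : ContinuousAt (fun h : SO0 d => confFactor h x ^ (-lam)) 1 :=
    hcf.continuousAt.rpow_const (Or.inl (by rw [h1]; simp))
  have h2 : ContinuousAt (fun h : SO0 d => principalAct lam h f x) 1 :=
    (Complex.continuous_ofReal.continuousAt.comp hr).mul
      (ContinuousAt.comp (g := f) hf.continuousAt hp)
  have h3 := h2.tendsto
  rwa [principalAct_one] at h3

variable [NeZero d]

/-- Translating a test function multiplies its transform by a character. If v is orthogonal to all
translates of f, then the function w v conj(𝓕 f), with w the weight, has vanishing Fourier
transform, so it is 0 almost everywhere. Bumps with transforms free of zeros on larger and larger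
balls give v = 0. -/
theorem topologicalClosure_map_testSub (h1 : (d : ℝ) / 2 < lam) (h2 : lam < d) :
    ((testSub d lam).map (csFourier h1 h2)).topologicalClosure = ⊤ := by
  rw [Submodule.topologicalClosure_eq_top_iff, Submodule.eq_bot_iff]
  intro v hv
  rw [Submodule.mem_orthogonal] at hv
  set w : RSpace d → ℂ := fun ξ => ((‖ξ‖ ^ ((d : ℝ) - 2 * lam) : ℝ) : ℂ) with hw
  have key : ∀ f : RSpace d → ℂ, ContDiff ℝ ∞ f → HasCompactSupport f →
      (fun ξ => w ξ * (v ξ * starRingEnd ℂ (𝓕 f ξ))) =ᵐ[volume] 0 := by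
    intro f hf hs
    have hco := csFourier_coe h1 h2 (testDecay lam hf hs)
    have hint : Integrable fun ξ => w ξ * (v ξ * starRingEnd ℂ (𝓕 f ξ)) := by
      refine (integrable_inner_cspace (csFourier h1 h2 (testDecay lam hf hs)) v).congr ?_
      filter_upwards [hco] with ξ hξ
      rw [hξ]; rfl
    refine ae_eq_zero_of_fourier_eq_zero hint fun a => ?_
    have hf' : ContDiff ℝ ∞ fun x => f (x + a) := hf.comp (contDiff_id.add contDiff_const)
    have hs' : HasCompactSupport fun x => f (x + a) :=
      hs.comp_homeomorph (Homeomorph.addRight a)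
    have h3 := hv _ (Submodule.mem_map_of_mem (testDecay_mem lam hf' hs'))
    rw [inner_cspace] at h3
    rw [Real.fourier_eq, ← h3]
    refine integral_congr_ae ?_
    filter_upwards [csFourier_coe h1 h2 (testDecay lam hf' hs')] with ξ hξ
    rw [hξ]
    simp only [testDecay]
    rw [fourier_comp_add_right', Circle.smul_def, Circle.smul_def, smul_eq_mul, smul_eq_mul,
      map_mul, AddChar.map_neg_eq_inv, Circle.coe_inv_eq_conj, real_inner_comm]
    simp only [hw]
    ring
  refine CSpace.ext_volume ?_
  choose f hf hs hne using fun n : ℕ =>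
    exists_bump_fourier_ne_zero (W := RSpace d) (R := n + 1) (by positivity)
  have hall := ae_all_iff.2 fun n => key (f n) (hf n) (hs n)
  have h0 := (absolutelyContinuous_csMeasure d lam).ae_eq (Lp.coeFn_zero ℂ 2 (csMeasure d lam))
  filter_upwards [hall, ae_norm_pos (W := RSpace d), h0] with ξ hξ hpos h0
  rw [h0]
  obtain ⟨n, hn⟩ := exists_nat_ge ‖ξ‖
  have h4 := hξ n
  simp only [Pi.zero_apply, mul_eq_zero, hw, Complex.ofReal_eq_zero, map_eq_zero] at h4
  rcases h4 with h4 | h4 | h4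
  · exact absurd h4 (Real.rpow_pos_of_pos hpos _).ne'
  · exact h4
  · exact absurd h4 (hne n ξ (by linarith))

theorem denseRange_csFourier (h1 : (d : ℝ) / 2 < lam) (h2 : lam < d) :
    DenseRange (csFourier h1 h2) := by
  have h := (Submodule.dense_iff_topologicalClosure_eq_top).2 (topologicalClosure_map_testSub h1 h2)
  exact h.mono (by rintro _ ⟨f, -, rfl⟩; exact ⟨f, rfl⟩)

/-- Dominated convergence in the kernel form of the inner product. The majorant comes from the bound
for the action by `timeBound`, which is continuous in h and so locally bounded near 1. -/
theorem tendsto_inner_csFourier (h1 : (d : ℝ) / 2 < lam) (h2 : lam < d) (h0 : 0 < lam)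
    (f : DecaySpace d lam) (hf : Continuous (f : RSpace d → ℂ)) :
    Filter.Tendsto (fun h => inner ℂ (csFourier h1 h2 f) (csFourier h1 h2 (decayAct h0 h f)))
      (nhds 1) (nhds (inner ℂ (csFourier h1 h2 f) (csFourier h1 h2 f))) := by
  simp only [inner_csFourier_eq_kernel_prod]
  refine Filter.Tendsto.const_mul _ ?_
  obtain ⟨hm, C, hC⟩ := f.2
  set τ : RSpace d → ℝ := fun x => coneVec x (Sum.inr 0) ^ (-lam) with hτ
  have hτ0 : ∀ x, 0 ≤ τ x := fun x => Real.rpow_nonneg (coneVec_time_pos x).le _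
  have hτm : (fun x => (τ x : ℂ)) ∈ DecaySpace d lam := by
    refine ⟨?_, 1, fun x => ?_⟩
    · have := (contDiff_coneVec (d := d) (Sum.inr 0)).continuous.measurable
      fun_prop
    · rw [one_mul, Complex.norm_real, Real.norm_of_nonneg (hτ0 x)]
  set K : ℝ := C * ((1 : SO0 d).timeBound + 1) ^ lam with hK
  have hC0 : 0 ≤ C := nonneg_of_mul_nonneg_left ((norm_nonneg _).trans (hC 0))
    (Real.rpow_pos_of_pos (coneVec_time_pos 0) _)
  have hbd : ∀ᶠ h : SO0 d in nhds 1, ∀ y, ‖principalAct lam h f y‖ ≤ K * τ y := by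
    filter_upwards [((SO0.continuous_timeBound d).tendsto 1).eventually
      (gt_mem_nhds (lt_add_one _))] with h hh y
    refine (norm_principalAct_le h0 h hC y).trans ?_
    have := h.timeBound_pos
    refine mul_le_mul_of_nonneg_right ?_ (hτ0 y)
    rw [hK]
    gcongr
  refine tendsto_integral_filter_of_dominated_convergence
    (fun p : RSpace d × RSpace d => K * ‖((‖p.1 - p.2‖ ^ (-(2 * (d - lam))) : ℝ) : ℂ) *
      ((τ p.2 : ℂ) * starRingEnd ℂ ((f : RSpace d → ℂ) p.1))‖) ?_ ?_ ?_ ?_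
  · exact Filter.Eventually.of_forall fun h =>
      (integrable_riesz_decay h1 h2 (decayAct h0 h f).2 f.2).aestronglyMeasurable
  · filter_upwards [hbd] with h hh
    refine Filter.Eventually.of_forall fun p => ?_
    rw [norm_mul, norm_mul, norm_mul, norm_mul, Complex.norm_real (τ p.2),
      Real.norm_of_nonneg (hτ0 _)]
    calc _ ≤ ‖((‖p.1 - p.2‖ ^ (-(2 * (d - lam))) : ℝ) : ℂ)‖ * (K * τ p.2 *
          ‖starRingEnd ℂ ((f : RSpace d → ℂ) p.1)‖) := by
          gcongr; exact hh p.2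
      _ = _ := by ring
  · exact (integrable_riesz_decay h1 h2 hτm f.2).norm.const_mul K
  · refine Filter.Eventually.of_forall fun p => ?_
    exact ((continuousAt_principalAct_one hf p.2).mul_const _).const_mul _

/-- The complementary series exists. -/
theorem exists_isCompSeries (h1 : (d : ℝ) / 2 < lam) (h2 : lam < d) :
    ∃ U, IsCompSeries d lam U := by
  have h0 : 0 < lam := lt_of_le_of_lt (by positivity) h1
  obtain ⟨U, hU⟩ := exists_unitary_extension (G := SO0 d) (csFourier h1 h2)
    (denseRange_csFourier h1 h2) (decayAct h0) (norm_csFourier_decayAct h1 h2 h0)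
    (fun f => csFourier_congr h1 h2 (Filter.Eventually.of_forall fun x => by
      simp [decayAct, principalAct_one]))
    (fun g h f => csFourier_congr h1 h2 (principalAct_mul lam g h f))
  refine ⟨U, fun h f hf hs => ⟨csFourier h1 h2 (testDecay lam hf hs),
    csFourier h1 h2 (decayAct h0 h (testDecay lam hf hs)), csFourier_coe _ _ _,
    csFourier_coe _ _ _, hU _ _⟩, ?_⟩
  refine continuous_unitary_of_dense U ((Submodule.dense_iff_topologicalClosure_eq_top).2
    (topologicalClosure_map_testSub h1 h2)) ?_
  rintro _ ⟨f, hf, rfl⟩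
  simp only [hU]
  exact tendsto_inner_csFourier h1 h2 h0 f hf.1.continuous

theorem isCompSeries_compSeries (h1 : (d : ℝ) / 2 < lam) (h2 : lam < d) :
    IsCompSeries d lam (compSeries d lam) := by
  rw [compSeries, dif_pos (exists_isCompSeries h1 h2)]
  exact (exists_isCompSeries h1 h2).choose_spec

theorem compSeries_csFourier_of_test (h1 : (d : ℝ) / 2 < lam) (h2 : lam < d) (h0 : 0 < lam)
    (h : SO0 d) {f : DecaySpace d lam} (hf : f ∈ testSub d lam) :
    compSeries d lam h (csFourier h1 h2 f) = csFourier h1 h2 (decayAct h0 h f) := by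
  obtain ⟨v, w, hv, hw, hvw⟩ := (isCompSeries_compSeries h1 h2).formula h f hf.1 hf.2
  have e1 : v = csFourier h1 h2 f := CSpace.ext_volume (hv.trans (csFourier_coe h1 h2 f).symm)
  have e2 : w = csFourier h1 h2 (decayAct h0 h f) :=
    CSpace.ext_volume (hw.trans (csFourier_coe h1 h2 (decayAct h0 h f)).symm)
  rw [← e1, ← e2, hvw]

theorem inner_eq_of_test (h1 : (d : ℝ) / 2 < lam) (h2 : lam < d) {v w : CSpace d lam}
    (h : ∀ f ∈ testSub d lam, inner ℂ (csFourier h1 h2 f) v = inner ℂ (csFourier h1 h2 f) w) :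
    v = w := by
  have h3 : v - w ∈ ((testSub d lam).map (csFourier h1 h2))ᗮ := by
    rw [Submodule.mem_orthogonal]
    rintro _ ⟨f, hf, rfl⟩
    rw [inner_sub_right, h f hf, sub_self]
  rw [(Submodule.topologicalClosure_eq_top_iff).1 (topologicalClosure_map_testSub h1 h2)] at h3
  exact sub_eq_zero.1 ((Submodule.mem_bot ℂ).1 h3)

/-- `compSeries` is chosen, and is known only on test functions. The formula passes to `DecaySpace`
without approximation: the vector which h should map to the right side is identified by its inner
products with test vectors, through unitarity and invariance of the kernel. -/
theorem compSeries_csFourier (h1 : (d : ℝ) / 2 < lam) (h2 : lam < d) (h0 : 0 < lam)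
    (h : SO0 d) (f : DecaySpace d lam) :
    compSeries d lam h (csFourier h1 h2 f) = csFourier h1 h2 (decayAct h0 h f) := by
  have h3 : (compSeries d lam h).symm (csFourier h1 h2 (decayAct h0 h f)) = csFourier h1 h2 f := by
    refine inner_eq_of_test h1 h2 fun g hg => ?_
    rw [← inner_csFourier_decayAct h1 h2 h0 h f g, ← compSeries_csFourier_of_test h1 h2 h0 h hg,
      ← LinearIsometryEquiv.inner_map_map (compSeries d lam h)]
    simp
  rw [← h3]; simp

end CompSeriesExists

/-! ### Splitting frequencies into tangential and normal parts. -/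

section Split

/-- The point `(ξ, η)` of `ℝ^{d+1}`. -/
noncomputable def snocE {d : ℕ} (ξ : RSpace d) (η : ℝ) : RSpace (d + 1) :=
  WithLp.toLp 2 (Fin.snoc (fun i => ξ i) η : Fin (d + 1) → ℝ)

theorem incl_eq_snocE {d : ℕ} (y : RSpace d) : incl d y = snocE y 0 := rfl

/-- The projection `(ξ, η) ↦ ξ`. -/
noncomputable def projE (d : ℕ) : RSpace (d + 1) →L[ℝ] RSpace d :=
  LinearMap.toContinuousLinearMap
    { toFun := fun ζ => WithLp.toLp 2 fun i => ζ i.castSucc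
      map_add' := fun _ _ => by ext i; simp
      map_smul' := fun _ _ => by ext i; simp }

@[simp] theorem projE_apply {d : ℕ} (ζ : RSpace (d + 1)) (i : Fin d) :
    projE d ζ i = ζ i.castSucc := rfl

@[simp] theorem snocE_last {d : ℕ} (ξ : RSpace d) (η : ℝ) : snocE ξ η (Fin.last d) = η := by
  simp [snocE]

@[simp] theorem projE_snocE {d : ℕ} (ξ : RSpace d) (η : ℝ) : projE d (snocE ξ η) = ξ := by
  ext i; simp [snocE]

@[simp] theorem projE_incl {d : ℕ} (y : RSpace d) : projE d (incl d y) = y := by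
  ext i; simp [incl]

@[simp] theorem incl_last {d : ℕ} (y : RSpace d) : incl d y (Fin.last d) = 0 := by simp [incl]

theorem norm_sq_eq_projE {d : ℕ} (ζ : RSpace (d + 1)) :
    ‖ζ‖ ^ 2 = ‖projE d ζ‖ ^ 2 + ζ (Fin.last d) ^ 2 := by
  rw [EuclideanSpace.real_norm_sq_eq, EuclideanSpace.real_norm_sq_eq, Fin.sum_univ_castSucc]
  simp

theorem norm_snocE_sq {d : ℕ} (ξ : RSpace d) (η : ℝ) : ‖snocE ξ η‖ ^ 2 = ‖ξ‖ ^ 2 + η ^ 2 := by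
  rw [norm_sq_eq_projE]; simp

theorem norm_projE_le {d : ℕ} (ζ : RSpace (d + 1)) : ‖projE d ζ‖ ≤ ‖ζ‖ := by
  have := norm_sq_eq_projE ζ
  exact abs_le_of_sq_le_sq' (by nlinarith [sq_nonneg (ζ (Fin.last d))]) (norm_nonneg _) |>.2

theorem inner_incl {d : ℕ} (y : RSpace d) (ζ : RSpace (d + 1)) :
    inner ℝ ζ (incl d y) = inner ℝ y (projE d ζ) := by
  simp [PiLp.inner_apply, Fin.sum_univ_castSucc, incl, mul_comm]

theorem inner_snocE {d : ℕ} (ξ ξ' : RSpace d) (η η' : ℝ) :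
    inner ℝ (snocE ξ η) (snocE ξ' η') = inner ℝ ξ ξ' + η * η' := by
  simp [PiLp.inner_apply, Fin.sum_univ_castSucc, snocE, mul_comm]

theorem inner_unitVec_last {d : ℕ} (ζ : RSpace (d + 1)) :
    inner ℝ ζ (unitVec (Fin.last d)) = ζ (Fin.last d) := by
  simp [EuclideanSpace.inner_single_right]

/-- `ℝ^{d+1} = ℝ^d × ℝ` as measure spaces. -/
noncomputable def splitEquiv (d : ℕ) : RSpace d × ℝ ≃ᵐ RSpace (d + 1) :=
  MeasurableEquiv.prodComm.trans <|
    ((MeasurableEquiv.refl ℝ).prodCongr (MeasurableEquiv.toLp 2 (Fin d → ℝ)).symm).trans <|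
      (MeasurableEquiv.piFinSuccAbove (fun _ => ℝ) (Fin.last d)).symm.trans <|
        MeasurableEquiv.toLp 2 (Fin (d + 1) → ℝ)

theorem splitEquiv_apply {d : ℕ} (p : RSpace d × ℝ) : splitEquiv d p = snocE p.1 p.2 := by
  ext i
  induction i using Fin.lastCases with
  | last => simp [splitEquiv, snocE, MeasurableEquiv.piFinSuccAbove, MeasurableEquiv.prodCongr]; rfl
  | cast i => simp [splitEquiv, snocE, MeasurableEquiv.piFinSuccAbove, MeasurableEquiv.prodCongr]; rfl

theorem measurePreserving_splitEquiv (d : ℕ) : MeasurePreserving (splitEquiv d) :=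
  (PiLp.volume_preserving_toLp (Fin (d + 1))).comp <|
    ((volume_preserving_piFinSuccAbove (fun _ : Fin (d + 1) => ℝ) (Fin.last d)).symm).comp <|
      ((MeasurePreserving.id volume).prod (PiLp.volume_preserving_ofLp (Fin d))).comp
        Measure.measurePreserving_swap

theorem integrable_split {d : ℕ} {E : Type*} [NormedAddCommGroup E] {F : RSpace (d + 1) → E} :
    Integrable (fun p : RSpace d × ℝ => F (snocE p.1 p.2)) (volume.prod volume) ↔ Integrable F := by
  rw [← Measure.volume_eq_prod, ← (measurePreserving_splitEquiv d).integrable_comp_emb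
    (splitEquiv d).measurableEmbedding]
  simp only [Function.comp_def, splitEquiv_apply]

theorem integral_split {d : ℕ} {E : Type*} [NormedAddCommGroup E] [NormedSpace ℝ E]
    {F : RSpace (d + 1) → E} (hF : Integrable F) :
    ∫ ζ, F ζ = ∫ ξ, ∫ η, F (snocE ξ η) := by
  rw [← integral_prod (fun p : RSpace d × ℝ => F (snocE p.1 p.2)) (integrable_split.2 hF),
    ← (measurePreserving_splitEquiv d).integral_comp (splitEquiv d).measurableEmbedding]
  simp only [splitEquiv_apply]
  rfl

/-- Allows almost everywhere identities in ξ to be used as almost everywhere identities in (ξ, η).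
-/
theorem quasiMeasurePreserving_projE (d : ℕ) :
    Measure.QuasiMeasurePreserving (projE d) volume volume := by
  have h := (Measure.quasiMeasurePreserving_fst (μ := (volume : Measure (RSpace d)))
    (ν := (volume : Measure ℝ))).comp
    (measurePreserving_splitEquiv d).symm.quasiMeasurePreserving
  have e : (projE d : RSpace (d + 1) → RSpace d) = Prod.fst ∘ (splitEquiv d).symm := by
    refine funext fun ζ => ?_
    obtain ⟨p, rfl⟩ := (splitEquiv d).surjective ζ
    rw [Function.comp_apply, MeasurableEquiv.symm_apply_apply, splitEquiv_apply, projE_snocE]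
  rw [e]
  exact h

end Split

/-! ### The homogeneous symbol and its fibre integrals. -/

section Symbol

/-- The polynomial `∑_{2k ≤ j} q_k η^{j-2k} |ξ|^{2k}`. -/
noncomputable def symb {d : ℕ} (j : ℕ) (q : ℕ → ℂ) (ζ : RSpace (d + 1)) : ℂ :=
  ∑ k ∈ Finset.range (j / 2 + 1), q k *
    ((ζ (Fin.last d) ^ (j - 2 * k) * ‖projE d ζ‖ ^ (2 * k) : ℝ) : ℂ)

/-- The polynomial `∑_{2k ≤ j} q_k u^{j-2k}`. -/
noncomputable def symbOne (j : ℕ) (q : ℕ → ℂ) (u : ℂ) : ℂ :=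
  ∑ k ∈ Finset.range (j / 2 + 1), q k * u ^ (j - 2 * k)

theorem continuous_symb {d : ℕ} (j : ℕ) (q : ℕ → ℂ) :
    Continuous (symb (d := d) j q) := by
  unfold symb; fun_prop

theorem symb_snocE_smul {d : ℕ} (j : ℕ) (q : ℕ → ℂ) (ξ : RSpace d) (u : ℝ) :
    symb j q (snocE ξ (‖ξ‖ * u)) = ((‖ξ‖ ^ j : ℝ) : ℂ) * symbOne j q u := by
  rw [symb, symbOne, Finset.mul_sum]
  refine Finset.sum_congr rfl fun k hk => ?_
  have h : j = (j - 2 * k) + 2 * k := by have := Finset.mem_range.1 hk; omega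
  rw [snocE_last, projE_snocE]
  conv_rhs => rw [h, pow_add]
  push_cast
  simp only [Nat.add_sub_cancel]
  ring

theorem norm_symbOne_le (j : ℕ) (q : ℕ → ℂ) (u : ℝ) :
    ‖symbOne j q u‖ ≤ (∑ k ∈ Finset.range (j / 2 + 1), ‖q k‖) * Real.sqrt (1 + u ^ 2) ^ j := by
  rw [symbOne, Finset.sum_mul]
  refine (norm_sum_le _ _).trans (Finset.sum_le_sum fun k _ => ?_)
  rw [norm_mul, norm_pow, Complex.norm_real, Real.norm_eq_abs]
  have h1 : (1 : ℝ) ≤ Real.sqrt (1 + u ^ 2) := Real.one_le_sqrt.2 (by nlinarith)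
  have h2 : |u| ≤ Real.sqrt (1 + u ^ 2) := Real.abs_le_sqrt (by linarith)
  gcongr
  calc |u| ^ (j - 2 * k) ≤ Real.sqrt (1 + u ^ 2) ^ (j - 2 * k) := by gcongr
    _ ≤ _ := pow_le_pow_right₀ h1 (by omega)

theorem exists_symbOne_ne_zero {j : ℕ} {q : ℕ → ℂ} {k : ℕ} (hk : 2 * k ≤ j) (hq : q k ≠ 0) :
    ∃ u : ℝ, symbOne j q u ≠ 0 := by
  by_contra! h
  let p : Polynomial ℂ := ∑ k ∈ Finset.range (j / 2 + 1),
    Polynomial.C (q k) * Polynomial.X ^ (j - 2 * k)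
  have hp : p = 0 := by
    refine Polynomial.eq_zero_of_infinite_isRoot p
      ((Set.infinite_range_of_injective Complex.ofReal_injective).mono ?_)
    rintro _ ⟨u, rfl⟩
    have := h u
    simpa [p, Polynomial.eval_finsetSum, symbOne] using this
  have hc : p.coeff (j - 2 * k) = q k := by
    simp only [p, Polynomial.finsetSum_coeff, Polynomial.coeff_C_mul_X_pow]
    rw [Finset.sum_eq_single k]
    · simp
    · intro b hb hbk
      rw [if_neg]
      have := Finset.mem_range.1 hb
      omega
    · intro hk'
      exact absurd (Finset.mem_range.2 (by omega)) hk'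
  rw [hp, Polynomial.coeff_zero] at hc
  exact hq hc.symm

/-- The norm constant of the multiplication by `symb j q`. -/
noncomputable def symbConst (j : ℕ) (s : ℝ) (q : ℕ → ℂ) : ℝ :=
  ∫ u : ℝ, Real.sqrt (1 + u ^ 2) ^ s * ‖symbOne j q u‖ ^ 2

theorem continuous_symbConst_integrand (j : ℕ) (s : ℝ) (q : ℕ → ℂ) :
    Continuous fun u : ℝ => Real.sqrt (1 + u ^ 2) ^ s * ‖symbOne j q u‖ ^ 2 := by
  have h : Continuous fun u : ℝ => Real.sqrt (1 + u ^ 2) ^ s :=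
    Continuous.rpow_const (by fun_prop) fun u => Or.inl (by positivity)
  unfold symbOne
  fun_prop

/-- The one-variable polynomial has degree at most j, so the integrand is of order at most
|u|^{s+2j} at infinity. -/
theorem integrable_symbConst {j : ℕ} {s : ℝ} (hs : s + 2 * j < -1) (q : ℕ → ℂ) :
    Integrable fun u : ℝ => Real.sqrt (1 + u ^ 2) ^ s * ‖symbOne j q u‖ ^ 2 := by
  have h := integrable_rpow_neg_one_add_norm_sq (E := ℝ) (μ := volume) (r := -(s + 2 * j))
    (by simp; linarith)
  refine (h.const_mul ((∑ k ∈ Finset.range (j / 2 + 1), ‖q k‖) ^ 2)).mono'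
    (continuous_symbConst_integrand j s q).aestronglyMeasurable
    (Filter.Eventually.of_forall fun u => ?_)
  rw [Real.norm_of_nonneg (by positivity)]
  have h1 : 0 < Real.sqrt (1 + u ^ 2) := by positivity
  calc _ ≤ Real.sqrt (1 + u ^ 2) ^ s *
        ((∑ k ∈ Finset.range (j / 2 + 1), ‖q k‖) * Real.sqrt (1 + u ^ 2) ^ j) ^ 2 := by
        gcongr; exact norm_symbOne_le j q u
    _ = _ := by
      have e : (1 + ‖u‖ ^ 2) ^ (-(-(s + 2 * j)) / 2) = Real.sqrt (1 + u ^ 2) ^ s *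
          (Real.sqrt (1 + u ^ 2) ^ j) ^ 2 := by
        rw [← pow_mul, ← Real.rpow_natCast (Real.sqrt _), ← Real.rpow_add h1, Real.sqrt_eq_rpow,
          ← Real.rpow_mul (by positivity), Real.norm_eq_abs, sq_abs]
        congr 1; push_cast; ring
      rw [e]; ring

theorem symbConst_pos {j : ℕ} {s : ℝ} (hs : s + 2 * j < -1) {q : ℕ → ℂ} {k : ℕ} (hk : 2 * k ≤ j)
    (hq : q k ≠ 0) : 0 < symbConst j s q := by
  obtain ⟨u, hu⟩ := exists_symbOne_ne_zero hk hq
  rw [symbConst, integral_pos_iff_support_of_nonneg (fun u => by positivity)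
    (integrable_symbConst hs q)]
  refine (continuous_symbConst_integrand j s q).isOpen_support.measure_pos volume ⟨u, ?_⟩
  have h1 : 0 < Real.sqrt (1 + u ^ 2) := by positivity
  have h2 := norm_pos_iff.2 hu
  exact (by positivity : 0 < Real.sqrt (1 + u ^ 2) ^ s * ‖symbOne j q u‖ ^ 2).ne'

theorem norm_snocE_smul {d : ℕ} (ξ : RSpace d) (u : ℝ) :
    ‖snocE ξ (‖ξ‖ * u)‖ = ‖ξ‖ * Real.sqrt (1 + u ^ 2) := by
  rw [← Real.sqrt_sq (norm_nonneg (snocE _ _)), norm_snocE_sq,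
    show ‖ξ‖ ^ 2 + (‖ξ‖ * u) ^ 2 = ‖ξ‖ ^ 2 * (1 + u ^ 2) by ring,
    Real.sqrt_mul (by positivity), Real.sqrt_sq (norm_nonneg _)]

theorem symb_section_scaling {d : ℕ} (j : ℕ) (s : ℝ) (q : ℕ → ℂ) {ξ : RSpace d} (hξ : 0 < ‖ξ‖)
    (u : ℝ) : ‖snocE ξ (‖ξ‖ * u)‖ ^ s * ‖symb j q (snocE ξ (‖ξ‖ * u))‖ ^ 2 =
      ‖ξ‖ ^ (s + 2 * j) * (Real.sqrt (1 + u ^ 2) ^ s * ‖symbOne j q u‖ ^ 2) := by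
  rw [norm_snocE_smul, symb_snocE_smul, norm_mul, Complex.norm_real, Real.norm_of_nonneg
    (by positivity), Real.mul_rpow hξ.le (Real.sqrt_nonneg _), Real.rpow_add hξ, mul_comm 2 (j : ℝ),
    Real.rpow_mul hξ.le, Real.rpow_natCast, Real.rpow_two]
  ring

theorem integrable_symb_section {d j : ℕ} {s : ℝ} (hs : s + 2 * j < -1) (q : ℕ → ℂ) {ξ : RSpace d}
    (hξ : 0 < ‖ξ‖) : Integrable fun η => ‖snocE ξ η‖ ^ s * ‖symb j q (snocE ξ η)‖ ^ 2 := by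
  rw [← integrable_comp_mul_left_iff _ hξ.ne']
  simp only [symb_section_scaling j s q hξ]
  exact (integrable_symbConst hs q).const_mul _

/-- Substitute η = |ξ| u: homogeneity takes out |ξ|^{s+2j}, and dη = |ξ| du accounts for the
remaining 1 in the exponent. -/
theorem integral_symb_section {d j : ℕ} {s : ℝ} (q : ℕ → ℂ) {ξ : RSpace d}
    (hξ : 0 < ‖ξ‖) : ∫ η, ‖snocE ξ η‖ ^ s * ‖symb j q (snocE ξ η)‖ ^ 2 =
      ‖ξ‖ ^ (s + 2 * j + 1) * symbConst j s q := by
  have h := Measure.integral_comp_mul_left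
    (fun η => ‖snocE ξ η‖ ^ s * ‖symb j q (snocE ξ η)‖ ^ 2) ‖ξ‖
  simp only [symb_section_scaling j s q hξ] at h
  rw [integral_const_mul, abs_of_pos (inv_pos.2 hξ), smul_eq_mul, eq_inv_mul_iff_mul_eq₀ hξ.ne'] at h
  rw [← h, Real.rpow_add_one hξ.ne', symbConst]
  ring

theorem aestronglyMeasurable_symb_mul {d j : ℕ} (q : ℕ → ℂ) {v : RSpace d → ℂ}
    (hv : AEStronglyMeasurable v volume) :
    AEStronglyMeasurable (fun ζ : RSpace (d + 1) => symb j q ζ * v (projE d ζ)) volume :=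
  (continuous_symb j q).aestronglyMeasurable.mul
    (hv.comp_quasiMeasurePreserving (quasiMeasurePreserving_projE d))

theorem integrable_and_integral_symb_mul {d j : ℕ} [NeZero d] {s : ℝ} (hs : s + 2 * j < -1)
    (q : ℕ → ℂ)
    {v : RSpace d → ℂ} (hv : AEStronglyMeasurable v volume)
    (hi : Integrable fun ξ => ‖ξ‖ ^ (s + 2 * j + 1) * ‖v ξ‖ ^ 2) :
    Integrable (fun ζ : RSpace (d + 1) => ‖ζ‖ ^ s * ‖symb j q ζ * v (projE d ζ)‖ ^ 2) ∧
    ∫ ζ : RSpace (d + 1), ‖ζ‖ ^ s * ‖symb j q ζ * v (projE d ζ)‖ ^ 2 =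
      symbConst j s q * ∫ ξ, ‖ξ‖ ^ (s + 2 * j + 1) * ‖v ξ‖ ^ 2 := by
  have e1 : ∀ (ξ : RSpace d) (η : ℝ), ‖snocE ξ η‖ ^ s *
      ‖symb j q (snocE ξ η) * v (projE d (snocE ξ η))‖ ^ 2 =
      ‖snocE ξ η‖ ^ s * ‖symb j q (snocE ξ η)‖ ^ 2 * ‖v ξ‖ ^ 2 := by
    intro ξ η; rw [projE_snocE, norm_mul]; ring
  have hm : AEStronglyMeasurable (fun ζ : RSpace (d + 1) =>
      ‖ζ‖ ^ s * ‖symb j q ζ * v (projE d ζ)‖ ^ 2) volume :=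
    (measurable_norm.pow_const s).aestronglyMeasurable.mul
      ((aestronglyMeasurable_symb_mul q hv).norm.pow 2)
  have hi' : Integrable (fun p : RSpace d × ℝ => ‖snocE p.1 p.2‖ ^ s *
      ‖symb j q (snocE p.1 p.2) * v (projE d (snocE p.1 p.2))‖ ^ 2) (volume.prod volume) := by
    have hm' := hm.comp_measurePreserving (measurePreserving_splitEquiv d)
    simp only [Function.comp_def, splitEquiv_apply] at hm'
    rw [Measure.volume_eq_prod] at hm'
    rw [integrable_prod_iff hm']
    simp only [e1]
    constructor
    · filter_upwards [ae_norm_pos (W := RSpace d)] with ξ hξ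
      exact (integrable_symb_section hs q hξ).mul_const _
    · refine (hi.const_mul (symbConst j s q)).congr ?_
      filter_upwards [ae_norm_pos (W := RSpace d)] with ξ hξ
      have : ∀ η, ‖‖snocE ξ η‖ ^ s * ‖symb j q (snocE ξ η)‖ ^ 2 * ‖v ξ‖ ^ 2‖ =
          ‖snocE ξ η‖ ^ s * ‖symb j q (snocE ξ η)‖ ^ 2 * ‖v ξ‖ ^ 2 := fun η =>
        Real.norm_of_nonneg (by positivity)
      simp only [this]
      rw [integral_mul_const, integral_symb_section q hξ]
      ring
  have hi2 := (integrable_split (F := fun ζ : RSpace (d + 1) =>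
    ‖ζ‖ ^ s * ‖symb j q ζ * v (projE d ζ)‖ ^ 2)).1 hi'
  refine ⟨hi2, ?_⟩
  rw [integral_split hi2, ← integral_const_mul]
  refine integral_congr_ae ?_
  filter_upwards [ae_norm_pos (W := RSpace d)] with ξ hξ
  simp only [e1]
  rw [integral_mul_const, integral_symb_section q hξ]
  ring

end Symbol

/-! ### Multiplication by the symbol as a multiple of an isometry. -/

section BreakMul

theorem norm_sq_cspace {d : ℕ} {lam : ℝ} (v : CSpace d lam) :
    ‖v‖ ^ 2 = ∫ ξ, ‖ξ‖ ^ ((d : ℝ) - 2 * lam) * ‖v ξ‖ ^ 2 := by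
  have h := inner_cspace v v
  have h2 : ∀ ξ, ((‖ξ‖ ^ ((d : ℝ) - 2 * lam) : ℝ) : ℂ) * (v ξ * starRingEnd ℂ (v ξ)) =
      ((‖ξ‖ ^ ((d : ℝ) - 2 * lam) * ‖v ξ‖ ^ 2 : ℝ) : ℂ) := fun ξ => by
    rw [RCLike.mul_conj]; push_cast; rfl
  simp only [h2] at h
  rw [integral_complex_ofReal, inner_self_eq_norm_sq_to_K] at h
  exact Complex.ofReal_injective (by push_cast; exact h)

theorem integrable_norm_sq_cspace {d : ℕ} {lam : ℝ} (v : CSpace d lam) :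
    Integrable fun ξ => ‖ξ‖ ^ ((d : ℝ) - 2 * lam) * ‖v ξ‖ ^ 2 :=
  (integrable_csMeasure_iff (lam := lam) fun ξ => ‖v ξ‖ ^ 2).1
    ((memLp_two_iff_integrable_sq_norm (Lp.aestronglyMeasurable v)).1 (Lp.memLp v))

variable {d j : ℕ} {mu lam lam' : ℝ}

theorem aestronglyMeasurable_cspace [NeZero d] (v : CSpace d lam) : AEStronglyMeasurable v volume :=
  (Lp.aestronglyMeasurable v).mono_ac (absolutelyContinuous_csMeasure d lam)

/-- The relations between the parameters `mu` and `lam` of `SO₀(d+2,1)` and the parameters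
`mu + j` and `lam'` of `SO₀(d+1,1)`. -/
structure BreakParams (d j : ℕ) (mu lam lam' : ℝ) : Prop where
  mu_pos : 0 < mu
  mu_add_lt : mu + j < (d : ℝ) / 2
  lam_add : lam + mu = d + 1
  lam_add' : lam' + (mu + j) = d

theorem BreakParams.half_lt (H : BreakParams d j mu lam lam') : ((d + 1 : ℕ) : ℝ) / 2 < lam := by
  have := H.lam_add; have := H.mu_add_lt; have : (0 : ℝ) ≤ j := j.cast_nonneg
  push_cast; linarith

theorem BreakParams.lt (H : BreakParams d j mu lam lam') : lam < (d + 1 : ℕ) := by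
  have := H.lam_add; have := H.mu_pos
  push_cast; linarith

theorem BreakParams.half_lt' (H : BreakParams d j mu lam lam') : (d : ℝ) / 2 < lam' := by
  have := H.lam_add'; have := H.mu_add_lt
  linarith

theorem BreakParams.lt' (H : BreakParams d j mu lam lam') : lam' < d := by
  have := H.lam_add'; have := H.mu_pos; have : (0 : ℝ) ≤ j := j.cast_nonneg
  linarith

/-- The convergence condition for the fibre integral. The left side is 2(mu + j) - d - 1, so this is
the bound mu + j < d/2. -/
theorem BreakParams.exponent_lt (H : BreakParams d j mu lam lam') :
    ((d + 1 : ℕ) : ℝ) - 2 * lam + 2 * j < -1 := by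
  have := H.lam_add; have := H.mu_add_lt
  push_cast; linarith

/-- The power of |ξ| left by the fibre integral is the weight of the smaller Hilbert space. -/
theorem BreakParams.exponent_eq (H : BreakParams d j mu lam lam') :
    ((d + 1 : ℕ) : ℝ) - 2 * lam + 2 * j + 1 = d - 2 * lam' := by
  have := H.lam_add; have := H.lam_add'
  push_cast; linarith

variable [NeZero d]

theorem memLp_symb_mul (H : BreakParams d j mu lam lam') (q : ℕ → ℂ) (v : CSpace d lam') :
    MemLp (fun ζ : RSpace (d + 1) => symb j q ζ * v (projE d ζ)) 2 (csMeasure (d + 1) lam) := by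
  refine memLp_csMeasure (aestronglyMeasurable_symb_mul q (aestronglyMeasurable_cspace v)) ?_
  refine (integrable_and_integral_symb_mul H.exponent_lt q (aestronglyMeasurable_cspace v) ?_).1
  rw [H.exponent_eq]
  exact integrable_norm_sq_cspace v

/-- Multiplication by the polynomial `symb j q`, from functions of `ξ` to functions
of `(ξ, η)`. -/
noncomputable def breakMul (H : BreakParams d j mu lam lam') (q : ℕ → ℂ) :
    CSpace d lam' →ₗ[ℂ] CSpace (d + 1) lam where
  toFun v := (memLp_symb_mul H q v).toLp
  map_add' v w := by
    rw [← MemLp.toLp_add]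
    refine MemLp.toLp_congr _ _ ?_
    refine csMeasure_absolutelyContinuous _ _ |>.ae_le ?_
    filter_upwards [(quasiMeasurePreserving_projE d).ae
      ((absolutelyContinuous_csMeasure d lam').ae_le (Lp.coeFn_add v w))] with ζ hζ
    rw [Pi.add_apply, hζ, Pi.add_apply, mul_add]
  map_smul' c v := by
    rw [RingHom.id_apply, ← MemLp.toLp_const_smul]
    refine MemLp.toLp_congr _ _ ?_
    refine csMeasure_absolutelyContinuous _ _ |>.ae_le ?_
    filter_upwards [(quasiMeasurePreserving_projE d).ae
      ((absolutelyContinuous_csMeasure d lam').ae_le (Lp.coeFn_smul c v))] with ζ hζ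
    rw [Pi.smul_apply, hζ, Pi.smul_apply, smul_eq_mul, smul_eq_mul, mul_left_comm]

theorem breakMul_coe (H : BreakParams d j mu lam lam') (q : ℕ → ℂ) (v : CSpace d lam') :
    breakMul H q v =ᵐ[volume] fun ζ => symb j q ζ * v (projE d ζ) :=
  (absolutelyContinuous_csMeasure (d + 1) lam).ae_eq (memLp_symb_mul H q v).coeFn_toLp

theorem norm_sq_breakMul (H : BreakParams d j mu lam lam') (q : ℕ → ℂ) (v : CSpace d lam') :
    ‖breakMul H q v‖ ^ 2 = symbConst j (((d + 1 : ℕ) : ℝ) - 2 * lam) q * ‖v‖ ^ 2 := by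
  rw [norm_sq_cspace, norm_sq_cspace]
  have h := (integrable_and_integral_symb_mul H.exponent_lt q (aestronglyMeasurable_cspace v)
    (by rw [H.exponent_eq]; exact integrable_norm_sq_cspace v)).2
  rw [H.exponent_eq] at h
  rw [← h]
  refine integral_congr_ae ?_
  filter_upwards [breakMul_coe H q v] with ζ hζ
  rw [hζ]

theorem norm_breakMul (H : BreakParams d j mu lam lam') (q : ℕ → ℂ) (v : CSpace d lam') :
    ‖breakMul H q v‖ = Real.sqrt (symbConst j (((d + 1 : ℕ) : ℝ) - 2 * lam) q) * ‖v‖ := by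
  have h0 : 0 ≤ symbConst j (((d + 1 : ℕ) : ℝ) - 2 * lam) q :=
    integral_nonneg fun u => by positivity
  rw [← Real.sqrt_sq (norm_nonneg (breakMul H q v)), norm_sq_breakMul, Real.sqrt_mul h0,
    Real.sqrt_sq (norm_nonneg _)]

theorem continuous_breakMul (H : BreakParams d j mu lam lam') (q : ℕ → ℂ) :
    Continuous (breakMul H q) :=
  AddMonoidHomClass.continuous_of_bound (breakMul H q) _ fun v => (norm_breakMul H q v).le

theorem breakMul_smul (H : BreakParams d j mu lam lam') (c : ℂ) (q : ℕ → ℂ) (v : CSpace d lam') :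
    breakMul H (c • q) v = c • breakMul H q v := by
  refine CSpace.ext_volume ?_
  have h := (absolutelyContinuous_csMeasure (d + 1) lam).ae_eq (Lp.coeFn_smul c (breakMul H q v))
  filter_upwards [breakMul_coe H q v, breakMul_coe H (c • q) v, h] with ζ h1 h2 h3
  rw [h3, Pi.smul_apply, h1, h2, smul_eq_mul, ← mul_assoc]
  congr 1
  simp only [symb, Finset.mul_sum, Pi.smul_apply, smul_eq_mul, mul_assoc]

/-- The coefficients of the symmetry breaking polynomial. -/
noncomputable def breakCoeff (ν : ℝ) (j k : ℕ) : ℝ :=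
  ∑ m ∈ Finset.range (j / 2 + 1), gaussCoeff j m * (Real.Gamma (ν - m) *
    Real.pi ^ (-(ν - m))) * m.choose k

/-- Expand |ζ|^{2m} = (|ξ|² + η²)^m by the binomial theorem and collect powers of |ξ|². -/
theorem breakPoly_eq {d j : ℕ} (ν : ℝ) (ζ : RSpace (d + 1)) :
    breakPoly (unitVec (Fin.last d)) ν j ζ =
      ∑ k ∈ Finset.range (j / 2 + 1), breakCoeff ν j k *
        (ζ (Fin.last d) ^ (j - 2 * k) * ‖projE d ζ‖ ^ (2 * k)) := by
  simp only [breakCoeff, Finset.sum_mul]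
  rw [Finset.sum_comm, breakPoly]
  refine Finset.sum_congr rfl fun m hm => ?_
  have hm' := Finset.mem_range.1 hm
  rw [inner_unitVec_last, norm_sq_eq_projE, add_pow, Finset.mul_sum, Finset.mul_sum]
  refine Finset.sum_subset_zero_on_sdiff (Finset.range_mono (by omega)) ?_ ?_
  · intro k hk
    have : m < k := by
      simp only [Finset.mem_sdiff, Finset.mem_range] at hk; omega
    rw [Nat.choose_eq_zero_of_lt this]; simp
  · intro k hk
    have hk' := Finset.mem_range.1 hk
    have e : ζ (Fin.last d) ^ (j - 2 * k) =
        ζ (Fin.last d) ^ (j - 2 * m) * (ζ (Fin.last d) ^ 2) ^ (m - k) := by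
      rw [← pow_mul, ← pow_add]; congr 1; omega
    rw [e, pow_mul]
    ring

theorem symb_breakCoeff {d j : ℕ} (ν : ℝ) (ζ : RSpace (d + 1)) :
    symb j (fun k => (breakCoeff ν j k : ℂ)) ζ =
      (breakPoly (unitVec (Fin.last d)) ν j ζ : ℂ) := by
  rw [breakPoly_eq, symb]; push_cast; rfl

/-- Evaluate the polynomial at |ξ| = 1, η = i. There |ξ|² + η² vanishes, so only the term m = 0
survives, and it has the nonzero value `gaussCoeff j 0` Γ(ν) π^{-ν} i^j. -/
theorem exists_breakCoeff_ne_zero {ν : ℝ} {j : ℕ} (hν : 0 < ν) :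
    ∃ k, 2 * k ≤ j ∧ breakCoeff ν j k ≠ 0 := by
  by_contra! h
  have h1 : ∑ k ∈ Finset.range (j / 2 + 1), (breakCoeff ν j k : ℂ) * Complex.I ^ (j - 2 * k) =
      0 := Finset.sum_eq_zero fun k hk => by
    have := Finset.mem_range.1 hk
    rw [h k (by omega)]; simp
  simp only [breakCoeff] at h1
  push_cast at h1
  simp only [Finset.sum_mul] at h1
  rw [Finset.sum_comm, Finset.sum_eq_single 0] at h1
  · rw [Finset.sum_eq_single 0] at h1
    · have hΓ := (Real.Gamma_pos_of_pos hν).ne'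
      have hp := (Real.rpow_pos_of_pos Real.pi_pos (-ν)).ne'
      have hI : Complex.I ^ j ≠ 0 := pow_ne_zero _ Complex.I_ne_zero
      have hg := gaussCoeff_zero_ne j
      simp [hg, hI, hΓ] at h1
      exact hp h1
    · intro k _ hk
      rw [Nat.choose_eq_zero_of_lt (Nat.pos_of_ne_zero hk)]; simp
    · simp
  · intro m hm hm0
    have hm' := Finset.mem_range.1 hm
    have h2 : ∑ k ∈ Finset.range (m + 1), (1 : ℂ) ^ k * (Complex.I ^ 2) ^ (m - k) * m.choose k =
        0 := by
      rw [← add_pow, Complex.I_sq]; simp [hm0]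
    have h3 : ∑ k ∈ Finset.range (j / 2 + 1), ((m.choose k : ℕ) : ℂ) * Complex.I ^ (j - 2 * k) =
        0 := by
      rw [← mul_zero (Complex.I ^ (j - 2 * m)), ← h2, Finset.mul_sum, eq_comm]
      refine Finset.sum_subset_zero_on_sdiff (Finset.range_mono (by omega)) ?_ ?_
      · intro k hk
        have : m < k := by
          simp only [Finset.mem_sdiff, Finset.mem_range] at hk; omega
        rw [Nat.choose_eq_zero_of_lt this]; simp
      · intro k hk
        have hk' := Finset.mem_range.1 hk
        have e : Complex.I ^ (j - 2 * k) =
            Complex.I ^ (j - 2 * m) * (Complex.I ^ 2) ^ (m - k) := by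
          rw [← pow_mul, ← pow_add]; congr 1; omega
        rw [e]; ring
    simp only [mul_assoc]
    rw [← Finset.mul_sum, ← Finset.mul_sum, ← Finset.mul_sum, h3]
    simp
  · simp

end BreakMul

/-! ### Equivariance of the multiplication operator. -/

section BreakEquivariance

variable {d j : ℕ} [NeZero d] {mu lam lam' : ℝ}

/-- The parameter `ν` of the symmetry breaking polynomial. -/
noncomputable def breakNu (d : ℕ) (mu : ℝ) : ℝ := ((d : ℝ) + 1) / 2 - mu

/-- The last coordinate of x is at most the distance from x to (y, 0), so the kernel is bounded by a
Riesz kernel of exponent 2 mu + j < d. -/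
theorem integrable_breaking_kernel (H : BreakParams d j mu lam lam') {f : RSpace d → ℂ}
    {g : RSpace (d + 1) → ℂ} (hf : f ∈ DecaySpace d lam') (hg : g ∈ DecaySpace (d + 1) lam) :
    Integrable (fun p : RSpace (d + 1) × RSpace d =>
      ((‖p.1 - incl d p.2‖ ^ (-(2 * (mu + j))) : ℝ) : ℂ) *
      (((p.1 (Fin.last d) ^ j : ℝ) : ℂ) * (f p.2 * starRingEnd ℂ (g p.1)))) := by
  have hd : (0 : ℝ) ≤ d := by positivity
  have hj0 : (0 : ℝ) ≤ j := j.cast_nonneg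
  have h1 := H.half_lt'
  have h2 := H.mu_pos
  have h3 := H.mu_add_lt
  obtain ⟨B, -, hB⟩ := DecaySpace.bounded (by linarith) hf
  have hL := integrable_riesz_prod (ι := incl d) (A := projE d) (s := 2 * mu + j) projE_incl
    norm_projE_le (by linarith) (by simp; linarith) (DecaySpace.integrable h1 hf)
    (DecaySpace.integrable H.half_lt hg) hB
  refine hL.mono ?_ ?_
  · have hι : Continuous (incl d) := (incl d).continuous
    have hme : Measurable fun p : RSpace (d + 1) × RSpace d =>
        ‖p.1 - incl d p.2‖ ^ (-(2 * (mu + j))) :=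
      (Continuous.measurable (by fun_prop : Continuous fun p : RSpace (d + 1) × RSpace d =>
        ‖p.1 - incl d p.2‖)).pow_const _
    refine (Complex.measurable_ofReal.comp hme).aestronglyMeasurable.mul
      (AEStronglyMeasurable.mul ?_
      (integrable_prod_conj_mul (DecaySpace.integrable h1 hf)
        (DecaySpace.integrable H.half_lt hg)).aestronglyMeasurable)
    exact Continuous.aestronglyMeasurable (by fun_prop)
  · filter_upwards [ae_norm_sub_pos (incl d)] with p hp
    rw [← mul_assoc, norm_mul, norm_mul _ (f p.2 * _)]
    refine mul_le_mul_of_nonneg_right ?_ (norm_nonneg _)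
    rw [norm_mul, Complex.norm_real, Complex.norm_real, Complex.norm_real,
      Real.norm_of_nonneg (by positivity : 0 ≤ ‖p.1 - incl d p.2‖ ^ (-(2 * (mu + j)))),
      Real.norm_of_nonneg (by positivity : 0 ≤ ‖p.1 - incl d p.2‖ ^ (-(2 * mu + j))), norm_pow,
      Real.norm_eq_abs]
    have h4 : |p.1 (Fin.last d)| ≤ ‖p.1 - incl d p.2‖ := by
      have := PiLp.norm_apply_le (p.1 - incl d p.2) (Fin.last d)
      simpa using this
    calc _ ≤ ‖p.1 - incl d p.2‖ ^ (-(2 * (mu + j))) * ‖p.1 - incl d p.2‖ ^ j := by gcongr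
      _ = _ := by
        rw [← Real.rpow_natCast, ← Real.rpow_add hp]; congr 1; ring

/-- With a = |ζ|^{-2ν}, the inequality a x y ≤ a (x² + y²) for x = |ζ|^j |𝓕 f| and y = |𝓕 g| leaves
two integrals of norm type, finite by the fibre integral and by the finite norm of g. -/
theorem integrable_breaking_fourier (H : BreakParams d j mu lam lam') {f : RSpace d → ℂ}
    {g : RSpace (d + 1) → ℂ} (hf : f ∈ DecaySpace d lam') (hg : g ∈ DecaySpace (d + 1) lam) :
    Integrable fun ζ : RSpace (d + 1) => ((‖ζ‖ ^ ((j : ℝ) - 2 * breakNu d mu) : ℝ) : ℂ) *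
      (𝓕 f (projE d ζ) * starRingEnd ℂ (𝓕 g ζ)) := by
  have h1 := H.half_lt'
  have hfi := DecaySpace.integrable h1 hf
  have hgi := DecaySpace.integrable H.half_lt hg
  -- The symbol is the constant 1 of degree 0; the factor |ζ|^{2j} is put into the weight.
  have hF := (integrable_and_integral_symb_mul (d := d) (j := 0)
    (s := ((d + 1 : ℕ) : ℝ) - 2 * lam + 2 * j) (by simpa using H.exponent_lt) (fun _ => 1)
    (continuous_fourier hfi).aestronglyMeasurable (by
      have := integrable_norm_sq_fourier_decay h1 H.lt' hf
      rw [← H.exponent_eq] at this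
      simpa using this)).1
  have hG := integrable_norm_sq_fourier_decay H.half_lt H.lt hg
  have hs : ((d + 1 : ℕ) : ℝ) - 2 * lam = -(2 * breakNu d mu) := by
    have := H.lam_add
    rw [breakNu]; push_cast; linarith
  rw [hs] at hF hG
  refine (hF.add hG).mono' ?_ ?_
  · exact (Complex.measurable_ofReal.comp (measurable_norm.pow_const _)).aestronglyMeasurable.mul
      (aestronglyMeasurable_fourier_pair _ hfi hgi).aestronglyMeasurable
  filter_upwards [ae_norm_pos (W := RSpace (d + 1))] with ζ hζ
  have e : symb (d := d) 0 (fun _ => 1) ζ = 1 := by simp [symb]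
  rw [Pi.add_apply, e, one_mul, norm_mul, norm_mul, RCLike.norm_conj, Complex.norm_real,
    Real.norm_of_nonneg (by positivity)]
  have e1 : ‖ζ‖ ^ ((j : ℝ) - 2 * breakNu d mu) =
      ‖ζ‖ ^ (-(2 * breakNu d mu)) * ‖ζ‖ ^ j := by
    rw [← Real.rpow_natCast, ← Real.rpow_add hζ]; congr 1; ring
  have e2 : ‖ζ‖ ^ (-(2 * breakNu d mu) + 2 * j) =
      ‖ζ‖ ^ (-(2 * breakNu d mu)) * (‖ζ‖ ^ j) ^ 2 := by
    rw [← pow_mul, ← Real.rpow_natCast, ← Real.rpow_add hζ]; congr 1; push_cast; ring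
  rw [e1, e2]
  have hp := Real.rpow_pos_of_pos hζ (-(2 * breakNu d mu))
  set a := ‖ζ‖ ^ (-(2 * breakNu d mu))
  set x := ‖ζ‖ ^ j * ‖𝓕 f (projE d ζ)‖ with hx
  set y := ‖𝓕 g ζ‖
  have : x * y ≤ x ^ 2 + y ^ 2 := by nlinarith [sq_nonneg (x - y), sq_nonneg (x + y)]
  calc _ = a * (x * y) := by rw [hx]; ring
    _ ≤ a * (x ^ 2 + y ^ 2) := by gcongr
    _ = _ := by rw [hx]; ring

/-- Expresses matrix coefficients of the multiplication operator by the covariant kernel, with a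
constant that does not depend on f and g. Invariance of the kernel integral is then equivariance of
the operator. -/
theorem inner_csFourier_breakMul (H : BreakParams d j mu lam lam') (f : DecaySpace d lam')
    (g : DecaySpace (d + 1) lam) :
    inner ℂ (csFourier H.half_lt H.lt g) (breakMul H (fun k => (breakCoeff (breakNu d mu) j k : ℂ))
        (csFourier H.half_lt' H.lt' f)) =
      (-(2 * Real.pi * Complex.I)) ^ j * (Real.Gamma (mu + j) * Real.pi ^ (-(mu + j)) : ℝ) *
      ∫ x, ∫ y, (f : RSpace d → ℂ) y * (starRingEnd ℂ ((g : RSpace (d + 1) → ℂ) x) *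
        (x (Fin.last d) ^ j * ‖x - incl d y‖ ^ (-(2 * (mu + j))) : ℝ)) := by
  have hd : (0 : ℝ) ≤ d := by positivity
  have hj0 : (0 : ℝ) ≤ j := j.cast_nonneg
  have h3 := H.mu_add_lt
  have hL := integrable_breaking_kernel H f.2 g.2
  have hj : ((j / 2 : ℕ) : ℝ) < breakNu d mu := by
    have : ((j / 2 : ℕ) : ℝ) ≤ j := by exact_mod_cast Nat.div_le_self j 2
    rw [breakNu]; linarith
  have he : ∀ p : RSpace (d + 1) × RSpace d, inner ℝ (p.1 - incl d p.2) (unitVec (Fin.last d)) =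
      p.1 (Fin.last d) := fun p => by rw [inner_unitVec_last]; simp
  have key := kernel_fourier_identity (ι := incl d) (A := projE d) inner_incl
    (e := unitVec (Fin.last d)) (by simp) (j := j) (ν := breakNu d mu) H.mu_pos
    (by rw [breakNu]; simp) hj (DecaySpace.integrable H.half_lt' f.2)
    (DecaySpace.integrable H.half_lt g.2) (by simp only [he]; exact hL)
    (integrable_breaking_fourier H f.2 g.2)
  simp only [he] at key
  rw [Measure.volume_eq_prod] at hL key
  rw [integral_prod _ hL] at key
  calc _ = _ := by
        rw [inner_cspace]
        refine integral_congr_ae ?_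
        have hs : ((d + 1 : ℕ) : ℝ) - 2 * lam = -(2 * breakNu d mu) := by
          have := H.lam_add
          rw [breakNu]; push_cast; linarith
        filter_upwards [csFourier_coe H.half_lt H.lt g, breakMul_coe H
          (fun k => (breakCoeff (breakNu d mu) j k : ℂ)) (csFourier H.half_lt' H.lt' f),
          (quasiMeasurePreserving_projE d).ae (csFourier_coe H.half_lt' H.lt' f)] with ζ e1 e2 e3
        rw [e1, e2, e3, symb_breakCoeff, hs, mul_assoc, ← mul_assoc (Complex.ofReal _),
          ← Complex.ofReal_mul]
    _ = _ := key.symm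
    _ = _ := by
        congr 1
        refine integral_congr_ae (Filter.Eventually.of_forall fun x => ?_)
        refine integral_congr_ae (Filter.Eventually.of_forall fun y => ?_)
        simp only; push_cast; ring

theorem breakMul_compSeries (H : BreakParams d j mu lam lam') (h : SO0 d) (v : CSpace d lam') :
    breakMul H (fun k => (breakCoeff (breakNu d mu) j k : ℂ)) (compSeries d lam' h v) =
      compSeries (d + 1) lam (extendSO0 d h)
        (breakMul H (fun k => (breakCoeff (breakNu d mu) j k : ℂ)) v) := by
  have hlam : 0 < lam := lt_of_le_of_lt (by positivity) H.half_lt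
  have hlam' : 0 < lam' := lt_of_le_of_lt (by positivity) H.half_lt'
  have hc := continuous_breakMul H (fun k => (breakCoeff (breakNu d mu) j k : ℂ))
  refine (denseRange_csFourier H.half_lt' H.lt').induction_on (p := fun v =>
    breakMul H (fun k => (breakCoeff (breakNu d mu) j k : ℂ)) (compSeries d lam' h v) =
      compSeries (d + 1) lam (extendSO0 d h)
        (breakMul H (fun k => (breakCoeff (breakNu d mu) j k : ℂ)) v)) v
    (isClosed_eq (hc.comp (compSeries d lam' h).continuous)
      ((compSeries (d + 1) lam (extendSO0 d h)).continuous.comp hc)) fun f => ?_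
  -- The group element is brought to one side, so that inner products with test vectors decide the
  -- equality; unitarity then puts it on both arguments.
  rw [← LinearIsometryEquiv.symm_apply_eq]
  refine inner_eq_of_test H.half_lt H.lt fun g _ => ?_
  rw [← LinearIsometryEquiv.inner_map_map (compSeries (d + 1) lam (extendSO0 d h)),
    LinearIsometryEquiv.apply_symm_apply, compSeries_csFourier H.half_lt H.lt hlam,
    compSeries_csFourier H.half_lt' H.lt' hlam', inner_csFourier_breakMul, inner_csFourier_breakMul]
  congr 1
  exact integral_breaking_kernel_principalAct H.lam_add H.lam_add' h f g

end BreakEquivariance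

/-! ### Constant coefficient operators on tempered distributions as Fourier multipliers. -/

section Symbols

variable {m : ℕ}

theorem TemperedDistribution.fourier_injective {F G : 𝓢'(RSpace m, ℂ)} (h : 𝓕 F = 𝓕 G) : F = G := by
  exact (FourierTransform.fourierCLE ℂ 𝓢'(RSpace m, ℂ)).injective h

/-- `G` is obtained from `F` by the Fourier multiplier `Q`. -/
def IsMultiplier (Q : RSpace m → ℂ) (F G : 𝓢'(RSpace m, ℂ)) : Prop :=
  Q.HasTemperateGrowth ∧ 𝓕 G = TemperedDistribution.smulLeftCLM ℂ Q (𝓕 F)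

theorem IsMultiplier.refl (F : 𝓢'(RSpace m, ℂ)) : IsMultiplier (fun _ => 1) F F :=
  ⟨by fun_prop, by rw [TemperedDistribution.smulLeftCLM_const, one_smul]⟩

theorem IsMultiplier.pderiv {Q : RSpace m → ℂ} {F G : 𝓢'(RSpace m, ℂ)} (h : IsMultiplier Q F G)
    (i : Fin m) :
    IsMultiplier (fun ξ => (2 * Real.pi * Complex.I) * (ξ i : ℂ) * Q ξ) F (pderivDist i G) := by
  have hi : Function.HasTemperateGrowth fun ξ : RSpace m =>
      ((inner ℝ ξ (unitVec i) : ℝ) : ℂ) := by fun_prop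
  have hQ := h.1
  have e : (fun ξ : RSpace m => (2 * Real.pi * Complex.I) * (ξ i : ℂ) * Q ξ) =
      (2 * Real.pi * Complex.I) • (Q * (fun ξ : RSpace m => ((inner ℝ ξ (unitVec i) : ℝ) : ℂ))) := by
    ext ξ
    simp only [EuclideanSpace.inner_single_right, Pi.smul_apply, Pi.mul_apply, smul_eq_mul]
    simp; ring
  rw [e]
  refine ⟨(Function.HasTemperateGrowth.const _).mul (hQ.mul hi), ?_⟩
  rw [pderivDist, TemperedDistribution.fourier_lineDerivOp_eq, h.2,
    TemperedDistribution.smulLeftCLM_smulLeftCLM_apply hQ hi,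
    TemperedDistribution.smulLeftCLM_smul (hQ.mul hi)]
  rfl

theorem IsMultiplier.sum {ι : Type*} {s : Finset ι} {Q : ι → RSpace m → ℂ}
    {F : 𝓢'(RSpace m, ℂ)} {G : ι → 𝓢'(RSpace m, ℂ)} (h : ∀ i ∈ s, IsMultiplier (Q i) F (G i)) :
    IsMultiplier (fun ξ => ∑ i ∈ s, Q i ξ) F (∑ i ∈ s, G i) := by
  refine ⟨Function.HasTemperateGrowth.sum fun i hi => (h i hi).1, ?_⟩
  rw [TemperedDistribution.smulLeftCLM_sum fun i hi => (h i hi).1, _root_.sum_apply,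
    FourierTransform.fourier_sum]
  exact Finset.sum_congr rfl fun i hi => (h i hi).2

theorem IsMultiplier.const_smul {Q : RSpace m → ℂ} {F G : 𝓢'(RSpace m, ℂ)}
    (h : IsMultiplier Q F G) (c : ℂ) : IsMultiplier (fun ξ => c * Q ξ) F (c • G) := by
  have hQ := h.1
  refine ⟨(Function.HasTemperateGrowth.const _).mul hQ, ?_⟩
  have e : (fun ξ => c * Q ξ) = c • Q := rfl
  rw [e, TemperedDistribution.smulLeftCLM_smul hQ, FourierTransform.fourier_smul, h.2]
  rfl

theorem IsMultiplier.iterate_pderiv {Q : RSpace m → ℂ} {F G : 𝓢'(RSpace m, ℂ)}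
    (h : IsMultiplier Q F G) (i : Fin m) (n : ℕ) :
    IsMultiplier (fun ξ => ((2 * Real.pi * Complex.I) * (ξ i : ℂ)) ^ n * Q ξ) F
      ((pderivDist i)^[n] G) := by
  induction n with
  | zero => simpa using h
  | succ n ih =>
    rw [Function.iterate_succ_apply']
    have := ih.pderiv i
    simpa only [pow_succ', mul_assoc] using this

theorem IsMultiplier.horLap {d : ℕ} {Q : RSpace (d + 1) → ℂ} {F G : 𝓢'(RSpace (d + 1), ℂ)}
    (h : IsMultiplier Q F G) :
    IsMultiplier (fun ξ => (2 * Real.pi * Complex.I) ^ 2 * ((‖projE d ξ‖ ^ 2 : ℝ) : ℂ) * Q ξ) F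
      (horLapDist G) := by
  have h1 := IsMultiplier.sum (s := Finset.univ) fun (i : Fin d) _ =>
    (h.pderiv i.castSucc).pderiv i.castSucc
  have e : (fun ξ : RSpace (d + 1) => (2 * Real.pi * Complex.I) ^ 2 *
      ((‖projE d ξ‖ ^ 2 : ℝ) : ℂ) * Q ξ) = fun ξ => ∑ i : Fin d,
        (2 * Real.pi * Complex.I) * (ξ i.castSucc : ℂ) *
          ((2 * Real.pi * Complex.I) * (ξ i.castSucc : ℂ) * Q ξ) := by
    ext ξ
    rw [EuclideanSpace.real_norm_sq_eq]
    push_cast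
    rw [Finset.mul_sum, Finset.sum_mul]
    refine Finset.sum_congr rfl fun i _ => ?_
    rw [projE_apply]; ring
  rw [e]
  exact h1

theorem IsMultiplier.iterate_horLap {d : ℕ} {Q : RSpace (d + 1) → ℂ}
    {F G : 𝓢'(RSpace (d + 1), ℂ)} (h : IsMultiplier Q F G) (n : ℕ) :
    IsMultiplier (fun ξ => ((2 * Real.pi * Complex.I) ^ 2 * ((‖projE d ξ‖ ^ 2 : ℝ) : ℂ)) ^ n * Q ξ) F
      (horLapDist^[n] G) := by
  induction n with
  | zero => simpa using h
  | succ n ih =>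
    rw [Function.iterate_succ_apply']
    have := ih.horLap
    simpa only [pow_succ', mul_assoc] using this

theorem symb_two_pi_I {d : ℕ} (j : ℕ) (C : ℕ → ℂ) (ξ : RSpace (d + 1)) :
    symb j (fun k => (2 * Real.pi * Complex.I) ^ j * C k) ξ =
      (2 * Real.pi * Complex.I) ^ j * symb j C ξ := by
  simp only [symb, Finset.mul_sum, mul_assoc]

/-- Every term of the operator has order j, so the factors 2πi combine to the common power j. -/
theorem symb_two_pi_I_eq {d : ℕ} (j : ℕ) (C : ℕ → ℂ) :
    (symb (d := d) j fun k => (2 * Real.pi * Complex.I) ^ j * C k) = fun ξ =>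
      ∑ k ∈ Finset.range (j / 2 + 1), C k * (((2 * Real.pi * Complex.I) * (ξ (Fin.last d) : ℂ)) ^
        (j - 2 * k) * (((2 * Real.pi * Complex.I) ^ 2 * ((‖projE d ξ‖ ^ 2 : ℝ) : ℂ)) ^ k * 1)) := by
  ext ξ
  refine Finset.sum_congr rfl fun k hk => ?_
  have hj : (2 * Real.pi * Complex.I : ℂ) ^ j = (2 * Real.pi * Complex.I) ^ (j - 2 * k) *
      ((2 * Real.pi * Complex.I) ^ 2) ^ k := by
    rw [← pow_mul, ← pow_add]; congr 1; have := Finset.mem_range.1 hk; omega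
  rw [hj, pow_mul]
  push_cast
  ring

theorem isMultiplier_diffOpDist {d : ℕ} (j : ℕ) (C : ℕ → ℂ) (F : 𝓢'(RSpace (d + 1), ℂ)) :
    IsMultiplier (symb j fun k => (2 * Real.pi * Complex.I) ^ j * C k) F (diffOpDist j C F) := by
  have h := IsMultiplier.sum (s := Finset.range (j / 2 + 1)) fun k _ =>
    ((((IsMultiplier.refl F).iterate_horLap k).iterate_pderiv (Fin.last d) (j - 2 * k)).const_smul
      (C k))
  rw [symb_two_pi_I_eq]
  exact h

end Symbols

/-! ### Distributions carried by the hyperplane, on the Fourier side. -/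

section DeltaDistribution

theorem integrable_schwartz_mul_cspace {d : ℕ} {lam : ℝ} (hlam : (d : ℝ) ≤ 2 * lam)
    (v : CSpace d lam) (φ : 𝓢(RSpace d, ℂ)) : Integrable fun ξ => φ ξ * v ξ := by
  have hg : (fun ξ : RSpace d => (((1 + ‖ξ‖ ^ 2) ^ bigExp d lam : ℝ) : ℂ)).HasTemperateGrowth := by
    fun_prop
  obtain ⟨C, hC⟩ : ∃ C : ℝ, ∀ ξ, ‖SchwartzMap.smulLeftCLM ℂ
      (fun ξ : RSpace d => (((1 + ‖ξ‖ ^ 2) ^ bigExp d lam : ℝ) : ℂ)) φ ξ‖ ≤ C :=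
    ⟨_, fun ξ => SchwartzMap.norm_le_seminorm ℂ _ ξ⟩
  refine ((integrable_of_CSpace hlam v).bdd_mul (SchwartzMap.continuous _).aestronglyMeasurable
    (Filter.Eventually.of_forall hC)).congr (Filter.Eventually.of_forall fun ξ => ?_)
  have hP : (((1 + ‖ξ‖ ^ 2) ^ bigExp d lam : ℝ) : ℂ) ≠ 0 := by
    exact_mod_cast (by positivity : (0 : ℝ) < (1 + ‖ξ‖ ^ 2) ^ bigExp d lam).ne'
  simp only
  rw [SchwartzMap.smulLeftCLM_apply_apply hg]
  simp only [smul_eq_mul]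
  field_simp

theorem toDist_smul {d : ℕ} {lam : ℝ} (hlam : (d : ℝ) ≤ 2 * lam) [NeZero d] (c : ℂ)
    (v : CSpace d lam) : toDist (c • v) = c • toDist v := by
  refine TemperedDistribution.fourier_injective ?_
  ext φ
  rw [FourierTransform.fourier_smul, fourier_toDist hlam]
  change _ = c • (𝓕 (toDist v) φ)
  rw [fourier_toDist hlam, smul_eq_mul, ← integral_const_mul]
  refine integral_congr_ae ?_
  filter_upwards [(absolutelyContinuous_csMeasure d lam).ae_eq (Lp.coeFn_smul c v)] with ξ hξ
  rw [hξ, Pi.smul_apply, smul_eq_mul]; ring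

/-- Restriction to the hyperplane corresponds to integration over the normal frequency. Both sides
are integrable with the same Fourier transform. -/
theorem fourierInv_restrict_fourier {d : ℕ} (φ : 𝓢(RSpace (d + 1), ℂ)) :
    (𝓕⁻ (restrictCLM d (𝓕 φ)) : 𝓢(RSpace d, ℂ)) =ᵐ[volume] fun ξ => ∫ η, φ (snocE ξ η) := by
  have hφ := integrable_split.2 φ.integrable
  have hΦ : Integrable fun ξ : RSpace d => ∫ η, φ (snocE ξ η) := hφ.integral_prod_left
  set ψ : 𝓢(RSpace d, ℂ) := 𝓕⁻ (restrictCLM d (𝓕 φ)) with hψ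
  have key : (fun ξ => ψ ξ - ∫ η, φ (snocE ξ η)) =ᵐ[volume] 0 := by
    refine ae_eq_zero_of_fourier_eq_zero (ψ.integrable.sub hΦ) fun a => ?_
    have e1 : 𝓕 (ψ : RSpace d → ℂ) a = 𝓕 (φ : RSpace (d + 1) → ℂ) (incl d a) := by
      rw [← SchwartzMap.fourier_coe, hψ, FourierInvPair.fourier_fourierInv_eq,
        ← SchwartzMap.fourier_coe]
      rfl
    have e2 : 𝓕 (φ : RSpace (d + 1) → ℂ) (incl d a) =
        𝓕 (fun ξ : RSpace d => ∫ η, φ (snocE ξ η)) a := by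
      rw [Real.fourier_eq, Real.fourier_eq, integral_split]
      · refine integral_congr_ae (Filter.Eventually.of_forall fun ξ => ?_)
        simp only [Circle.smul_def]
        rw [← integral_smul]
        refine integral_congr_ae (Filter.Eventually.of_forall fun η => ?_)
        simp only [incl_eq_snocE, inner_snocE, mul_zero, add_zero]
      · exact (Real.fourierIntegral_convergent_iff (incl d a)).2 φ.integrable
    have e3 := fourier_add_apply' (f := ψ) (g := -fun ξ : RSpace d => ∫ η, φ (snocE ξ η))
      ψ.integrable hΦ.neg
    have e4 := fourier_const_smul' (-1) fun ξ : RSpace d => ∫ η, φ (snocE ξ η)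
    rw [neg_one_smul, neg_one_smul] at e4
    have e5 : (fun ξ => ψ ξ - ∫ η, φ (snocE ξ η)) =
        ψ + -fun ξ : RSpace d => ∫ η, φ (snocE ξ η) := by
      ext ξ; simp [sub_eq_add_neg]
    rw [e5, e3, e4, Pi.add_apply, Pi.neg_apply, e1, e2, add_neg_cancel]
  filter_upwards [key] with ξ hξ
  exact sub_eq_zero.1 hξ

/-- In other words, the Fourier transform of f(y) δ(x_{d+1}) is the function (ξ, η) ↦ v(ξ). -/
theorem fourier_tensorDelta_toDist {d : ℕ} {lam : ℝ} (hlam : (d : ℝ) ≤ 2 * lam)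
    (v : CSpace d lam) (φ : 𝓢(RSpace (d + 1), ℂ)) :
    𝓕 (tensorDelta (toDist v)) φ = ∫ ξ, (∫ η, φ (snocE ξ η)) * v ξ := by
  have h1 : 𝓕 (tensorDelta (toDist v)) φ = toDist v (restrictCLM d (𝓕 φ)) := rfl
  have h2 : toDist v (restrictCLM d (𝓕 φ)) = 𝓕 (toDist v) (𝓕⁻ (restrictCLM d (𝓕 φ))) := by
    rw [TemperedDistribution.fourier_apply, FourierInvPair.fourier_fourierInv_eq]
  rw [h1, h2, fourier_toDist hlam]
  refine integral_congr_ae ?_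
  filter_upwards [fourierInv_restrict_fourier φ] with ξ hξ
  rw [hξ]

variable {d j : ℕ} [NeZero d] {mu lam lam' : ℝ}

/-- Links the distributions of the theorem with the Hilbert space operator: derivatives become the
symbol, the delta factor a function constant in η. That the result lies in the larger Hilbert space
is built into `breakMul`. -/
theorem diffOpDist_tensorDelta (H : BreakParams d j mu lam lam') (C : ℕ → ℂ)
    (v : CSpace d lam') :
    diffOpDist j C (tensorDelta (toDist v)) =
      toDist (breakMul H (fun k => (2 * Real.pi * Complex.I) ^ j * C k) v) := by
  have h1 : (d : ℝ) ≤ 2 * lam' := by have := H.half_lt'; linarith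
  have h2 : ((d + 1 : ℕ) : ℝ) ≤ 2 * lam := by have := H.half_lt; linarith
  refine TemperedDistribution.fourier_injective ?_
  obtain ⟨hQ, hm⟩ := isMultiplier_diffOpDist j C (tensorDelta (toDist v))
  rw [hm]
  ext φ
  rw [TemperedDistribution.smulLeftCLM_apply_apply, fourier_tensorDelta_toDist h1,
    fourier_toDist h2]
  set q : ℕ → ℂ := fun k => (2 * Real.pi * Complex.I) ^ j * C k
  have hae := breakMul_coe H q v
  have hi : Integrable fun ζ => φ ζ * (symb j q ζ * v (projE d ζ)) := by
    refine (integrable_schwartz_mul_cspace h2 (breakMul H q v) φ).congr ?_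
    filter_upwards [hae] with ζ hζ
    rw [hζ]
  have e : ∫ ζ, φ ζ * breakMul H q v ζ = ∫ ζ, φ ζ * (symb j q ζ * v (projE d ζ)) := by
    refine integral_congr_ae ?_
    filter_upwards [hae] with ζ hζ
    rw [hζ]
  rw [e, integral_split hi]
  refine integral_congr_ae (Filter.Eventually.of_forall fun ξ => ?_)
  simp only [projE_snocE]
  rw [← integral_mul_const]
  refine integral_congr_ae (Filter.Eventually.of_forall fun η => ?_)
  simp only
  rw [SchwartzMap.smulLeftCLM_apply_apply hQ, smul_eq_mul]
  ring

end DeltaDistribution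

/-! ### The same multipliers for pointwise derivatives of Schwartz functions. -/

section SchwartzMultiplier

variable {m : ℕ}

/-- The function `G` is the Schwartz function which is obtained from `φ` by the Fourier
multiplier `Q`. -/
def IsSchwartzMultiplier (Q : RSpace m → ℂ) (φ : 𝓢(RSpace m, ℂ)) (G : RSpace m → ℂ) : Prop :=
  ∃ ψ : 𝓢(RSpace m, ℂ), (ψ : RSpace m → ℂ) = G ∧ ∀ ξ, 𝓕 ψ ξ = Q ξ * 𝓕 φ ξ

theorem IsSchwartzMultiplier.refl (φ : 𝓢(RSpace m, ℂ)) : IsSchwartzMultiplier (fun _ => 1) φ φ :=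
  ⟨φ, rfl, fun _ => (one_mul _).symm⟩

variable {Q : RSpace m → ℂ} {φ : 𝓢(RSpace m, ℂ)} {G : RSpace m → ℂ}

theorem IsSchwartzMultiplier.pderiv (h : IsSchwartzMultiplier Q φ G) (i : Fin m) :
    IsSchwartzMultiplier (fun ξ => (2 * Real.pi * Complex.I) * (ξ i : ℂ) * Q ξ) φ
      (pderivFun i G) := by
  obtain ⟨ψ, rfl, hψ⟩ := h
  refine ⟨∂_{unitVec i} ψ, ?_, fun ξ => ?_⟩
  · ext x
    rw [SchwartzMap.lineDerivOp_apply]; rfl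
  · have hi : (fun ξ : RSpace m => inner ℝ ξ (unitVec i)).HasTemperateGrowth := by fun_prop
    rw [SchwartzMap.fourier_lineDerivOp_eq, _root_.smul_apply,
      SchwartzMap.smulLeftCLM_apply_apply hi, hψ]
    simp only [EuclideanSpace.inner_single_right, smul_eq_mul, Complex.real_smul]
    simp; ring

theorem IsSchwartzMultiplier.sum {ι : Type*} {s : Finset ι} {Q : ι → RSpace m → ℂ}
    {G : ι → RSpace m → ℂ} (h : ∀ i ∈ s, IsSchwartzMultiplier (Q i) φ (G i)) :
    IsSchwartzMultiplier (fun ξ => ∑ i ∈ s, Q i ξ) φ (∑ i ∈ s, G i) := by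
  choose! ψ h1 h2 using h
  refine ⟨∑ i ∈ s, ψ i, ?_, fun ξ => ?_⟩
  · ext x
    rw [_root_.sum_apply, Finset.sum_apply]
    exact Finset.sum_congr rfl fun i hi => congrFun (h1 i hi) x
  · rw [FourierTransform.fourier_sum, _root_.sum_apply, Finset.sum_mul]
    exact Finset.sum_congr rfl fun i hi => h2 i hi ξ

theorem IsSchwartzMultiplier.const_smul (h : IsSchwartzMultiplier Q φ G) (c : ℂ) :
    IsSchwartzMultiplier (fun ξ => c * Q ξ) φ (c • G) := by
  obtain ⟨ψ, rfl, hψ⟩ := h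
  refine ⟨c • ψ, rfl, fun ξ => ?_⟩
  rw [FourierTransform.fourier_smul, _root_.smul_apply, hψ, smul_eq_mul, mul_assoc]

theorem IsSchwartzMultiplier.iterate_pderiv (h : IsSchwartzMultiplier Q φ G) (i : Fin m) (n : ℕ) :
    IsSchwartzMultiplier (fun ξ => ((2 * Real.pi * Complex.I) * (ξ i : ℂ)) ^ n * Q ξ) φ
      ((pderivFun i)^[n] G) := by
  induction n with
  | zero => simpa using h
  | succ n ih =>
    rw [Function.iterate_succ_apply']
    have := ih.pderiv i
    simpa only [pow_succ', mul_assoc] using this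

theorem IsSchwartzMultiplier.horLap {d : ℕ} {Q : RSpace (d + 1) → ℂ} {φ : 𝓢(RSpace (d + 1), ℂ)}
    {G : RSpace (d + 1) → ℂ} (h : IsSchwartzMultiplier Q φ G) :
    IsSchwartzMultiplier
      (fun ξ => (2 * Real.pi * Complex.I) ^ 2 * ((‖projE d ξ‖ ^ 2 : ℝ) : ℂ) * Q ξ) φ
      (horLapFun G) := by
  have h1 := IsSchwartzMultiplier.sum (s := Finset.univ) fun (i : Fin d) _ =>
    (h.pderiv i.castSucc).pderiv i.castSucc
  have e : (fun ξ : RSpace (d + 1) => (2 * Real.pi * Complex.I) ^ 2 *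
      ((‖projE d ξ‖ ^ 2 : ℝ) : ℂ) * Q ξ) = fun ξ => ∑ i : Fin d,
        (2 * Real.pi * Complex.I) * (ξ i.castSucc : ℂ) *
          ((2 * Real.pi * Complex.I) * (ξ i.castSucc : ℂ) * Q ξ) := by
    ext ξ
    rw [EuclideanSpace.real_norm_sq_eq]
    push_cast
    rw [Finset.mul_sum, Finset.sum_mul]
    refine Finset.sum_congr rfl fun i _ => ?_
    rw [projE_apply]; ring
  rw [e]
  exact h1

theorem IsSchwartzMultiplier.iterate_horLap {d : ℕ} {Q : RSpace (d + 1) → ℂ}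
    {φ : 𝓢(RSpace (d + 1), ℂ)} {G : RSpace (d + 1) → ℂ} (h : IsSchwartzMultiplier Q φ G) (n : ℕ) :
    IsSchwartzMultiplier
      (fun ξ => ((2 * Real.pi * Complex.I) ^ 2 * ((‖projE d ξ‖ ^ 2 : ℝ) : ℂ)) ^ n * Q ξ) φ
      (horLapFun^[n] G) := by
  induction n with
  | zero => simpa using h
  | succ n ih =>
    rw [Function.iterate_succ_apply']
    have := ih.horLap
    simpa only [pow_succ', mul_assoc] using this

theorem isSchwartzMultiplier_diffOpFun {d : ℕ} (j : ℕ) (C : ℕ → ℂ) (φ : 𝓢(RSpace (d + 1), ℂ)) :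
    IsSchwartzMultiplier (symb j fun k => (2 * Real.pi * Complex.I) ^ j * C k) φ
      (diffOpFun j C φ) := by
  have h := IsSchwartzMultiplier.sum (s := Finset.range (j / 2 + 1)) fun k _ =>
    ((((IsSchwartzMultiplier.refl φ).iterate_horLap k).iterate_pderiv (Fin.last d)
      (j - 2 * k)).const_smul (C k))
  rw [symb_two_pi_I_eq]
  exact h

end SchwartzMultiplier

/-! ### Plancherel's formula in mixed form. -/

section Plancherel

variable {W : Type*} [NormedAddCommGroup W] [InnerProductSpace ℝ W] [FiniteDimensional ℝ W]
  [MeasurableSpace W] [BorelSpace W]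

theorem fourier_conj (f : W → ℂ) (ξ : W) :
    𝓕 (fun x => starRingEnd ℂ (f x)) ξ = starRingEnd ℂ (𝓕 f (-ξ)) := by
  rw [Real.fourier_eq, Real.fourier_eq, ← integral_conj]
  refine integral_congr_ae (Filter.Eventually.of_forall fun x => ?_)
  simp [Circle.smul_def, AddChar.map_neg_eq_inv]

theorem schwartz_fourierInv_apply (φ : 𝓢(W, ℂ)) (ξ : W) :
    (𝓕⁻ φ : 𝓢(W, ℂ)) ξ = (𝓕 φ : 𝓢(W, ℂ)) (-ξ) := by
  rw [SchwartzMap.fourierInv_coe, SchwartzMap.fourier_coe, Real.fourierInv_eq_fourier_neg]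

/-- Plancherel's formula for a Schwartz function and an integrable function. -/
theorem integral_fourier_mul_conj_fourier (φ : 𝓢(W, ℂ)) {f : W → ℂ} (hf : Integrable f) :
    ∫ ξ, (𝓕 φ : 𝓢(W, ℂ)) ξ * starRingEnd ℂ (𝓕 f ξ) = ∫ x, φ x * starRingEnd ℂ (f x) := by
  have hflip := VectorFourier.integral_fourierIntegral_smul_eq_flip (μ := (volume : Measure W))
    (ν := (volume : Measure W)) (L := innerₗ W) (e := Real.fourierChar)
    Real.continuous_fourierChar (by exact continuous_inner) (𝓕⁻ φ : 𝓢(W, ℂ)).integrable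
    (integrable_conj hf)
  rw [flip_innerₗ] at hflip
  have h1 : ∀ x, VectorFourier.fourierIntegral Real.fourierChar volume (innerₗ W)
      ((𝓕⁻ φ : 𝓢(W, ℂ)) : W → ℂ) x = φ x := fun x => by
    change 𝓕 ((𝓕⁻ φ : 𝓢(W, ℂ)) : W → ℂ) x = _
    rw [← SchwartzMap.fourier_coe, FourierInvPair.fourier_fourierInv_eq]
  have h2 : ∀ ξ, VectorFourier.fourierIntegral Real.fourierChar volume (innerₗ W)
      (fun x => starRingEnd ℂ (f x)) ξ = starRingEnd ℂ (𝓕 f (-ξ)) := fun ξ => fourier_conj f ξ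
  simp only [h1, h2, schwartz_fourierInv_apply, smul_eq_mul] at hflip
  rw [hflip, ← integral_neg_eq_self fun ξ => (𝓕 φ : 𝓢(W, ℂ)) ξ * starRingEnd ℂ (𝓕 f ξ)]

end Plancherel

theorem integral_fourier_snocE {d : ℕ} (ψ : 𝓢(RSpace (d + 1), ℂ)) :
    (fun ξ => ∫ η, (𝓕 ψ : 𝓢(RSpace (d + 1), ℂ)) (snocE ξ η)) =ᵐ[volume]
      (𝓕 (restrictCLM d ψ) : 𝓢(RSpace d, ℂ)) := by
  refine (fourierInv_restrict_fourier (𝓕 ψ)).symm.trans (Filter.Eventually.of_forall fun ξ => ?_)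
  rw [schwartz_fourierInv_apply, SchwartzMap.fourier_coe, SchwartzMap.fourier_coe, Real.fourier_eq,
    Real.fourier_eq, ← integral_neg_eq_self]
  refine integral_congr_ae (Filter.Eventually.of_forall fun y => ?_)
  have : restrictCLM d (𝓕 (𝓕 ψ)) (-y) = restrictCLM d ψ y := by
    change (𝓕 (𝓕 ψ) : 𝓢(RSpace (d + 1), ℂ)) (incl d (-y)) = ψ (incl d y)
    rw [map_neg, ← schwartz_fourierInv_apply, FourierPair.fourierInv_fourier_eq]
  simp only [this, inner_neg_left, inner_neg_right, neg_neg]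

/-! ### Schwartz functions with the dual parameter as vectors of the complementary series. -/

section DualVectors

variable {d : ℕ} {lam : ℝ}

theorem integrable_rpow_mul_schwartz_sq (h1 : (d : ℝ) / 2 < lam) (h2 : lam < d)
    (φ : 𝓢(RSpace d, ℂ)) : Integrable fun ξ => ‖ξ‖ ^ (2 * lam - d) * ‖φ ξ‖ ^ 2 := by
  obtain ⟨B, hB⟩ : ∃ B : ℝ, ∀ ξ, ‖φ ξ‖ ≤ B := ⟨_, fun ξ => SchwartzMap.norm_le_seminorm ℂ φ ξ⟩
  have hi := ((φ.integrable_pow_mul volume 0).add (φ.integrable_pow_mul volume d)).const_mul B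
  refine hi.mono' ?_ (Filter.Eventually.of_forall fun ξ => ?_)
  · exact (measurable_norm.pow_const _).aestronglyMeasurable.mul
      (φ.continuous.norm.pow 2).aestronglyMeasurable
  rw [Real.norm_of_nonneg (by positivity), Pi.add_apply, pow_zero, one_mul]
  have hB0 : 0 ≤ B := (norm_nonneg _).trans (hB 0)
  have h3 : ‖ξ‖ ^ (2 * lam - d) ≤ 1 + ‖ξ‖ ^ d := by
    rcases le_total ‖ξ‖ 1 with h | h
    · have := Real.rpow_le_one (norm_nonneg ξ) h (by linarith : 0 ≤ 2 * lam - d)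
      have : 0 ≤ ‖ξ‖ ^ d := by positivity
      linarith
    · have : ‖ξ‖ ^ (2 * lam - d) ≤ ‖ξ‖ ^ (d : ℝ) :=
        Real.rpow_le_rpow_of_exponent_le h (by linarith)
      rw [Real.rpow_natCast] at this
      linarith
  calc _ ≤ (1 + ‖ξ‖ ^ d) * (‖φ ξ‖ * B) := by
        rw [pow_two]; gcongr; exact hB ξ
    _ = _ := by ring

variable [NeZero d]

theorem memLp_dualVec (h1 : (d : ℝ) / 2 < lam) (h2 : lam < d) (φ : 𝓢(RSpace d, ℂ)) :
    MemLp (fun ξ => ((‖ξ‖ ^ (2 * lam - d) : ℝ) : ℂ) * (𝓕 φ : 𝓢(RSpace d, ℂ)) ξ) 2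
      (csMeasure d lam) := by
  refine memLp_csMeasure ?_ ?_
  · exact (Complex.measurable_ofReal.comp (measurable_norm.pow_const _)).aestronglyMeasurable.mul
      (𝓕 φ : 𝓢(RSpace d, ℂ)).continuous.aestronglyMeasurable
  · refine (integrable_rpow_mul_schwartz_sq h1 h2 (𝓕 φ)).congr ?_
    filter_upwards [ae_norm_pos (W := RSpace d)] with ξ hξ
    have e : ‖ξ‖ ^ ((d : ℝ) - 2 * lam) * ‖ξ‖ ^ (2 * lam - d) = 1 := by
      rw [← Real.rpow_add hξ]; simp
    rw [norm_mul, Complex.norm_real, Real.norm_of_nonneg (by positivity)]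
    linear_combination -(‖ξ‖ ^ (2 * lam - d) * ‖(𝓕 φ : 𝓢(RSpace d, ℂ)) ξ‖ ^ 2) * e

/-- The vector which represents the antilinear functional `v ↦ ∫ 𝓕 φ · conj v`. -/
noncomputable def dualVec (h1 : (d : ℝ) / 2 < lam) (h2 : lam < d) (φ : 𝓢(RSpace d, ℂ)) :
    CSpace d lam := (memLp_dualVec h1 h2 φ).toLp

theorem inner_dualVec (h1 : (d : ℝ) / 2 < lam) (h2 : lam < d) (φ : 𝓢(RSpace d, ℂ))
    (v : CSpace d lam) : inner ℂ v (dualVec h1 h2 φ) =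
      ∫ ξ, (𝓕 φ : 𝓢(RSpace d, ℂ)) ξ * starRingEnd ℂ (v ξ) := by
  rw [inner_cspace]
  refine integral_congr_ae ?_
  filter_upwards [ae_norm_pos (W := RSpace d), (absolutelyContinuous_csMeasure d lam).ae_eq
    (memLp_dualVec h1 h2 φ).coeFn_toLp] with ξ hξ hφ
  have e : ((‖ξ‖ ^ ((d : ℝ) - 2 * lam) : ℝ) : ℂ) * ((‖ξ‖ ^ (2 * lam - d) : ℝ) : ℂ) = 1 := by
    rw [← Complex.ofReal_mul, ← Real.rpow_add hξ]; simp
  rw [dualVec, hφ]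
  linear_combination (𝓕 φ : 𝓢(RSpace d, ℂ)) ξ * starRingEnd ℂ (v ξ) * e

theorem inner_csFourier_dualVec (h1 : (d : ℝ) / 2 < lam) (h2 : lam < d) (φ : 𝓢(RSpace d, ℂ))
    (f : DecaySpace d lam) : inner ℂ (csFourier h1 h2 f) (dualVec h1 h2 φ) =
      ∫ x, φ x * starRingEnd ℂ ((f : RSpace d → ℂ) x) := by
  rw [inner_dualVec, ← integral_fourier_mul_conj_fourier φ (DecaySpace.integrable h1 f.2)]
  refine integral_congr_ae ?_
  filter_upwards [csFourier_coe h1 h2 f] with ξ hξ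
  rw [hξ]

/-- The bilinear pairing of `π_mu` and `π_lam`, for `lam + mu = d`, is invariant. -/
theorem integral_mul_conj_principalAct {mu : ℝ} (hlm : lam + mu = d) (h : SO0 d)
    (g f : RSpace d → ℂ) :
    ∫ x, g x * starRingEnd ℂ (principalAct lam h f x) =
      ∫ x, principalAct mu h⁻¹ g x * starRingEnd ℂ (f x) := by
  rw [← integral_confPoint h fun x => principalAct mu h⁻¹ g x * starRingEnd ℂ (f x)]
  refine integral_congr_ae ?_
  filter_upwards [ae_confFactor_ne h] with x hx
  have ht := confFactor_pos hx
  simp only [principalAct, confPoint_inv_confPoint hx, map_mul, Complex.conj_ofReal,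
    Complex.real_smul]
  have e : (confFactor h x) ^ (-lam) =
      confFactor h x ^ (-(d : ℝ)) * confFactor h⁻¹ (confPoint h x) ^ (-mu) := by
    rw [eq_inv_of_mul_eq_one_right (confFactor_inv_confPoint hx), Real.inv_rpow ht.le,
      ← Real.rpow_neg ht.le, ← Real.rpow_add ht]
    congr 1; linarith
  rw [e]; push_cast; ring

/-- Integration pairs π_mu and π_lam invariantly when lam + mu = d, so the vector representing φ
transforms as φ does under π_mu. The transformed function has to be Schwartz again, which is
achieved later by cutting off. -/
theorem compSeries_inv_dualVec (h1 : (d : ℝ) / 2 < lam) (h2 : lam < d) {mu : ℝ}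
    (hlm : lam + mu = d) (h : SO0 d) {φ ψ : 𝓢(RSpace d, ℂ)}
    (hψ : (ψ : RSpace d → ℂ) = principalAct mu h φ) :
    compSeries d lam h (dualVec h1 h2 φ) = dualVec h1 h2 ψ := by
  have h0 : 0 < lam := lt_of_le_of_lt (by positivity) h1
  refine inner_eq_of_test h1 h2 fun f _ => ?_
  rw [← LinearIsometryEquiv.inner_map_map (compSeries d lam h⁻¹)]
  have e : compSeries d lam h⁻¹ (compSeries d lam h (dualVec h1 h2 φ)) = dualVec h1 h2 φ := by
    change (compSeries d lam h⁻¹ * compSeries d lam h) _ = _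
    rw [← map_mul]; simp
  rw [e, compSeries_csFourier h1 h2 h0, inner_csFourier_dualVec, inner_csFourier_dualVec, hψ]
  have := integral_mul_conj_principalAct hlm h⁻¹ φ f
  rw [inv_inv] at this
  exact this

end DualVectors

/-- Only test functions supported in U are used, since outside U the functions may fail to be
continuous. -/
theorem eqOn_of_integral_test_eq {W : Type*} [NormedAddCommGroup W] [InnerProductSpace ℝ W]
    [FiniteDimensional ℝ W] [MeasurableSpace W] [BorelSpace W] {U : Set W} (hU : IsOpen U)
    {a b : W → ℂ} (ha : ContinuousOn a U) (hb : ContinuousOn b U)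
    (h : ∀ g : W → ℝ, ContDiff ℝ ∞ g → HasCompactSupport g →
      ∫ x, a x * (g x : ℂ) = ∫ x, b x * (g x : ℂ)) : Set.EqOn a b U := by
  have hint : ∀ c : W → ℂ, ContinuousOn c U → ∀ g : W → ℝ, ContDiff ℝ ∞ g → HasCompactSupport g →
      tsupport g ⊆ U → Integrable fun x => c x * (g x : ℂ) := by
    intro c hc g hg hs hgU
    refine (integrableOn_iff_integrable_of_support_subset (s := tsupport g) ?_).1
      (ContinuousOn.integrableOn_compact hs ((hc.mono hgU).mul
        (Complex.continuous_ofReal.comp hg.continuous).continuousOn))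
    intro x hx
    refine subset_tsupport g fun h0 => hx ?_
    simp [h0]
  have hae := hU.ae_eq_zero_of_integral_contDiff_smul_eq_zero (μ := volume)
    ((ha.sub hb).locallyIntegrableOn hU.measurableSet) fun g hg hs hgU => by
      have h1 := integral_sub (hint a ha g hg hs hgU) (hint b hb g hg hs hgU)
      rw [h g hg hs, sub_self] at h1
      rw [← h1]
      refine integral_congr_ae (Filter.Eventually.of_forall fun x => ?_)
      simp only [Pi.sub_apply, Complex.real_smul]
      ring
  refine Measure.eqOn_open_of_ae_eq (μ := volume) ?_ hU ha hb
  refine (ae_restrict_iff' hU.measurableSet).2 ?_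
  filter_upwards [hae] with x hx hxU
  exact sub_eq_zero.1 (hx hxU)

theorem continuousOn_principalAct {d : ℕ} (lam : ℝ) (h : SO0 d) {f : RSpace d → ℂ}
    (hf : Continuous f) : ContinuousOn (principalAct lam h f) {x | confFactor h x ≠ 0} := by
  intro x hx
  refine ContinuousAt.continuousWithinAt ?_
  refine (Complex.continuous_ofReal.continuousAt.comp
    ((contDiff_confFactor h).continuous.continuousAt.rpow_const (Or.inl hx))).mul ?_
  exact ContinuousAt.comp (g := f) hf.continuousAt (contDiffAt_confPoint hx).continuousAt

/-! ### From equivariance in Hilbert space to intertwining of differential operators. -/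

section WeakIntertwining

variable {d j : ℕ} [NeZero d] {mu lam lam' : ℝ}

/-- The adjoint of the multiplication is the differential operator followed by restriction:
integrating over η on the Fourier side restricts to the hyperplane. The coefficients are real, so
that conjugation leaves the symbol unchanged. -/
theorem inner_breakMul_dualVec (H : BreakParams d j mu lam lam') (p : ℕ → ℝ)
    (φ : 𝓢(RSpace (d + 1), ℂ)) (f : DecaySpace d lam') :
    (2 * Real.pi * Complex.I) ^ j * inner ℂ (breakMul H (fun k => (p k : ℂ))
      (csFourier H.half_lt' H.lt' f)) (dualVec H.half_lt H.lt φ) =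
      ∫ y, diffOpFun j (fun k => (p k : ℂ)) φ (incl d y) *
        starRingEnd ℂ ((f : RSpace d → ℂ) y) := by
  obtain ⟨ψ, hψ, hF⟩ := isSchwartzMultiplier_diffOpFun j (fun k => (p k : ℂ)) φ
  rw [← hψ]
  have h1 : ∫ y, ψ (incl d y) * starRingEnd ℂ ((f : RSpace d → ℂ) y) =
      ∫ ξ, (𝓕 (restrictCLM d ψ) : 𝓢(RSpace d, ℂ)) ξ *
        starRingEnd ℂ (𝓕 (f : RSpace d → ℂ) ξ) :=
    (integral_fourier_mul_conj_fourier (restrictCLM d ψ)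
      (DecaySpace.integrable H.half_lt' f.2)).symm
  have hsym : ∀ ζ, starRingEnd ℂ (symb j (fun k => (p k : ℂ)) ζ) =
      symb (d := d) j (fun k => (p k : ℂ)) ζ := by
    intro ζ
    simp [symb]
  rw [inner_dualVec, ← integral_const_mul]
  have hae : (fun ζ => (𝓕 ψ : 𝓢(RSpace (d + 1), ℂ)) ζ *
      starRingEnd ℂ (𝓕 (f : RSpace d → ℂ) (projE d ζ))) =ᵐ[volume]
      fun ζ => (2 * Real.pi * Complex.I) ^ j * ((𝓕 φ : 𝓢(RSpace (d + 1), ℂ)) ζ *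
        starRingEnd ℂ (breakMul H (fun k => (p k : ℂ)) (csFourier H.half_lt' H.lt' f) ζ)) := by
    filter_upwards [breakMul_coe H (fun k => (p k : ℂ)) (csFourier H.half_lt' H.lt' f),
      (quasiMeasurePreserving_projE d).ae (csFourier_coe H.half_lt' H.lt' f)] with ζ e1 e2
    rw [e1, e2, hF, symb_two_pi_I, map_mul, hsym]
    ring
  rw [← integral_congr_ae hae, integral_split, h1]
  · refine integral_congr_ae ?_
    filter_upwards [integral_fourier_snocE ψ] with ξ hξ
    simp only [projE_snocE]
    rw [integral_mul_const, hξ]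
  · refine (𝓕 ψ : 𝓢(RSpace (d + 1), ℂ)).integrable.mul_bdd (c := ∫ x, ‖(f : RSpace d → ℂ) x‖) ?_
      (Filter.Eventually.of_forall fun ζ => ?_)
    · have := (continuous_fourier (DecaySpace.integrable H.half_lt' f.2)).comp (projE d).continuous
      exact (Complex.continuous_conj.comp this).aestronglyMeasurable
    · rw [RCLike.norm_conj]
      exact norm_fourier_le _ _

/-- The differential operator with the unnormalized coefficients. -/
noncomputable abbrev breakOp (d : ℕ) (mu : ℝ) (j : ℕ) (f : RSpace (d + 1) → ℂ) :
    RSpace (d + 1) → ℂ :=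
  diffOpFun j (fun k => (breakCoeff (breakNu d mu) j k : ℂ)) f

/-- Both sides have the same integrals against conjugated functions of `DecaySpace`, by equivariance
of the multiplication and the invariant pairing of π_{mu+j} and π_lam'. Continuity away from the
point sent to infinity upgrades this to equality at y. -/
theorem breakOp_schwartz (H : BreakParams d j mu lam lam') (h : SO0 d)
    {φ ψ : 𝓢(RSpace (d + 1), ℂ)}
    (hψ : (ψ : RSpace (d + 1) → ℂ) = principalAct mu (extendSO0 d h) φ) (y : RSpace d)
    (hy : confFactor h y ≠ 0) :
    breakOp d mu j ψ (incl d y) =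
      principalAct (mu + j) h (fun z => breakOp d mu j φ (incl d z)) y := by
  have h0 : 0 < lam := lt_of_le_of_lt (by positivity) H.half_lt
  have h0' : 0 < lam' := lt_of_le_of_lt (by positivity) H.half_lt'
  obtain ⟨φ', hφ', -⟩ := isSchwartzMultiplier_diffOpFun j
    (fun k => (breakCoeff (breakNu d mu) j k : ℂ)) φ
  obtain ⟨ψ', hψ', -⟩ := isSchwartzMultiplier_diffOpFun j
    (fun k => (breakCoeff (breakNu d mu) j k : ℂ)) ψ
  set u : RSpace d → ℂ := fun y => breakOp d mu j ψ (incl d y) with hu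
  set w : RSpace d → ℂ := fun z => breakOp d mu j φ (incl d z) with hw
  have huc : Continuous u := by
    simp only [hu, breakOp, ← hψ']; exact ψ'.continuous.comp (incl d).continuous
  have hwc : Continuous w := by
    simp only [hw, breakOp, ← hφ']; exact φ'.continuous.comp (incl d).continuous
  have key : ∀ f : DecaySpace d lam', ∫ y, u y * starRingEnd ℂ ((f : RSpace d → ℂ) y) =
      ∫ y, principalAct (mu + j) h w y * starRingEnd ℂ ((f : RSpace d → ℂ) y) := by
    intro f
    rw [hu, ← inner_breakMul_dualVec H _ ψ f, ← compSeries_inv_dualVec H.half_lt H.lt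
      (by have := H.lam_add; push_cast; linarith) (extendSO0 d h) hψ]
    -- Write f as h applied to h⁻¹ f, so that the group element stands on both arguments and
    -- unitarity removes it.
    have e : breakMul H (fun k => (breakCoeff (breakNu d mu) j k : ℂ))
        (csFourier H.half_lt' H.lt' f) = compSeries (d + 1) lam (extendSO0 d h)
          (breakMul H (fun k => (breakCoeff (breakNu d mu) j k : ℂ))
            (csFourier H.half_lt' H.lt' (decayAct h0' h⁻¹ f))) := by
      rw [← breakMul_compSeries, ← compSeries_csFourier H.half_lt' H.lt' h0']
      congr 1
      change _ = (compSeries d lam' h * compSeries d lam' h⁻¹) _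
      rw [← map_mul]; simp
    rw [e, LinearIsometryEquiv.inner_map_map, inner_breakMul_dualVec H _ φ]
    have := integral_mul_conj_principalAct H.lam_add' h⁻¹ w f
    rw [inv_inv] at this
    exact this
  refine eqOn_of_integral_test_eq (isOpen_confFactor_ne h) huc.continuousOn
    (continuousOn_principalAct (mu + j) h hwc) (fun g hg hs => ?_) hy
  have := key (testDecay lam' (f := fun x => (g x : ℂ)) (Complex.ofRealCLM.contDiff.comp hg)
    (hs.comp_left (g := fun r : ℝ => (r : ℂ)) Complex.ofReal_zero))
  simpa [testDecay] using this

end WeakIntertwining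

/-! ### Differential operators depend only on germs. -/

section Locality

variable {m : ℕ}

theorem pderivFun_congr {f g : RSpace m → ℂ} {x : RSpace m} (h : f =ᶠ[nhds x] g) (i : Fin m) :
    pderivFun i f =ᶠ[nhds x] pderivFun i g := by
  filter_upwards [h.eventuallyEq_nhds] with y hy using hy.lineDeriv_eq

theorem iterate_congr {T : (RSpace m → ℂ) → RSpace m → ℂ} {x : RSpace m}
    (hT : ∀ f g : RSpace m → ℂ, f =ᶠ[nhds x] g → T f =ᶠ[nhds x] T g) {f g : RSpace m → ℂ}
    (h : f =ᶠ[nhds x] g) (n : ℕ) : T^[n] f =ᶠ[nhds x] T^[n] g := by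
  induction n with
  | zero => exact h
  | succ n ih => rw [Function.iterate_succ_apply', Function.iterate_succ_apply']; exact hT _ _ ih

theorem horLapFun_congr {d : ℕ} {f g : RSpace (d + 1) → ℂ} {x : RSpace (d + 1)}
    (h : f =ᶠ[nhds x] g) : horLapFun f =ᶠ[nhds x] horLapFun g := by
  have h1 : ∀ᶠ y in nhds x, ∀ i : Fin d, pderivFun i.castSucc (pderivFun i.castSucc f) y =
      pderivFun i.castSucc (pderivFun i.castSucc g) y :=
    Filter.eventually_all.2 fun i => pderivFun_congr (pderivFun_congr h _) _
  filter_upwards [h1] with y hy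
  simp only [horLapFun, Finset.sum_apply, hy]

theorem diffOpFun_congr {d j : ℕ} (C : ℕ → ℂ) {f g : RSpace (d + 1) → ℂ} {x : RSpace (d + 1)}
    (h : f =ᶠ[nhds x] g) : diffOpFun j C f x = diffOpFun j C g x := by
  simp only [diffOpFun, Finset.sum_apply, Pi.smul_apply]
  refine Finset.sum_congr rfl fun k _ => ?_
  rw [(iterate_congr (fun f g h => pderivFun_congr h _)
    (iterate_congr (fun f g h => horLapFun_congr h) h k) (j - 2 * k)).eq_of_nhds]

end Locality

/-! ### Intertwining on smooth functions. -/

section Intertwining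

theorem IsSmoothVector.contDiff {d : ℕ} {mu : ℝ} {f : RSpace d → ℂ} (hf : IsSmoothVector mu f) :
    ContDiff ℝ ∞ f := by
  obtain ⟨φ, hφ, h⟩ := hf
  have e : f = fun x => ((((1 + ‖x‖ ^ 2) / 2) ^ (-mu) : ℝ) : ℂ) *
      φ (WithLp.toLp 2 fun i : Fin (d + 1) =>
        coneVec x (Sum.inl i) / coneVec x (Sum.inr 0)) := funext h
  rw [e]
  refine ContDiff.mul (Complex.ofRealCLM.contDiff.comp ?_) (hφ.comp ?_)
  · refine ContDiff.rpow_const_of_ne ?_ fun x => by positivity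
    exact ((contDiff_const.add (contDiff_norm_sq ℝ)).div_const 2)
  · rw [contDiff_euclidean]
    intro i
    exact (contDiff_coneVec _).div (contDiff_coneVec _) fun x => (coneVec_time_pos x).ne'

/-- `principalAct` preserves test functions with support in the domain of the conformal map. -/
theorem contDiff_principalAct_of_test {d : ℕ} {lam : ℝ} (hlam : lam ≠ 0) (h : SO0 d)
    {g : RSpace d → ℂ}
    (hg : ContDiff ℝ ∞ g) (hs : HasCompactSupport g)
    (hsub : tsupport g ⊆ {x | confFactor h⁻¹ x ≠ 0}) :
    ContDiff ℝ ∞ (principalAct lam h g) ∧ HasCompactSupport (principalAct lam h g) := by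
  set S := confPoint h⁻¹ '' tsupport g with hS
  have hSc : IsCompact S := by
    refine IsCompact.image_of_continuousOn hs fun x hx => ?_
    exact (contDiffAt_confPoint (hsub hx)).continuousAt.continuousWithinAt
  have hSt : ∀ x ∈ S, confFactor h x ≠ 0 := by
    rintro _ ⟨x, hx, rfl⟩
    have := confFactor_inv_confPoint_ne (hsub hx)
    rwa [inv_inv] at this
  have h0 : ∀ x, x ∉ S → principalAct lam h g x = 0 := by
    intro x hx
    by_cases ht : confFactor h x = 0
    · rw [principalAct, ht, Real.zero_rpow (neg_ne_zero.2 hlam)]; simp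
    · have : confPoint h x ∉ tsupport g := fun hg => hx ⟨_, hg, confPoint_inv_confPoint ht⟩
      rw [principalAct, image_eq_zero_of_notMem_tsupport this, mul_zero]
  refine ⟨contDiff_iff_contDiffAt.2 fun x => ?_, HasCompactSupport.intro hSc h0⟩
  by_cases hx : x ∈ S
  · have ht := hSt x hx
    exact (Complex.ofRealCLM.contDiff.contDiffAt.comp x
      ((contDiff_confFactor h).contDiffAt.rpow_const_of_ne ht)).mul
      (hg.contDiffAt.comp x (contDiffAt_confPoint ht))
  · refine contDiffAt_const (c := (0 : ℂ)) |>.congr_of_eventuallyEq ?_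
    filter_upwards [hSc.isClosed.isOpen_compl.mem_nhds hx] with y hy using h0 y hy

/-- At y only the germ of f at z = h⁻¹(y, 0) matters. A cutoff of f near z, with support away from
the point that h sends to infinity, is a test function whose transform is a test function too, and
`breakOp_schwartz` applies to it. -/
theorem breakOp_intertwines {d j : ℕ} [NeZero d] {mu lam lam' : ℝ}
    (H : BreakParams d j mu lam lam') (h : SO0 d) {f : RSpace (d + 1) → ℂ}
    (hf : ContDiff ℝ ∞ f) (y : RSpace d) (hy : confFactor h y ≠ 0) :
    breakOp d mu j (principalAct mu (extendSO0 d h) f) (incl d y) =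
      principalAct (mu + j) h (fun z => breakOp d mu j f (incl d z)) y := by
  set h' := extendSO0 d h with hh'
  have hy' : confFactor h' (incl d y) ≠ 0 := by rwa [hh', confFactor_extend_incl]
  set z := confPoint h' (incl d y) with hz
  have hU := isOpen_confFactor_ne h'⁻¹
  have hzU : confFactor h'⁻¹ z ≠ 0 := confFactor_inv_confPoint_ne hy'
  obtain ⟨ε, hε, hεU⟩ := Metric.isOpen_iff.1 hU z hzU
  let b : ContDiffBump z := ⟨ε / 4, ε / 2, by positivity, by linarith⟩
  set g : RSpace (d + 1) → ℂ := fun x => (b x : ℂ) * f x with hg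
  have hgc : ContDiff ℝ ∞ g := (Complex.ofRealCLM.contDiff.comp b.contDiff).mul hf
  have hbs : HasCompactSupport fun x => (b x : ℂ) :=
    b.hasCompactSupport.comp_left (g := fun r : ℝ => (r : ℂ)) Complex.ofReal_zero
  have hgs : HasCompactSupport g := hbs.mul_right
  have hsub : tsupport g ⊆ {x | confFactor h'⁻¹ x ≠ 0} := by
    have h1 : tsupport g ⊆ tsupport b := by
      refine closure_mono fun x hx h0 => hx ?_
      simp [hg, h0]
    refine (h1.trans b.tsupport_eq.subset).trans ((Metric.closedBall_subset_ball ?_).trans hεU)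
    show ε / 2 < ε
    linarith
  obtain ⟨hc, hcs⟩ := contDiff_principalAct_of_test H.mu_pos.ne' h' hgc hgs hsub
  have key := breakOp_schwartz H h (φ := hgs.toSchwartzMap hgc) (ψ := hcs.toSchwartzMap hc) rfl y hy
  have hgf : g =ᶠ[nhds z] f := by
    filter_upwards [b.eventuallyEq_one] with x hx
    simp [hg, hx]
  have hρ : principalAct mu h' g =ᶠ[nhds (incl d y)] principalAct mu h' f := by
    have := (contDiffAt_confPoint hy').continuousAt.eventually hgf
    filter_upwards [this] with x hx
    simp only [principalAct, hx]
  have e1 := diffOpFun_congr (j := j) (fun k => (breakCoeff (breakNu d mu) j k : ℂ)) hρ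
  have e2 := diffOpFun_congr (j := j) (fun k => (breakCoeff (breakNu d mu) j k : ℂ)) hgf
  rw [breakOp, ← e1]
  refine key.trans ?_
  simp only [principalAct]
  congr 1
  rw [hz, hh', confPoint_extend_incl] at e2
  exact e2

end Intertwining

/-! ### A conformal inversion in the identity component. -/

section PlaneRotation

variable {d : ℕ} [NeZero d]

/-- The second space coordinate. -/
def secondIdx (d : ℕ) [NeZero d] : LIdx d := Sum.inl (Fin.succ 0)

/-- The projection to the plane of the first two space coordinates. -/
def planeProj (d : ℕ) [NeZero d] : Matrix (LIdx d) (LIdx d) ℝ :=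
  Matrix.single (Sum.inl 0) (Sum.inl 0) 1 + Matrix.single (secondIdx d) (secondIdx d) 1

/-- The infinitesimal rotation of the plane of the first two space coordinates. -/
def planeSkew (d : ℕ) [NeZero d] : Matrix (LIdx d) (LIdx d) ℝ :=
  Matrix.single (secondIdx d) (Sum.inl 0) 1 - Matrix.single (Sum.inl 0) (secondIdx d) 1

theorem inl_zero_ne_secondIdx : (Sum.inl 0 : LIdx d) ≠ secondIdx d := by
  simp only [secondIdx, ne_eq, Sum.inl.injEq]
  exact (Fin.succ_ne_zero _).symm

theorem planeProj_mul_self : planeProj d * planeProj d = planeProj d := by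
  have h := inl_zero_ne_secondIdx (d := d)
  simp [planeProj, mul_add, add_mul, Matrix.single_mul_single_of_ne, h, h.symm]

theorem planeSkew_mul_self : planeSkew d * planeSkew d = -planeProj d := by
  have h := inl_zero_ne_secondIdx (d := d)
  simp [planeProj, planeSkew, mul_sub, sub_mul, Matrix.single_mul_single_of_ne, h, h.symm]
  abel

theorem planeProj_mul_planeSkew : planeProj d * planeSkew d = planeSkew d := by
  have h := inl_zero_ne_secondIdx (d := d)
  simp [planeProj, planeSkew, mul_sub, add_mul, Matrix.single_mul_single_of_ne, h, h.symm]

theorem planeSkew_mul_planeProj : planeSkew d * planeProj d = planeSkew d := by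
  have h := inl_zero_ne_secondIdx (d := d)
  simp [planeProj, planeSkew, mul_add, sub_mul, Matrix.single_mul_single_of_ne, h, h.symm]
  abel

/-- The rotation by `θ` in the plane of the first two space coordinates. -/
noncomputable def rotMat (d : ℕ) [NeZero d] (θ : ℝ) : Matrix (LIdx d) (LIdx d) ℝ :=
  1 + (Real.cos θ - 1) • planeProj d + Real.sin θ • planeSkew d

theorem rotMat_mul (a b : ℝ) : rotMat d a * rotMat d b = rotMat d (a + b) := by
  simp only [rotMat, mul_add, add_mul, one_mul, mul_one, Matrix.smul_mul, Matrix.mul_smul,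
    planeProj_mul_self, planeSkew_mul_self, planeProj_mul_planeSkew, planeSkew_mul_planeProj,
    Real.cos_add, Real.sin_add]
  module

theorem transpose_rotMat (θ : ℝ) : (rotMat d θ)ᵀ = rotMat d (-θ) := by
  simp only [rotMat, planeProj, planeSkew, Matrix.transpose_add, Matrix.transpose_smul,
    Matrix.transpose_sub, Matrix.transpose_single, Matrix.transpose_one, Real.cos_neg, Real.sin_neg]
  module

theorem rotMat_zero : rotMat d 0 = 1 := by simp [rotMat]

theorem rotMat_form (θ : ℝ) :
    LieAlgebra.Orthogonal.indefiniteDiagonal (Fin (d + 1)) (Fin 1) ℝ * rotMat d θ =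
      rotMat d θ * LieAlgebra.Orthogonal.indefiniteDiagonal (Fin (d + 1)) (Fin 1) ℝ := by
  have h : ∀ i k : Fin (d + 1), LieAlgebra.Orthogonal.indefiniteDiagonal (Fin (d + 1)) (Fin 1) ℝ *
      Matrix.single (Sum.inl i) (Sum.inl k) 1 = Matrix.single (Sum.inl i) (Sum.inl k) 1 *
      LieAlgebra.Orthogonal.indefiniteDiagonal (Fin (d + 1)) (Fin 1) ℝ := by
    intro i k
    ext a b
    rw [LieAlgebra.Orthogonal.indefiniteDiagonal, Matrix.diagonal_mul, Matrix.mul_diagonal]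
    simp only [Matrix.single_apply]
    split_ifs with hab
    · rw [← hab.1, ← hab.2]; simp
    · simp
  simp only [rotMat, planeProj, planeSkew, secondIdx, mul_add, add_mul, mul_sub, sub_mul,
    Matrix.mul_smul, Matrix.smul_mul, h, mul_one, one_mul]

/-- The square of the determinant at half the angle, and this square is 1 because the transpose is
the inverse. -/
theorem det_rotMat (θ : ℝ) : (rotMat d θ).det = 1 := by
  have h1 : rotMat d θ = rotMat d (θ / 2) * rotMat d (θ / 2) := by rw [rotMat_mul, add_halves]
  have h2 : (rotMat d (θ / 2)).det * (rotMat d (θ / 2)).det = 1 := by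
    have := congrArg Matrix.det (rotMat_mul (d := d) (-(θ / 2)) (θ / 2))
    rwa [Matrix.det_mul, ← transpose_rotMat, Matrix.det_transpose, neg_add_cancel, rotMat_zero,
      Matrix.det_one] at this
  rw [h1, Matrix.det_mul, h2]

/-- The rotations as elements of `SO(d+1,1)`. -/
noncomputable def rotSO (d : ℕ) [NeZero d] (θ : ℝ) : lorentzSO d :=
  ⟨⟨rotMat d θ, det_rotMat θ⟩, mem_lorentzSO.2 <| by
    change (rotMat d θ)ᵀ * _ * rotMat d θ = _
    rw [Matrix.mul_assoc, rotMat_form, ← Matrix.mul_assoc, transpose_rotMat, rotMat_mul,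
      neg_add_cancel, rotMat_zero, one_mul]⟩

theorem continuous_rotSO : Continuous (rotSO d) := by
  refine Continuous.subtype_mk (Continuous.subtype_mk ?_ _) _
  unfold rotMat
  fun_prop

/-- The rotations as elements of `SO₀(d+1,1)`. -/
noncomputable def rotSO0 (d : ℕ) [NeZero d] (θ : ℝ) : SO0 d :=
  ⟨rotSO d θ, by
    have h : IsPreconnected (Set.range (rotSO d)) := isPreconnected_range continuous_rotSO
    have h1 : (1 : lorentzSO d) ∈ Set.range (rotSO d) :=
      ⟨0, Subtype.ext (Subtype.ext rotMat_zero)⟩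
    exact h.subset_connectedComponent h1 ⟨θ, rfl⟩⟩

theorem rotSO0_mat (θ : ℝ) : (rotSO0 d θ).mat = rotMat d θ := rfl

/-- The inversion, up to a rotation. -/
noncomputable def inversion (d : ℕ) [NeZero d] : SO0 d := (rotSO0 d Real.pi)⁻¹

theorem inversion_mulVec (v : LIdx d → ℝ) : ((inversion d)⁻¹).mat *ᵥ v =
    fun i => if i = Sum.inl 0 ∨ i = secondIdx d then -v i else v i := by
  have h := inl_zero_ne_secondIdx (d := d)
  rw [inversion, inv_inv, rotSO0_mat, rotMat, Real.cos_pi, Real.sin_pi, zero_smul, add_zero]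
  ext i
  rw [Matrix.add_mulVec, Matrix.one_mulVec, Matrix.smul_mulVec, planeProj, Matrix.add_mulVec]
  simp only [Pi.add_apply, Pi.smul_apply, Matrix.single_mulVec, smul_eq_mul, one_mul]
  by_cases h1 : i = Sum.inl 0
  · subst h1; simp [h]; ring
  · by_cases h2 : i = secondIdx d
    · subst h2; simp [h.symm]; ring
    · simp [h1, h2]

/-- The sign change of the first coordinate turns (1 - |x|²)/2 + (1 + |x|²)/2 = 1 into |x|². A
second sign is changed as well in order to stay in the identity component. -/
theorem confFactor_inversion (x : RSpace d) : confFactor (inversion d) x = ‖x‖ ^ 2 := by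
  rw [confFactor, movedCone, inversion_mulVec]
  simp [coneVec, secondIdx]
  ring

theorem confFactor_extend_inversion (x : RSpace (d + 1)) :
    confFactor (extendSO0 d (inversion d)) x = ‖x‖ ^ 2 := by
  have h : ∀ i : LIdx d, movedCone (extendSO0 d (inversion d)) x (idxEquiv d (Sum.inl i)) =
      if i = Sum.inl 0 ∨ i = secondIdx d then -coneVec x (idxEquiv d (Sum.inl i)) else
        coneVec x (idxEquiv d (Sum.inl i)) := by
    intro i
    rw [movedCone, ← map_inv, extendSO0_mat, congrFun (extendMat_mulVec_castSucc _ _) i,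
      inversion_mulVec]
  have h1 := h (Sum.inl 0)
  have h2 := h (Sum.inr 0)
  rw [idxEquiv_inl_inl] at h1
  rw [idxEquiv_inl_inr] at h2
  rw [confFactor, h2]
  simp only [Fin.castSucc_zero] at h1
  rw [h1]
  simp [coneVec, secondIdx]
  ring

theorem norm_confPoint_inversion {x : RSpace d} (hx : ‖x‖ = 1) :
    ‖confPoint (inversion d) x‖ = 1 := by
  have h1 : confFactor (inversion d) x = 1 := by rw [confFactor_inversion, hx, one_pow]
  have h2 := congrFun (movedCone_eq (h := inversion d) (x := x) (by rw [h1]; exact one_ne_zero))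
    (Sum.inr 0)
  rw [h1, one_smul, movedCone, inversion_mulVec] at h2
  simp only [secondIdx, coneVec, hx, Sum.elim_inr] at h2
  have h3 : ‖confPoint (inversion d) x‖ ^ 2 = 1 := by simp at h2; linarith
  exact (pow_eq_one_iff_of_nonneg (norm_nonneg _) two_ne_zero).1 h3

end PlaneRotation

/-! ### Derivatives of powers of the last coordinate and of the norm. -/

section PointwiseDerivatives

variable {m d : ℕ}

theorem pderivFun_eqOn {f g : RSpace m → ℂ} {U : Set (RSpace m)} (hU : IsOpen U)
    (h : Set.EqOn f g U) (i : Fin m) : Set.EqOn (pderivFun i f) (pderivFun i g) U := fun _ hx =>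
  (pderivFun_congr (h.eventuallyEq_of_mem (hU.mem_nhds hx)) i).eq_of_nhds

theorem iterate_eqOn {T : (RSpace m → ℂ) → RSpace m → ℂ} {U : Set (RSpace m)}
    (hT : ∀ f g : RSpace m → ℂ, Set.EqOn f g U → Set.EqOn (T f) (T g) U) {f g : RSpace m → ℂ}
    (h : Set.EqOn f g U) (n : ℕ) : Set.EqOn (T^[n] f) (T^[n] g) U := by
  induction n with
  | zero => exact h
  | succ n ih => rw [Function.iterate_succ_apply', Function.iterate_succ_apply']; exact hT _ _ ih

theorem pderivFun_contDiffOn {f : RSpace m → ℂ} {U : Set (RSpace m)} (hU : IsOpen U)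
    (hf : ContDiffOn ℝ ∞ f U) (i : Fin m) : ContDiffOn ℝ ∞ (pderivFun i f) U := by
  have h1 : ContDiffOn ℝ ∞ (fun x => fderiv ℝ f x (unitVec i)) U :=
    (hf.fderiv_of_isOpen hU (by simp)).clm_apply contDiffOn_const
  refine h1.congr fun x hx => ?_
  exact ((hf.differentiableOn (by simp)).differentiableAt (hU.mem_nhds hx)).lineDeriv_eq_fderiv

theorem horLapFun_contDiffOn {f : RSpace (d + 1) → ℂ} {U : Set (RSpace (d + 1))} (hU : IsOpen U)
    (hf : ContDiffOn ℝ ∞ f U) : ContDiffOn ℝ ∞ (horLapFun f) U := by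
  have : horLapFun f = fun x => ∑ i : Fin d, pderivFun i.castSucc (pderivFun i.castSucc f) x := by
    ext x; simp [horLapFun]
  rw [this]
  exact ContDiffOn.sum fun i _ => pderivFun_contDiffOn hU (pderivFun_contDiffOn hU hf _) _

theorem iterate_horLapFun_contDiffOn {f : RSpace (d + 1) → ℂ} {U : Set (RSpace (d + 1))}
    (hU : IsOpen U) (hf : ContDiffOn ℝ ∞ f U) (k : ℕ) : ContDiffOn ℝ ∞ (horLapFun^[k] f) U := by
  induction k with
  | zero => exact hf
  | succ k ih => rw [Function.iterate_succ_apply']; exact horLapFun_contDiffOn hU ih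

theorem pderivFun_castSucc_mul (n : ℕ) (v : RSpace (d + 1) → ℂ) (i : Fin d) :
    pderivFun i.castSucc (fun x => (x (Fin.last d) : ℂ) ^ n * v x) =
      fun x => (x (Fin.last d) : ℂ) ^ n * pderivFun i.castSucc v x := by
  ext x
  have h : ∀ t : ℝ, (x + t • (unitVec i.castSucc : RSpace (d + 1))) (Fin.last d) =
      x (Fin.last d) := fun t => by simp [(Fin.castSucc_lt_last i).ne']
  simp only [pderivFun, lineDeriv, h]
  rw [deriv_const_mul_field]

theorem horLapFun_mul (n : ℕ) (v : RSpace (d + 1) → ℂ) :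
    horLapFun (fun x => (x (Fin.last d) : ℂ) ^ n * v x) =
      fun x => (x (Fin.last d) : ℂ) ^ n * horLapFun v x := by
  ext x
  simp only [horLapFun, Finset.sum_apply, pderivFun_castSucc_mul, Finset.mul_sum]

theorem iterate_horLapFun_mul (n k : ℕ) (v : RSpace (d + 1) → ℂ) :
    horLapFun^[k] (fun x => (x (Fin.last d) : ℂ) ^ n * v x) =
      fun x => (x (Fin.last d) : ℂ) ^ n * horLapFun^[k] v x := by
  induction k with
  | zero => rfl
  | succ k ih =>
    rw [Function.iterate_succ_apply', Function.iterate_succ_apply', ih, horLapFun_mul]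

/-- The normal derivatives of order at most `n` of `x_{d+1}^n v`. -/
theorem iterate_pderiv_last_mul {U : Set (RSpace (d + 1))} (hU : IsOpen U) {x : RSpace (d + 1)}
    (hx : x ∈ U) (hx0 : x (Fin.last d) = 0) (l : ℕ) : ∀ (n : ℕ) (v : RSpace (d + 1) → ℂ), l ≤ n →
    ContDiffOn ℝ ∞ v U → (pderivFun (Fin.last d))^[l] (fun x => (x (Fin.last d) : ℂ) ^ n * v x) x =
      if n = l then (l.factorial : ℂ) * v x else 0 := by
  induction l with
  | zero =>
    intro n v _ _
    simp only [Function.iterate_zero, id_eq, hx0]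
    split_ifs with h
    · subst h; simp
    · simp [h]
  | succ l ih =>
    intro n v hn hv
    obtain ⟨n, rfl⟩ : ∃ k, n = k + 1 := ⟨n - 1, by omega⟩
    -- One normal derivative of x_{d+1}^{n+1} v is x_{d+1}^n v', so a derivative is traded for a
    -- power.
    set v' : RSpace (d + 1) → ℂ := fun x => (n + 1) * v x +
      (x (Fin.last d) : ℂ) * pderivFun (Fin.last d) v x with hv'
    have hcoord : ContDiff ℝ ∞ fun x : RSpace (d + 1) => (x (Fin.last d) : ℂ) :=
      Complex.ofRealCLM.contDiff.comp (by fun_prop)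
    have hv'c : ContDiffOn ℝ ∞ v' U :=
      (contDiffOn_const.mul hv).add (hcoord.contDiffOn.mul (pderivFun_contDiffOn hU hv _))
    have h1 : Set.EqOn (pderivFun (Fin.last d) fun x => (x (Fin.last d) : ℂ) ^ (n + 1) * v x)
        (fun x => (x (Fin.last d) : ℂ) ^ n * v' x) U := by
      intro z hz
      have hd : HasLineDerivAt ℝ v (pderivFun (Fin.last d) v z) z (unitVec (Fin.last d)) :=
        ((hv.differentiableOn (by simp)).differentiableAt
          (hU.mem_nhds hz)).lineDifferentiableAt.hasLineDerivAt
      have hc : HasDerivAt (fun t : ℝ =>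
          (((z + t • (unitVec (Fin.last d) : RSpace (d + 1))) (Fin.last d) : ℝ) : ℂ)) 1 0 := by
        have : (fun t : ℝ => (((z + t • (unitVec (Fin.last d) : RSpace (d + 1))) (Fin.last d) : ℝ) :
            ℂ)) = fun t : ℝ => (z (Fin.last d) : ℂ) + (t : ℂ) := by ext t; simp
        rw [this]
        exact (Complex.ofRealCLM.hasDerivAt (x := 0)).const_add _
      have h2 := (hc.pow (n + 1)).mul hd
      have h3 := h2.deriv
      simp only [pderivFun, lineDeriv]
      refine Eq.trans h3 ?_
      simp [hv', pderivFun, lineDeriv]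
      ring
    rw [Function.iterate_succ_apply, (iterate_eqOn (fun f g h => pderivFun_eqOn hU h _) h1 l) hx,
      ih n v' (by omega) hv'c]
    simp only [Nat.add_right_cancel_iff]
    split_ifs with h
    · subst h
      simp only [hv', hx0, Nat.factorial_succ]
      push_cast; ring
    · rfl

/-- The Laplacian on functions on `ℝ^d`. -/
noncomputable def lapFun (f : RSpace d → ℂ) : RSpace d → ℂ :=
  ∑ i : Fin d, pderivFun i (pderivFun i f)

theorem pderivFun_castSucc_incl (f : RSpace (d + 1) → ℂ) (i : Fin d) :
    (fun y => pderivFun i.castSucc f (incl d y)) = pderivFun i fun y => f (incl d y) := by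
  ext y
  simp only [pderivFun, lineDeriv]
  congr 1
  ext t
  have : incl d (unitVec i) = unitVec i.castSucc := by
    ext k
    induction k using Fin.lastCases with
    | last => simp [(Fin.castSucc_lt_last i).ne]
    | cast k => simp [incl]
  rw [map_add, map_smul, this]

theorem horLapFun_incl (f : RSpace (d + 1) → ℂ) :
    (fun y => horLapFun f (incl d y)) = lapFun fun y => f (incl d y) := by
  ext y
  simp only [horLapFun, lapFun, Finset.sum_apply, ← pderivFun_castSucc_incl]

theorem iterate_horLapFun_incl (k : ℕ) (f : RSpace (d + 1) → ℂ) :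
    (fun y => horLapFun^[k] f (incl d y)) = lapFun^[k] fun y => f (incl d y) := by
  induction k with
  | zero => rfl
  | succ k ih => rw [Function.iterate_succ_apply', Function.iterate_succ_apply', horLapFun_incl, ih]

theorem hasDerivAt_norm_sq_rpow (q : ℝ) (i : Fin d) {y : RSpace d} (hy : y ≠ 0) :
    HasDerivAt (fun t : ℝ => (‖y + t • (unitVec i : RSpace d)‖ ^ 2) ^ (-q))
      (-(2 * q) * (y i * (‖y‖ ^ 2) ^ (-(q + 1)))) 0 := by
  have e : (fun t : ℝ => ‖y + t • (unitVec i : RSpace d)‖ ^ 2) =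
      fun t : ℝ => ‖y‖ ^ 2 + 2 * y i * t + t ^ 2 := by
    ext t
    rw [norm_add_sq_real, inner_smul_right, norm_smul, EuclideanSpace.inner_single_right,
      PiLp.norm_single]
    simp; ring
  have h1 : HasDerivAt (fun t : ℝ => ‖y + t • (unitVec i : RSpace d)‖ ^ 2) (2 * y i) 0 := by
    rw [e]
    have := (((hasDerivAt_id' (0 : ℝ)).const_mul (2 * y i)).const_add (‖y‖ ^ 2)).fun_add
      (hasDerivAt_pow 2 (0 : ℝ))
    simpa using this
  have hr : ‖y + (0 : ℝ) • (unitVec i : RSpace d)‖ ^ 2 ≠ 0 := by simpa using hy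
  have h2 := h1.rpow_const (p := -q) (Or.inl hr)
  convert h2 using 1
  rw [zero_smul, add_zero, neg_add, ← sub_eq_add_neg]
  ring

theorem pderivFun_norm_rpow (q : ℝ) (i : Fin d) {y : RSpace d} (hy : y ≠ 0) :
    pderivFun i (fun y => (((‖y‖ ^ 2) ^ (-q) : ℝ) : ℂ)) y =
      ((-(2 * q) * (y i * (‖y‖ ^ 2) ^ (-(q + 1))) : ℝ) : ℂ) :=
  (hasDerivAt_norm_sq_rpow q i hy).ofReal_comp.deriv

theorem pderivFun_coord_mul_norm_rpow (q : ℝ) (i : Fin d) {y : RSpace d} (hy : y ≠ 0) :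
    pderivFun i (fun y => ((-(2 * q) * (y i * (‖y‖ ^ 2) ^ (-(q + 1))) : ℝ) : ℂ)) y =
      ((-(2 * q) * ((‖y‖ ^ 2) ^ (-(q + 1)) -
        2 * (q + 1) * (y i ^ 2 * (‖y‖ ^ 2) ^ (-(q + 1 + 1)))) : ℝ) : ℂ) := by
  have hc : HasDerivAt (fun t : ℝ => (y + t • (unitVec i : RSpace d)) i) 1 0 := by
    have : (fun t : ℝ => (y + t • (unitVec i : RSpace d)) i) = fun t => y i + t := by ext t; simp
    rw [this]
    exact (hasDerivAt_id _).const_add _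
  have h := ((hc.mul (hasDerivAt_norm_sq_rpow (q + 1) i hy)).const_mul (-(2 * q))).ofReal_comp.deriv
  refine Eq.trans h ?_
  congr 1
  simp only [zero_smul, add_zero]
  ring

theorem lapFun_eqOn {f g : RSpace d → ℂ} {U : Set (RSpace d)} (hU : IsOpen U)
    (h : Set.EqOn f g U) : Set.EqOn (lapFun f) (lapFun g) U := fun x hx => by
  simp only [lapFun, Finset.sum_apply]
  exact Finset.sum_congr rfl fun i _ => pderivFun_eqOn hU (pderivFun_eqOn hU h i) i hx

theorem pderivFun_const_mul (c : ℂ) (f : RSpace d → ℂ) (i : Fin d) :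
    pderivFun i (fun y => c * f y) = fun y => c * pderivFun i f y := by
  ext y
  simp only [pderivFun, lineDeriv]
  rw [deriv_const_mul_field]

theorem lapFun_const_mul (c : ℂ) (f : RSpace d → ℂ) (y : RSpace d) :
    lapFun (fun y => c * f y) y = c * lapFun f y := by
  simp only [lapFun, Finset.sum_apply, pderivFun_const_mul, Finset.mul_sum]

/-- The factor vanishes at q = 0 and is nonzero for 0 < q < d/2 - 1; the uniqueness argument rests
on this contrast. -/
theorem lapFun_norm_rpow (q : ℝ) {y : RSpace d} (hy : y ≠ 0) :
    lapFun (fun y => (((‖y‖ ^ 2) ^ (-q) : ℝ) : ℂ)) y =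
      ((2 * q * (2 * (q + 1) - d) * (‖y‖ ^ 2) ^ (-(q + 1)) : ℝ) : ℂ) := by
  have hU : IsOpen {y : RSpace d | y ≠ 0} := isOpen_ne
  have h1 : ∀ i : Fin d, pderivFun i (pderivFun i fun y => (((‖y‖ ^ 2) ^ (-q) : ℝ) : ℂ)) y =
      ((-(2 * q) * ((‖y‖ ^ 2) ^ (-(q + 1)) -
        2 * (q + 1) * (y i ^ 2 * (‖y‖ ^ 2) ^ (-(q + 1 + 1)))) : ℝ) : ℂ) := fun i => by
    rw [← pderivFun_coord_mul_norm_rpow q i hy]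
    exact pderivFun_eqOn hU (fun z hz => pderivFun_norm_rpow q i hz) i hy
  simp only [lapFun, Finset.sum_apply, h1]
  rw [← Complex.ofReal_sum]
  congr 1
  rw [← Finset.mul_sum, Finset.sum_sub_distrib, ← Finset.mul_sum, ← Finset.sum_mul,
    ← EuclideanSpace.real_norm_sq_eq]
  have hr : ‖y‖ ^ 2 ≠ 0 := by simpa using hy
  have e : ‖y‖ ^ 2 * (‖y‖ ^ 2) ^ (-(q + 1 + 1)) = (‖y‖ ^ 2) ^ (-(q + 1)) := by
    rw [neg_add (q + 1), ← sub_eq_add_neg, Real.rpow_sub_one hr]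
    field_simp
  rw [e]
  simp
  ring

theorem iterate_lapFun_norm_rpow (q : ℝ) (k : ℕ) {y : RSpace d} (hy : y ≠ 0) :
    lapFun^[k] (fun y => (((‖y‖ ^ 2) ^ (-q) : ℝ) : ℂ)) y =
      (((∏ i ∈ Finset.range k, 2 * (q + i) * (2 * (q + i + 1) - d)) : ℝ) : ℂ) *
        (((‖y‖ ^ 2) ^ (-(q + k)) : ℝ) : ℂ) := by
  induction k generalizing y with
  | zero => simp
  | succ k ih =>
    have hU : IsOpen {y : RSpace d | y ≠ 0} := isOpen_ne
    rw [Function.iterate_succ_apply', lapFun_eqOn hU (fun z hz => ih hz) hy, lapFun_const_mul,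
      lapFun_norm_rpow _ hy, Finset.prod_range_succ, ← Complex.ofReal_mul, ← Complex.ofReal_mul]
    congr 1
    push_cast
    rw [← add_assoc q]
    ring

end PointwiseDerivatives

/-! ### Uniqueness of the intertwining coefficients. -/

section Uniqueness

/-- On the hyperplane the terms with i > k have too few normal derivatives to remove the power of
x_{d+1}, and those with i < k have coefficient zero. Such functions isolate one coefficient. -/
theorem diffOpFun_last_pow_mul {d j k : ℕ} {δ : ℕ → ℂ} (hk : 2 * k ≤ j) (hδ : ∀ i < k, δ i = 0)
    {U : Set (RSpace (d + 1))} (hU : IsOpen U) {v : RSpace (d + 1) → ℂ} (hv : ContDiffOn ℝ ∞ v U)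
    {x : RSpace (d + 1)} (hx : x ∈ U) (hx0 : x (Fin.last d) = 0) :
    diffOpFun j δ (fun x => (x (Fin.last d) : ℂ) ^ (j - 2 * k) * v x) x =
      δ k * ((j - 2 * k).factorial * horLapFun^[k] v x) := by
  simp only [diffOpFun, Finset.sum_apply, Pi.smul_apply, smul_eq_mul, iterate_horLapFun_mul]
  rw [Finset.sum_eq_single k]
  · rw [iterate_pderiv_last_mul hU hx hx0 _ _ _ le_rfl (iterate_horLapFun_contDiffOn hU hv k),
      if_pos rfl]
  · intro i hi hik
    have hi' := Finset.mem_range.1 hi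
    rcases lt_or_gt_of_ne hik with h | h
    · rw [hδ i h, zero_mul]
    · rw [iterate_pderiv_last_mul hU hx hx0 _ _ _ (by omega)
        (iterate_horLapFun_contDiffOn hU hv i), if_neg (by omega), mul_zero]
  · intro h
    exact absurd (Finset.mem_range.2 (by omega)) h

theorem iterate_horLapFun_norm_rpow {d : ℕ} (q : ℝ) (k : ℕ) {y : RSpace d} (hy : ‖y‖ = 1) :
    horLapFun^[k] (fun x : RSpace (d + 1) => (((‖x‖ ^ 2) ^ (-q) : ℝ) : ℂ)) (incl d y) =
      ((∏ i ∈ Finset.range k, 2 * (q + i) * (2 * (q + i + 1) - d) : ℝ) : ℂ) := by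
  have hy0 : y ≠ 0 := by rintro rfl; simp at hy
  have h := congrFun (iterate_horLapFun_incl k
    fun x : RSpace (d + 1) => (((‖x‖ ^ 2) ^ (-q) : ℝ) : ℂ)) y
  simp only [LinearIsometry.norm_map] at h
  rw [h, iterate_lapFun_norm_rpow q k hy0, hy]
  simp

theorem contDiffOn_norm_rpow {m : ℕ} (q : ℝ) :
    ContDiffOn ℝ ∞ (fun x : RSpace m => (((‖x‖ ^ 2) ^ (-q) : ℝ) : ℂ)) {x | x ≠ 0} := by
  refine Complex.ofRealCLM.contDiff.comp_contDiffOn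
    (ContDiffOn.rpow_const_of_ne (contDiff_norm_sq ℝ).contDiffOn fun x hx => ?_)
  have : x ≠ 0 := hx
  simpa using this

/-- There are smooth vectors which equal `x_{d+1}^m` near the unit sphere. -/
theorem exists_isSmoothVector_eq_pow (d : ℕ) (mu : ℝ) (m : ℕ) :
    ∃ f : RSpace (d + 1) → ℂ, IsSmoothVector mu f ∧
      ∀ z, ‖z‖ = 1 → f =ᶠ[nhds z] fun x => (x (Fin.last d) : ℂ) ^ m := by
  let b : ContDiffBump (0 : ℝ) := ⟨1 / 4, 1 / 2, by norm_num, by norm_num⟩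
  have hb : ∀ r, 0 < 1 + b r * r := by
    intro r
    by_cases hr : b r = 0
    · rw [hr]; norm_num
    · have h1 : r ∈ Function.support b := hr
      rw [b.support_eq, mem_ball_zero_iff, Real.norm_eq_abs] at h1
      have h1 : |r| < 1 / 2 := h1
      have h2 : |b r * r| ≤ 1 * |r| := by
        rw [abs_mul, abs_of_nonneg b.nonneg]; gcongr; exact b.le_one
      have := (abs_le.1 h2).1
      linarith
  -- Near the unit sphere the first sphere coordinate u₀ is small and 1 + u₀ = 1/τ, with τ the
  -- conformal weight (1 + |x|²)/2. So (1 + u₀)^{-(mu+m)} cancels the powers of τ in τ^{-mu}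
  -- (x_{d+1}/τ)^m. The bump keeps the base positive everywhere.
  let φ : RSpace (d + 1 + 1) → ℂ := fun u =>
    (((1 + b (u 0) * u 0) ^ (-(-(mu + m))) : ℝ) : ℂ)⁻¹ * ((u (Fin.last (d + 1)) ^ m : ℝ) : ℂ)
  have hφ : ContDiff ℝ ∞ φ := by
    have h0 : ContDiff ℝ ∞ fun u : RSpace (d + 1 + 1) => u 0 := by fun_prop
    have hl : ContDiff ℝ ∞ fun u : RSpace (d + 1 + 1) => u (Fin.last (d + 1)) := by fun_prop
    refine ContDiff.mul (ContDiff.inv (Complex.ofRealCLM.contDiff.comp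
      (ContDiff.rpow_const_of_ne (contDiff_const.add ((b.contDiff.comp h0).mul h0))
        fun u => (hb _).ne')) fun u => ?_) (Complex.ofRealCLM.contDiff.comp (hl.pow m))
    exact_mod_cast (Real.rpow_pos_of_pos (hb _) _).ne'
  refine ⟨_, ⟨φ, hφ, fun x => rfl⟩, fun z hz => ?_⟩
  have hu : Filter.Tendsto (fun x : RSpace (d + 1) => (1 - ‖x‖ ^ 2) / 2 / ((1 + ‖x‖ ^ 2) / 2))
      (nhds z) (nhds 0) := by
    have : Continuous fun x : RSpace (d + 1) => (1 - ‖x‖ ^ 2) / 2 / ((1 + ‖x‖ ^ 2) / 2) :=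
      Continuous.div (by fun_prop) (by fun_prop) fun x => by positivity
    have h := this.tendsto z
    simpa [hz] using h
  filter_upwards [hu.eventually b.eventuallyEq_one] with x hx
  have h0 : coneVec x (Sum.inl 0) = (1 - ‖x‖ ^ 2) / 2 := by simp [coneVec]
  have ht : coneVec x (Sum.inr 0) = (1 + ‖x‖ ^ 2) / 2 := by simp [coneVec]
  have hlast : coneVec x (Sum.inl (Fin.last (d + 1))) = x (Fin.last d) := by
    rw [← Fin.succ_last]; simp [coneVec]
  simp only [φ, h0, ht, hlast]
  rw [hx, Pi.one_apply, one_mul]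
  set τ : ℝ := (1 + ‖x‖ ^ 2) / 2 with hτ
  have hτ0 : 0 < τ := by positivity
  have e1 : 1 + (1 - ‖x‖ ^ 2) / 2 / τ = τ⁻¹ := by
    rw [hτ]; field_simp; ring
  rw [e1, neg_neg, Real.inv_rpow hτ0.le, ← Real.rpow_neg hτ0.le, div_pow, Real.rpow_neg hτ0.le,
    Real.rpow_neg hτ0.le, Real.rpow_add hτ0, Real.rpow_natCast]
  have h3 := (Real.rpow_pos_of_pos hτ0 mu).ne'
  push_cast
  have h3' : ((τ ^ mu : ℝ) : ℂ) ≠ 0 := by exact_mod_cast h3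
  have h4' : (τ : ℂ) ≠ 0 := by exact_mod_cast hτ0.ne'
  field_simp

/-- Let all coefficients before k ≥ 1 vanish, put m = j - 2k, and test the relation with the
inversion at a unit vector and f = x_{d+1}^m near the unit sphere. One side is a multiple of δ_k Δ^k
1 = 0. On the other side f has become x_{d+1}^m |x|^{-2(mu+m)}, which gives δ_k m! times a product
with no zero factor. -/
theorem coeff_eq_zero_of_intertwines {d j : ℕ} [NeZero d] {mu : ℝ} (hmu : 0 < mu)
    (hmuj : mu + j < (d : ℝ) / 2) {δ : ℕ → ℂ}
    (hδ : ∀ (h : SO0 d) (f : RSpace (d + 1) → ℂ), IsSmoothVector mu f →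
      ∀ y : RSpace d, confFactor h y ≠ 0 →
      diffOpFun j δ (principalAct mu (extendSO0 d h) f) (incl d y) =
        principalAct (mu + j) h (fun z => diffOpFun j δ f (incl d z)) y)
    (h0 : δ 0 = 0) (k : ℕ) (hk : 2 * k ≤ j) : δ k = 0 := by
  induction k using Nat.strong_induction_on with
  | _ k ih =>
  rcases Nat.eq_zero_or_pos k with rfl | hkpos
  · exact h0
  have hlt : ∀ i < k, δ i = 0 := fun i hi => ih i hi (by omega)
  set m := j - 2 * k with hm
  obtain ⟨f, hf, hfz⟩ := exists_isSmoothVector_eq_pow d mu m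
  set y : RSpace d := unitVec 0 with hy
  have hy1 : ‖y‖ = 1 := by simp [hy]
  have hcf : confFactor (inversion d) y = 1 := by rw [confFactor_inversion, hy1, one_pow]
  have hz1 := norm_confPoint_inversion hy1
  have key := hδ (inversion d) f hf y (by rw [hcf]; exact one_ne_zero)
  have hU : IsOpen {x : RSpace (d + 1) | x ≠ 0} := isOpen_ne
  have hne : ∀ w : RSpace d, ‖w‖ = 1 → incl d w ∈ {x : RSpace (d + 1) | x ≠ 0} := by
    intro w hw h
    have := (incl d).norm_map w
    rw [h, hw] at this
    simp at this
  have hR : diffOpFun j δ f (incl d (confPoint (inversion d) y)) = 0 := by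
    have e : f =ᶠ[nhds (incl d (confPoint (inversion d) y))] fun x =>
        (x (Fin.last d) : ℂ) ^ m * (((‖x‖ ^ 2) ^ (-(0 : ℝ)) : ℝ) : ℂ) := by
      filter_upwards [hfz _ (((incl d).norm_map _).trans hz1)] with x hx
      rw [hx]; simp
    rw [diffOpFun_congr δ e, diffOpFun_last_pow_mul hk hlt hU (contDiffOn_norm_rpow 0)
      (hne _ hz1) (incl_last _), iterate_horLapFun_norm_rpow 0 k hz1,
      Finset.prod_eq_zero (Finset.mem_range.2 hkpos) (by simp)]
    simp
  have hL : diffOpFun j δ (principalAct mu (extendSO0 d (inversion d)) f) (incl d y) =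
      δ k * (m.factorial * ((∏ i ∈ Finset.range k, 2 * ((mu + m) + i) *
        (2 * ((mu + m) + i + 1) - d) : ℝ) : ℂ)) := by
    have hy' : confFactor (extendSO0 d (inversion d)) (incl d y) ≠ 0 := by
      rw [confFactor_extend_incl, hcf]; exact one_ne_zero
    have e : principalAct mu (extendSO0 d (inversion d)) f =ᶠ[nhds (incl d y)] fun x =>
        (x (Fin.last d) : ℂ) ^ m * (((‖x‖ ^ 2) ^ (-(mu + m)) : ℝ) : ℂ) := by
      have hc := (contDiffAt_confPoint hy').continuousAt.eventually (by
        rw [confPoint_extend_incl]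
        exact hfz _ (((incl d).norm_map _).trans hz1))
      filter_upwards [hc, hU.mem_nhds (hne y hy1)] with x hx hx0
      have hx0' : 0 < ‖x‖ ^ 2 := by
        have : x ≠ 0 := hx0
        positivity
      rw [principalAct, hx, confPoint_extend_last, confFactor_extend_inversion, neg_add,
        Real.rpow_add hx0', Real.rpow_neg hx0'.le (m : ℝ), Real.rpow_natCast]
      push_cast
      rw [div_pow]
      ring
    rw [diffOpFun_congr δ e, diffOpFun_last_pow_mul hk hlt hU (contDiffOn_norm_rpow _)
      (hne _ hy1) (incl_last _), iterate_horLapFun_norm_rpow _ k hy1]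
  rw [hL, principalAct, hR, mul_zero] at key
  refine (mul_eq_zero.1 key).resolve_right (mul_ne_zero ?_ ?_)
  · exact_mod_cast m.factorial_ne_zero
  · rw [Complex.ofReal_ne_zero, Finset.prod_ne_zero_iff]
    intro i hi
    have hi' : i + 1 ≤ k := Finset.mem_range.1 hi
    -- As i < k, also m + i + 1 ≤ j - 2k + k ≤ j. So 2(mu + m + i + 1) ≤ 2(mu + j) < d, and the
    -- second factor is negative.
    have h1 : (m : ℝ) + i + 1 ≤ j := by
      have : m + i + 1 ≤ j := by omega
      exact_mod_cast this
    have h2 : (0 : ℝ) ≤ m := m.cast_nonneg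
    have h3 : (0 : ℝ) ≤ i := i.cast_nonneg
    refine mul_ne_zero (by positivity) (ne_of_lt ?_)
    linarith

end Uniqueness

/-! ### The discrete component of the restricted representation. -/

section MainTheorem

variable {d j : ℕ} {mu lam lam' : ℝ}

theorem diffOpFun_sub_const_mul (j : ℕ) (C p : ℕ → ℂ) (r : ℂ) (f : RSpace (d + 1) → ℂ)
    (x : RSpace (d + 1)) :
    diffOpFun j (fun k => C k - r * p k) f x = diffOpFun j C f x - r * diffOpFun j p f x := by
  simp only [diffOpFun, Finset.sum_apply, Pi.smul_apply, smul_eq_mul, Finset.mul_sum, sub_mul,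
    Finset.sum_sub_distrib, mul_assoc]

theorem diffOpFun_const_mul (j : ℕ) (p : ℕ → ℂ) (r : ℂ) (f : RSpace (d + 1) → ℂ)
    (x : RSpace (d + 1)) :
    diffOpFun j (fun k => r * p k) f x = r * diffOpFun j p f x := by
  simp only [diffOpFun, Finset.sum_apply, Pi.smul_apply, smul_eq_mul, Finset.mul_sum, mul_assoc]

theorem breakNu_pos (H : BreakParams d j mu lam lam') : 0 < breakNu d mu := by
  have := H.mu_add_lt
  have : (0 : ℝ) ≤ j := j.cast_nonneg
  rw [breakNu]; linarith

variable [NeZero d]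

/-- If the leading coefficient vanished, uniqueness would make all of them vanish, against
`exists_breakCoeff_ne_zero`. It permits the normalization C 0 = 1. -/
theorem breakCoeff_zero_ne (H : BreakParams d j mu lam lam') :
    (breakCoeff (breakNu d mu) j 0 : ℂ) ≠ 0 := fun h0 => by
  obtain ⟨k, hk, hk0⟩ := exists_breakCoeff_ne_zero (j := j) (breakNu_pos H)
  refine hk0 (Complex.ofReal_eq_zero.1 ?_)
  exact coeff_eq_zero_of_intertwines (δ := fun k => (breakCoeff (breakNu d mu) j k : ℂ))
    H.mu_pos H.mu_add_lt (fun h f hf y hy => breakOp_intertwines H h hf.contDiff y hy) h0 k hk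

theorem isIntertwiningCoeff_breakCoeff (H : BreakParams d j mu lam lam') :
    IsIntertwiningCoeff d mu j fun k =>
      (breakCoeff (breakNu d mu) j 0 : ℂ)⁻¹ * (breakCoeff (breakNu d mu) j k : ℂ) where
  normalized := inv_mul_cancel₀ (breakCoeff_zero_ne H)
  intertwines h f hf y hy := by
    have := breakOp_intertwines H h hf.contDiff y hy
    simp only [breakOp, diffOpFun_const_mul, principalAct] at this ⊢
    rw [this]
    ring

/-- The difference of the two normalized operators intertwines and has leading coefficient 0. -/
theorem IsIntertwiningCoeff.eq (H : BreakParams d j mu lam lam') {C : ℕ → ℂ}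
    (hC : IsIntertwiningCoeff d mu j C) {k : ℕ} (hk : 2 * k ≤ j) :
    C k = (breakCoeff (breakNu d mu) j 0 : ℂ)⁻¹ * (breakCoeff (breakNu d mu) j k : ℂ) := by
  refine sub_eq_zero.1 (coeff_eq_zero_of_intertwines (δ := fun k => C k -
    (breakCoeff (breakNu d mu) j 0 : ℂ)⁻¹ * (breakCoeff (breakNu d mu) j k : ℂ))
    H.mu_pos H.mu_add_lt (fun h f hf y hy => ?_) ?_ k hk)
  · have h1 := breakOp_intertwines H h hf.contDiff y hy
    have h2 := hC.intertwines h f hf y hy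
    simp only [breakOp, diffOpFun_sub_const_mul, principalAct] at h1 h2 ⊢
    rw [h1, h2]
    ring
  · simp only [hC.normalized, inv_mul_cancel₀ (breakCoeff_zero_ne H), sub_self]

theorem breakMul_congr (H : BreakParams d j mu lam lam') {q q' : ℕ → ℂ}
    (h : ∀ k, 2 * k ≤ j → q k = q' k) : breakMul H q = breakMul H q' := by
  ext1 v
  refine CSpace.ext_volume ?_
  filter_upwards [breakMul_coe H q v, breakMul_coe H q' v] with ζ h1 h2
  rw [h1, h2]
  congr 1
  refine Finset.sum_congr rfl fun k hk => ?_
  have := Finset.mem_range.1 hk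
  rw [h k (by omega)]

/-- The operator of symmetry breaking in the Fourier picture intertwines the complementary
series. -/
theorem IsIntertwiningCoeff.breakMul_compSeries (H : BreakParams d j mu lam lam') {C : ℕ → ℂ}
    (hC : IsIntertwiningCoeff d mu j C) (z : ℂ) (h : SO0 d) (v : CSpace d lam') :
    breakMul H (fun k => z * C k) (compSeries d lam' h v) =
      compSeries (d + 1) lam (extendSO0 d h) (breakMul H (fun k => z * C k) v) := by
  have e : breakMul H (fun k => z * C k) =
      breakMul H ((z * (breakCoeff (breakNu d mu) j 0 : ℂ)⁻¹) •
        fun k => (breakCoeff (breakNu d mu) j k : ℂ)) :=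
    breakMul_congr H fun k hk => by
      rw [hC.eq H hk, Pi.smul_apply, smul_eq_mul, mul_assoc]
  rw [e, breakMul_smul, breakMul_smul, _root_.breakMul_compSeries, map_smul]

theorem nontrivial_cspace (h1 : (d : ℝ) / 2 < lam) (h2 : lam < d) : Nontrivial (CSpace d lam) := by
  obtain ⟨f, hf, hs, hne⟩ := exists_bump_fourier_ne_zero (W := RSpace d) one_pos
  refine ⟨csFourier h1 h2 (testDecay lam hf hs), 0, fun h => ?_⟩
  have h0 := (absolutelyContinuous_csMeasure d lam).ae_eq (Lp.coeFn_zero ℂ 2 (csMeasure d lam))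
  have hae : ∀ᵐ ξ : RSpace d, ξ ∉ Metric.ball (0 : RSpace d) 1 := by
    have hco := csFourier_coe h1 h2 (testDecay lam hf hs)
    rw [h] at hco
    filter_upwards [hco, h0] with ξ e1 e2 hξ
    rw [e2] at e1
    exact hne ξ (mem_ball_zero_iff.1 hξ).le e1.symm
  have h3 : volume (Metric.ball (0 : RSpace d) 1) = 0 := measure_eq_zero_iff_ae_notMem.2 hae
  exact (Metric.measure_ball_pos volume (0 : RSpace d) one_pos).ne' h3

/-- The discrete component of the restriction of the complementary series. -/
theorem IsIntertwiningCoeff.exists_subrepresentation (H : BreakParams d j mu lam lam')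
    {C : ℕ → ℂ} (hC : IsIntertwiningCoeff d mu j C) :
    ∃ (W : Submodule ℂ (CSpace (d + 1) lam)) (e : CSpace d lam' ≃ₗᵢ[ℂ] W) (c : ℝ),
      IsClosed (W : Set (CSpace (d + 1) lam)) ∧ W ≠ ⊥ ∧
      (∀ (h : SO0 d), ∀ w ∈ W, compSeries (d + 1) lam (extendSO0 d h) w ∈ W) ∧
      (∀ (h : SO0 d) (f : CSpace d lam'),
        (e (compSeries d lam' h f) : CSpace (d + 1) lam) =
          compSeries (d + 1) lam (extendSO0 d h) (e f)) ∧
      0 < c ∧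
      (∀ f : CSpace d lam', diffOpDist j C (tensorDelta (toDist f)) =
        (c : ℂ) • toDist (e f : CSpace (d + 1) lam)) ∧
      toDist '' (W : Set (CSpace (d + 1) lam)) =
        {F | ∃ f : CSpace d lam', F = diffOpDist j C (tensorDelta (toDist f))} := by
  set z : ℂ := (2 * Real.pi * Complex.I) ^ j with hz
  have hz0 : z ≠ 0 := pow_ne_zero _ Complex.two_pi_I_ne_zero
  set q : ℕ → ℂ := fun k => z * C k with hq
  set c : ℝ := Real.sqrt (symbConst j (((d + 1 : ℕ) : ℝ) - 2 * lam) q) with hc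
  -- The symbol is not identically zero because its coefficient at k = 0 is (2πi)^j.
  have hc0 : 0 < c := Real.sqrt_pos.2 <| symbConst_pos H.exponent_lt (k := 0) (by simp)
    (by simpa [hq, hC.normalized] using hz0)
  have hcC : (c : ℂ) ≠ 0 := Complex.ofReal_ne_zero.2 hc0.ne'
  let ι : CSpace d lam' →ₗᵢ[ℂ] CSpace (d + 1) lam :=
    { toLinearMap := (c : ℂ)⁻¹ • breakMul H q
      norm_map' := fun v => by
        rw [LinearMap.smul_apply, norm_smul, norm_breakMul, ← hc, norm_inv,
          Complex.norm_of_nonneg hc0.le, inv_mul_cancel_left₀ hc0.ne'] }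
  have hι : ∀ v, ι v = (c : ℂ)⁻¹ • breakMul H q v := fun _ => rfl
  have hιU : ∀ h v, ι (compSeries d lam' h v) =
      compSeries (d + 1) lam (extendSO0 d h) (ι v) := fun h v => by
    rw [hι, hι, hC.breakMul_compSeries H, map_smul]
  have h2 : ((d + 1 : ℕ) : ℝ) ≤ 2 * lam := by have := H.half_lt; linarith
  have hdist : ∀ f : CSpace d lam', diffOpDist j C (tensorDelta (toDist f)) =
      (c : ℂ) • toDist (ι f) := fun f => by
    rw [diffOpDist_tensorDelta H, ← toDist_smul h2, hι, smul_inv_smul₀ hcC]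
  refine ⟨LinearMap.range ι.toLinearMap, ι.equivRange, c, ?_, ?_, ?_, hιU, hc0, hdist, ?_⟩
  · rw [LinearMap.coe_range]
    exact ι.isometry.isClosedEmbedding.isClosed_range
  · have := nontrivial_cspace H.half_lt' H.lt'
    obtain ⟨v, hv⟩ := exists_ne (0 : CSpace d lam')
    refine fun hbot => hv (ι.injective ?_)
    rw [map_zero]
    exact (Submodule.mem_bot ℂ).1 (hbot ▸ LinearMap.mem_range_self ι.toLinearMap v)
  · rintro h _ ⟨v, rfl⟩
    exact ⟨compSeries d lam' h v, hιU h v⟩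
  · ext F
    constructor
    · rintro ⟨_, ⟨v, rfl⟩, rfl⟩
      -- The scalar c between the isometry and the differential operator is absorbed in f, so both
      -- families of distributions coincide.
      refine ⟨(c : ℂ)⁻¹ • v, ?_⟩
      rw [hdist, ← toDist_smul h2, map_smul, smul_inv_smul₀ hcC]
      rfl
    · rintro ⟨f, rfl⟩
      refine ⟨ι ((c : ℂ) • f), ⟨_, rfl⟩, ?_⟩
      rw [hdist, map_smul, toDist_smul h2]

end MainTheorem

theorem corollary6p3 (n d : ℕ) (hn : 2 < n) (hd : n = d + 2) (mu : ℝ) (j : ℕ)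
    (hmu0 : 0 < mu) (hmu : mu < ((n : ℝ) - 1) / 2) (hj : mu + j < ((n : ℝ) - 2) / 2) :
    IsCompSeries (d + 1) (n - 1 - mu) (compSeries (d + 1) (n - 1 - mu)) ∧
    IsCompSeries d (n - 2 - (mu + j)) (compSeries d (n - 2 - (mu + j))) ∧
    (∃ C, IsIntertwiningCoeff d mu j C) ∧
    ∀ C, IsIntertwiningCoeff d mu j C →
      ∃ (W : Submodule ℂ (CSpace (d + 1) (n - 1 - mu)))
        (e : CSpace d (n - 2 - (mu + j)) ≃ₗᵢ[ℂ] W) (c : ℝ),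
        IsClosed (W : Set (CSpace (d + 1) (n - 1 - mu))) ∧ W ≠ ⊥ ∧
        (∀ (h : SO0 d), ∀ w ∈ W, compSeries (d + 1) (n - 1 - mu) (extendSO0 d h) w ∈ W) ∧
        (∀ (h : SO0 d) (f : CSpace d (n - 2 - (mu + j))),
          (e (compSeries d (n - 2 - (mu + j)) h f) : CSpace (d + 1) (n - 1 - mu)) =
            compSeries (d + 1) (n - 1 - mu) (extendSO0 d h) (e f)) ∧
        0 < c ∧
        (∀ f : CSpace d (n - 2 - (mu + j)),
          diffOpDist j C (tensorDelta (toDist f)) =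
            (c : ℂ) • toDist (e f : CSpace (d + 1) (n - 1 - mu))) ∧
        toDist '' (W : Set (CSpace (d + 1) (n - 1 - mu))) =
          {F | ∃ f : CSpace d (n - 2 - (mu + j)),
            F = diffOpDist j C (tensorDelta (toDist f))} := by
  subst hd
  -- From n > 2 one has d ≥ 1, so that points are null sets in ℝ^d.
  have : NeZero d := ⟨by omega⟩
  have hmul : mu + (j : ℝ) < (d : ℝ) / 2 := by push_cast at hj; linarith
  have H : BreakParams d j mu (((d + 2 : ℕ) : ℝ) - 1 - mu) (((d + 2 : ℕ) : ℝ) - 2 - (mu + j)) :=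
    { mu_pos := hmu0
      mu_add_lt := hmul
      lam_add := by push_cast; ring
      lam_add' := by push_cast; ring }
  exact ⟨isCompSeries_compSeries H.half_lt H.lt, isCompSeries_compSeries H.half_lt' H.lt',
    ⟨_, isIntertwiningCoeff_breakCoeff H⟩, fun C hC => hC.exists_subrepresentation H⟩
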